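/- Setting. Let $L=(L(t))_{t\in\mathbb R}$ be a two-sided $\mathbb R^m$-valued Lévy process (càdlàg paths, stationary and independent increments, $L(0)=0$ a.s.) with $\mathbb E L(1)=0$, $\mathbb E\|L(1)\|^2<\infty$ and non-singular $\mathbb E[L(1)L(1)^{\mathsf T}]$. A state-space model $(A,B,C,L)$ of dimension $N$, with $A\in\mathbb R^{N\times N}$, $B\in\mathbb R^{N\times m}$, $C\in\mathbb R^{d\times N}$, is given for $t\ge t_0\ge 0$ by $dX(t)=AX(t)\,dt+B\,dL(t)$, i.e. $X(t)=X(t_0)+\int_{t_0}^tAX(s)\,ds+B(L(t)-L(t_0))$, and $Y(t)=CX(t)$. Its transfer function is $k(z)=C(zI_N-A)^{-1}B$. The model is minimal if no triple of smaller dimension has the same transfer function. Two minimal models are observationally equivalent if their transfer functions coincide. A canonical form for stationary models is a condition on triples $(A,B,C)$ such that every minimal triple $(A,B,C)$ with $\sigma(A)\subset(-\infty,0)+i\mathbb R$ is observationally equivalent to exactly one minimal triple of the same dimension satisfying the condition (the echelon form is an example); fix any such canonical form. A matrix $M\in\mathbb R^{d\times c}$ is positive lower triangular if there are $1\le j_1<\dots<j_c\le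 d$ such that, for each $i$, $M_{j_i,i}>0$ and $M_{k,i}=0$ for $k<j_i$. For deterministic square-integrable $f$, $\int f\,dL$ is the $L^2$-limit of the integrals of step functions converging to $f$ in $L^2(\mathbb R)$. Theorem. Let $(A,B,C,L)$ be a minimal state-space model of dimension $N$ with $\sigma(A)\subset\{(-\infty,0)+i\mathbb R\}\cup\{0\}$, where the algebraic and the geometric multiplicity of $0$ as an eigenvalue of $A$ are both equal to $c$, $0\le c\le d$. Then there are unique matrices $A_2\in\mathbb R^{(N-c)\times(N-c)}$, $B_1\in\mathbb R^{c\times m}$, $B_2\in\mathbb R^{(N-c)\times m}$, $C_1\in\mathbb R^{d\times c}$, $C_2\in\mathbb R^{d\times(N-c)}$ such that the model $$\begin{pmatrix}dX_1(t)\\dX_2(t)\end{pmatrix}=\begin{pmatrix}0&0\\0&A_2\end{pmatrix}\begin{pmatrix}X_1(t)\\X_2(t)\end{pmatrix}dt+\begin{pmatrix}B_1\\B_2\end{pmatrix}dL(t),\qquad Y(t)=C_1X_1(t)+C_2X_2(t),\quad t\ge t_0,$$ is minimal and observationally equivalent to $(A,B,C,L)$, and 1. every eigenvalue of $\exp(A_2)$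 has modulus less than $1$; 2. $C_1^{\mathsf T}C_1=I_c$ and $C_1$ is positive lower triangular; 3. $(A_2,B_2,C_2)$ is in the given canonical form ($B_1$ is not restricted further). For every $t_0\ge 0$, the two models have the same output processes $Y=(Y(t))_{t\ge t_0}$. Moreover, $C_1B_1L$ is a Lévy process; the integral $Z(t)=\int_{-\infty}^te^{A_2(t-u)}B_2\,dL(u)$ exists for all $t\in\mathbb R$; and the processes $Z$ and $C_2Z$ are strictly stationary. For every $t_0\ge0$ and every random vector $\xi$ in $\mathbb R^c$ the decoupled state equation has a solution with $X_1(t_0)=\xi$ and $X_2(t_0)=Z(t_0)$ a.s. Whenever $X_2(t_0)=Z(t_0)$ a.s., one has for every $t\ge t_0$, almost surely, $X_2(t)=Z(t)$ and $$Y(t)=C_1X_1(t_0)+C_1B_1\bigl(L(t)-L(t_0)\bigr)+C_2\int_{-\infty}^te^{A_2(t-u)}B_2\,dL(u),$$ which for $t_0=0$ reads $Y(t)=C_1X_1(0)+C_1B_1L(t)+C_2\int_{-\infty}^te^{A_2(t-u)}B_2\,dL(u)$. -/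

import Mathlib

open MeasureTheory ProbabilityTheory Filter Topology
open scoped Matrix ENNReal

noncomputable section

/-! ### State-space models -/

/-- The matrices `(A, B, C)` of a state-space model `dX = A X dt + B dL`, `Y = C X` with output
dimension `d`, input dimension `m` and state coordinates indexed by `ι`. -/
@[ext]
structure StateSpaceModel (d m : ℕ) (ι : Type) where
  A : Matrix ι ι ℝ
  B : Matrix ι (Fin m) ℝ
  C : Matrix (Fin d) ι ℝ

namespace StateSpaceModel

/-- The transfer function `k(z) = C (z I - A)⁻¹ B`, a matrix of real rational functions. -/
def transferFunction {d m : ℕ} {ι : Type} [Fintype ι] [DecidableEq ι]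
    (S : StateSpaceModel d m ι) : Matrix (Fin d) (Fin m) (RatFunc ℝ) :=
  S.C.map (algebraMap ℝ (RatFunc ℝ)) *
    ((RatFunc.X : RatFunc ℝ) • (1 : Matrix ι ι (RatFunc ℝ)) -
      S.A.map (algebraMap ℝ (RatFunc ℝ)))⁻¹ *
    S.B.map (algebraMap ℝ (RatFunc ℝ))

/-- Minimality: no algebraic realization of the same transfer function has smaller dimension. -/
def IsMinimal {d m : ℕ} {ι : Type} [Fintype ι] [DecidableEq ι]
    (S : StateSpaceModel d m ι) : Prop :=
  ∀ (n : ℕ) (S' : StateSpaceModel d m (Fin n)),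
    S'.transferFunction = S.transferFunction → Fintype.card ι ≤ n

/-- Observational equivalence of two minimal models: they have the same transfer function. -/
def ObsEquiv {d m : ℕ} {ι κ : Type} [Fintype ι] [DecidableEq ι] [Fintype κ] [DecidableEq κ]
    (S : StateSpaceModel d m ι) (S' : StateSpaceModel d m κ) : Prop :=
  S.IsMinimal ∧ S'.IsMinimal ∧ S.transferFunction = S'.transferFunction

/-- All complex eigenvalues of `A` lie in the open left half-plane. -/
def IsStable {d m : ℕ} {ι : Type} [Fintype ι] [DecidableEq ι]
    (S : StateSpaceModel d m ι) : Prop :=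
  ∀ μ ∈ spectrum ℂ (S.A.map (algebraMap ℝ ℂ)), μ.re < 0

end StateSpaceModel

/-- A canonical form for stationary (i.e. stable) minimal models: a condition that is satisfied by
exactly one representative of each class of observationally equivalent models. -/
def IsCanonicalForm {d m : ℕ} (K : ∀ n : ℕ, StateSpaceModel d m (Fin n) → Prop) : Prop :=
  ∀ (n : ℕ) (S : StateSpaceModel d m (Fin n)), S.IsMinimal → S.IsStable →
    ∃! S' : StateSpaceModel d m (Fin n), S.ObsEquiv S' ∧ K n S'

/-- Canonical forms exist. -/
theorem exists_isCanonicalForm (d m : ℕ) :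
    ∃ K : ∀ n : ℕ, StateSpaceModel d m (Fin n) → Prop, IsCanonicalForm K := by
  classical
  have hne : ∀ n : ℕ, Nonempty (StateSpaceModel d m (Fin n)) := fun n => ⟨⟨0, 0, 0⟩⟩
  refine ⟨fun n S' => S' = @Classical.epsilon _ (hne n) (fun T : StateSpaceModel d m (Fin n) =>
    T.IsMinimal ∧ T.transferFunction = S'.transferFunction), fun n S hS _ => ?_⟩
  obtain ⟨h1, h2⟩ := @Classical.epsilon_spec _ (fun T : StateSpaceModel d m (Fin n) =>
    T.IsMinimal ∧ T.transferFunction = S.transferFunction) ⟨S, hS, rfl⟩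
  refine ⟨_, ⟨⟨hS, h1, h2.symm⟩, ?_⟩, ?_⟩
  · beta_reduce
    rw [h2]
  · rintro y ⟨⟨-, -, hy⟩, hy'⟩
    rw [← hy] at hy'
    exact hy'

/-- `M` is positive lower triangular: there are row indices `j₁ < ⋯ < j_c` such that in column `i`
the first non-zero entry stands in row `jᵢ` and is positive. -/
def IsPositiveLowerTriangular {d c : ℕ} (M : Matrix (Fin d) (Fin c) ℝ) : Prop :=
  ∃ j : Fin c → Fin d, StrictMono j ∧ ∀ i, 0 < M (j i) i ∧ ∀ k < j i, M k i = 0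

/-- The matrices of a decoupled model `dX₁ = B₁ dL`, `dX₂ = A₂ X₂ dt + B₂ dL`,
`Y = C₁ X₁ + C₂ X₂`, with `X₁` of dimension `c` and `X₂` of dimension `n`. -/
@[ext]
structure DecoupledModel (d m c n : ℕ) where
  A₂ : Matrix (Fin n) (Fin n) ℝ
  B₁ : Matrix (Fin c) (Fin m) ℝ
  B₂ : Matrix (Fin n) (Fin m) ℝ
  C₁ : Matrix (Fin d) (Fin c) ℝ
  C₂ : Matrix (Fin d) (Fin n) ℝ

namespace DecoupledModel

variable {d m c n : ℕ}

/-- The state-space model `(diag(0, A₂), (B₁; B₂), (C₁, C₂))` on `ℝᶜ × ℝⁿ`. -/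
def toModel (M : DecoupledModel d m c n) : StateSpaceModel d m (Fin c ⊕ Fin n) where
  A := Matrix.fromBlocks 0 0 0 M.A₂
  B := Matrix.fromRows M.B₁ M.B₂
  C := Matrix.fromCols M.C₁ M.C₂

/-- The subsystem `(A₂, B₂, C₂)`. -/
def stablePart (M : DecoupledModel d m c n) : StateSpaceModel d m (Fin n) where
  A := M.A₂
  B := M.B₂
  C := M.C₂

/-- The decoupled model `M` is a canonical form of the model `S`, relative to the canonical
form `K` for stationary models. -/
structure IsCanonicalFormOf (M : DecoupledModel d m c n)
    (K : ∀ n : ℕ, StateSpaceModel d m (Fin n) → Prop)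
    {ι : Type} [Fintype ι] [DecidableEq ι] (S : StateSpaceModel d m ι) : Prop where
  obsEquiv : S.ObsEquiv M.toModel
  exp_lt_one : ∀ μ ∈ spectrum ℂ ((NormedSpace.exp M.A₂).map (algebraMap ℝ ℂ)), ‖μ‖ < 1
  orthonormal : M.C₁ᵀ * M.C₁ = 1
  positiveLowerTriangular : IsPositiveLowerTriangular M.C₁
  canonical : K n M.stablePart

end DecoupledModel

/-! ### Lévy processes -/

/-- Right-continuous with left limits. -/
def IsCadlag {E : Type*} [TopologicalSpace E] (f : ℝ → E) : Prop :=
  ∀ t, ContinuousWithinAt f (Set.Ici t) t ∧ ∃ l, Tendsto f (𝓝[<] t) (𝓝 l)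

/-- A two-sided Lévy process `(L(t))_{t ∈ ℝ}` with values in `ℝᵏ`. -/
structure IsLevy {k : ℕ} {Ω : Type*} [MeasurableSpace Ω] (L : ℝ → Ω → Fin k → ℝ)
    (P : Measure Ω) : Prop where
  measurable : ∀ t, Measurable (L t)
  zero : ∀ᵐ ω ∂P, L 0 ω = 0
  indepIncrements : HasIndepIncrements L P
  stationaryIncrements : ∀ s t h : ℝ,
    IdentDistrib (fun ω => L (t + h) ω - L (s + h) ω) (fun ω => L t ω - L s ω) P P
  cadlag : ∀ᵐ ω ∂P, IsCadlag fun t => L t ω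

/-- A Lévy process with `E L(1) = 0`, `E ‖L(1)‖² < ∞` and non-singular covariance matrix
`E[L(1) L(1)ᵀ]`. -/
structure IsDrivingLevy {k : ℕ} {Ω : Type*} [MeasurableSpace Ω] (L : ℝ → Ω → Fin k → ℝ)
    (P : Measure Ω) : Prop where
  isLevy : IsLevy L P
  memLp : MemLp (L 1) 2 P
  mean_zero : ∫ ω, L 1 ω ∂P = 0
  cov_nonsingular :
    (Matrix.of fun i j : Fin k => ∫ ω, L 1 ω i * L 1 ω j ∂P).det ≠ 0

/-! ### Stochastic integrals of deterministic functions -/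

/-- A step function `∑ᵢ wᵢ 1_{(aᵢ, bᵢ]}` on the real line. -/
structure StepFn where
  size : ℕ
  a : Fin size → ℝ
  b : Fin size → ℝ
  w : Fin size → ℝ
  le : ∀ i, a i ≤ b i

namespace StepFn

/-- The step function as a function. -/
def toFun (g : StepFn) (u : ℝ) : ℝ :=
  ∑ i, (Set.Ioc (g.a i) (g.b i)).indicator (fun _ => g.w i) u

/-- `∫ g dℓ = ∑ᵢ wᵢ (ℓ(bᵢ) - ℓ(aᵢ))`. -/
def integral {Ω : Type*} (g : StepFn) (ℓ : ℝ → Ω → ℝ) (ω : Ω) : ℝ :=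
  ∑ i, g.w i * (ℓ (g.b i) ω - ℓ (g.a i) ω)

end StepFn

/-- `J = ∫ f dℓ` over the real line: `J` is the `L²(P)`-limit of `∫ gₖ dℓ` for all sequences of
step functions `gₖ → f` in `L²(ℝ)`. -/
def HasStochIntegral {Ω : Type*} [MeasurableSpace Ω] (P : Measure Ω) (ℓ : ℝ → Ω → ℝ)
    (f : ℝ → ℝ) (J : Ω → ℝ) : Prop :=
  MemLp f 2 volume ∧ MemLp J 2 P ∧ ∀ g : ℕ → StepFn,
    Tendsto (fun k => eLpNorm (fun u => f u - (g k).toFun u) 2 volume) atTop (𝓝 0) →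
    Tendsto (fun k => eLpNorm (fun ω => J ω - (g k).integral ℓ ω) 2 P) atTop (𝓝 0)

/-- `I = ∫ F dL` for a matrix-valued `F`: almost surely `Iᵢ = ∑ⱼ ∫ Fᵢⱼ dLⱼ` for all `i`. -/
def HasLevyIntegral {n k : ℕ} {Ω : Type*} [MeasurableSpace Ω] (P : Measure Ω)
    (L : ℝ → Ω → Fin k → ℝ) (F : ℝ → Matrix (Fin n) (Fin k) ℝ) (I : Ω → Fin n → ℝ) : Prop :=
  ∃ J : Fin n → Fin k → Ω → ℝ,
    (∀ i j, HasStochIntegral P (fun t ω => L t ω j) (fun u => F u i j) (J i j)) ∧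
    ∀ᵐ ω ∂P, ∀ i, I ω i = ∑ j, J i j ω

/-- `I = ∫_{-∞}^t F(u) dL(u)`. -/
def HasLevyIntegralIic {n k : ℕ} {Ω : Type*} [MeasurableSpace Ω] (P : Measure Ω)
    (L : ℝ → Ω → Fin k → ℝ) (t : ℝ) (F : ℝ → Matrix (Fin n) (Fin k) ℝ)
    (I : Ω → Fin n → ℝ) : Prop :=
  HasLevyIntegral P L ((Set.Iic t).indicator F) I

/-- Strict stationarity: the finite-dimensional distributions are invariant under time shifts. -/
def IsStrictlyStationary {n : ℕ} {Ω : Type*} [MeasurableSpace Ω] (P : Measure Ω)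
    (Z : ℝ → Ω → Fin n → ℝ) : Prop :=
  ∀ (k : ℕ) (t : Fin k → ℝ) (h : ℝ),
    IdentDistrib (fun ω i => Z (t i + h) ω) (fun ω i => Z (t i) ω) P P

/-! ### Solutions of the state and observation equations -/

namespace StateSpaceModel

variable {d m : ℕ} {ι : Type} [Fintype ι] [DecidableEq ι]

/-- `(X(t))_{t ≥ t₀}` solves `dX = A X dt + B dL`, i.e. almost surely
`X(t) = X(t₀) + ∫_{t₀}^t A X(s) ds + B (L(t) - L(t₀))` for all `t ≥ t₀`. -/
def IsStateSolution (S : StateSpaceModel d m ι) {Ω : Type*} [MeasurableSpace Ω] (P : Measure Ω)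
    (L : ℝ → Ω → Fin m → ℝ) (t₀ : ℝ) (X : ℝ → Ω → ι → ℝ) : Prop :=
  (∀ t, t₀ ≤ t → Measurable (X t)) ∧
  ∀ᵐ ω ∂P, ∀ t, t₀ ≤ t →
    IntervalIntegrable (fun s => X s ω) volume t₀ t ∧
    X t ω = X t₀ ω + (∫ s in t₀..t, S.A *ᵥ X s ω) + S.B *ᵥ (L t ω - L t₀ ω)

/-- `(Y(t))_{t ≥ t₀}` is the output `Y = C X` of the state process `(X(t))_{t ≥ t₀}`. -/
def IsOutputOf (S : StateSpaceModel d m ι) {Ω : Type*} [MeasurableSpace Ω] (P : Measure Ω)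
    (t₀ : ℝ) (X : ℝ → Ω → ι → ℝ) (Y : ℝ → Ω → Fin d → ℝ) : Prop :=
  ∀ᵐ ω ∂P, ∀ t, t₀ ≤ t → Y t ω = S.C *ᵥ X t ω

/-- `(Y(t))_{t ≥ t₀}` is an output process of the state-space model `(A, B, C, L)`. -/
def IsOutput (S : StateSpaceModel d m ι) {Ω : Type*} [MeasurableSpace Ω] (P : Measure Ω)
    (L : ℝ → Ω → Fin m → ℝ) (t₀ : ℝ) (Y : ℝ → Ω → Fin d → ℝ) : Prop :=
  ∃ X : ℝ → Ω → ι → ℝ, S.IsStateSolution P L t₀ X ∧ S.IsOutputOf P t₀ X Y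

end StateSpaceModel

end

/-!
The theorem combines realization theory for the matrices with the calculus of Lévy-driven linear
equations.

*Canonical form.* A transfer function is the same thing as the sequence of Markov parameters
`C Aᵏ B`, by a valuation argument at infinity. Hence two minimal models with the same transfer
function differ by a change of basis (`StateSpaceModel.ObsEquiv.exists_iso`), and in particular have
the same outputs. Since `0` is a semisimple eigenvalue, the state space is the direct sum of the
kernel and the range of `A`, which decouples the model
(`DecoupledModel.exists_toModel_obsEquiv`). The Markov parameters of positive order depend only on
the stable part `(A₂, B₂, C₂)`, and since `A₂` is invertible they also determine `C₂ B₂`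
(`DecoupledModel.markov_stablePart_zero_eq`). So the transfer function determines the class of the
stable part, which has one representative in the given canonical form, and the product `C₁ B₁`, which
has rank `c` by minimality. Its range has exactly one positive lower triangular orthonormal
basis (`exists_positiveLowerTriangular_basis`, `IsPositiveLowerTriangular.eq_of_eq_mul`); this is
`C₁`, and `B₁ = C₁ᵀ (C₁ B₁)`.

*Stationary solution.* The increments of a component `ℓ` of `L` satisfy
`E (ℓ(t) - ℓ(s))² = σ |t - s|` (`exists_isL2Noise`), which gives the isometry and the integral of
square-integrable functions. The eigenvalues of `exp A₂` lie in the open unit disc, so the kernel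
`exp (A₂ (t - u)) B₂` decays exponentially and `Z` exists. It is strictly stationary as a limit in
probability of step function integrals, the joint laws of which are invariant under time shifts
(`isStrictlyStationary_of_movingAverage`).

*Representation.* Along each càdlàg path of `L`, the equation for `X₂` is solved by the formula of
variation of constants, in which the integral against `dL` is integrated by parts, so that no
stochastic integral is left (`eq_variation_of_constants`). Integrating by parts in the definition of
`Z` shows that `Z` obeys the same formula almost surely
(`HasLevyIntegralIic.ae_eq_variation_of_constants`). Hence `X₂(t) = Z(t)` as soon as `X₂(t₀) = Z(t₀)`,
while `X₁(t) = X₁(t₀) + B₁ (L(t) - L(t₀))` is immediate.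
-/

noncomputable section

/-! ### Transfer functions and Markov parameters -/

namespace StateSpaceModel

open RatFunc WithZero

section Resolvent

variable {d m : ℕ} {ι κ : Type} [Fintype ι] [DecidableEq ι] [Fintype κ] [DecidableEq κ]

/-- The Markov parameters `C Aᵏ B`, the coefficients of the transfer function at infinity. -/
def markov (S : StateSpaceModel d m ι) (k : ℕ) : Matrix (Fin d) (Fin m) ℝ :=
  S.C * S.A ^ k * S.B

/-- The pencil `z I - A` over the field of rational functions. -/
def pencil (A : Matrix ι ι ℝ) : Matrix ι ι (RatFunc ℝ) :=
  (RatFunc.X : RatFunc ℝ) • (1 : Matrix ι ι (RatFunc ℝ)) - A.map (algebraMap ℝ (RatFunc ℝ))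

lemma isUnit_det_pencil (A : Matrix ι ι ℝ) : IsUnit (pencil A).det := by
  have h : pencil A = A.charmatrix.map (algebraMap (Polynomial ℝ) (RatFunc ℝ)) := by
    ext i j
    by_cases hij : i = j
    · subst hij
      simp [pencil, Matrix.charmatrix_apply_eq, RatFunc.algebraMap_eq_C]
    · simp [pencil, hij, RatFunc.algebraMap_eq_C]
  rw [h, ← RingHom.mapMatrix_apply, ← RingHom.map_det]
  refine IsUnit.mk0 _ ?_
  exact (map_ne_zero_iff _ (RatFunc.algebraMap_injective ℝ)).2 (Matrix.charpoly_monic A).ne_zero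

open scoped Classical in
/-- `z (z I - A)⁻¹ = I + A (z I - A)⁻¹`. -/
lemma X_smul_pencil_inv (A : Matrix ι ι ℝ) :
    (RatFunc.X : RatFunc ℝ) • (pencil A)⁻¹ =
      1 + A.map (algebraMap ℝ (RatFunc ℝ)) * (pencil A)⁻¹ := by
  have h := Matrix.mul_nonsing_inv (pencil A) (isUnit_det_pencil A)
  conv_lhs at h => rw [pencil, Matrix.sub_mul, Matrix.smul_mul, Matrix.one_mul]
  rw [← h]
  simp [pencil]

open scoped Classical in
lemma inftyValuation_algebraMap_le (a : ℝ) :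
    inftyValuation ℝ (algebraMap ℝ (RatFunc ℝ) a) ≤ 1 := by
  by_cases ha : a = 0
  · simp [ha]
  · rw [RatFunc.algebraMap_eq_C, inftyValuation.C ℝ ha]

open scoped Classical in
/-- The resolvent is strictly proper: all its entries vanish at infinity. An entry `r` of maximal
valuation at infinity satisfies `v(z) v(r) ≤ max (1, v(r))`, and `v(z) > 1`. -/
lemma inftyValuation_pencil_inv_lt (A : Matrix ι ι ℝ) (i j : ι) :
    inftyValuation ℝ ((pencil A)⁻¹ i j) < 1 := by
  have : Nonempty (ι × ι) := ⟨(i, j)⟩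
  obtain ⟨⟨k, l⟩, hmax⟩ := Finite.exists_max
    (fun p : ι × ι => inftyValuation ℝ ((pencil A)⁻¹ p.1 p.2))
  refine (hmax (i, j)).trans_lt ?_
  by_contra! hge
  simp only at hge hmax
  have h := congrFun (congrFun (X_smul_pencil_inv A) k) l
  have hle : inftyValuation ℝ (((RatFunc.X : RatFunc ℝ) • (pencil A)⁻¹) k l) ≤
      inftyValuation ℝ ((pencil A)⁻¹ k l) := by
    rw [h, Matrix.add_apply]
    refine (Valuation.map_add _ _ _).trans (max_le ?_ ?_)
    · refine le_trans ?_ hge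
      rcases eq_or_ne k l with rfl | hkl
      · rw [Matrix.one_apply_eq, map_one]
      · rw [Matrix.one_apply_ne hkl, map_zero]; exact zero_le_one
    · rw [Matrix.mul_apply]
      refine Valuation.map_sum_le _ fun p _ => ?_
      rw [map_mul]
      calc _ ≤ 1 * inftyValuation ℝ ((pencil A)⁻¹ k l) :=
            mul_le_mul' (inftyValuation_algebraMap_le _) (hmax (p, l))
        _ = _ := one_mul _
  rw [Matrix.smul_apply, smul_eq_mul, map_mul, inftyValuation.X] at hle
  have h0 : (0 : ℤᵐ⁰) < inftyValuation ℝ ((pencil A)⁻¹ k l) := lt_of_lt_of_le zero_lt_one hge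
  have h1 : (1 : ℤᵐ⁰) < exp 1 := by
    rw [← WithZero.exp_zero, WithZero.exp_lt_exp]; norm_num
  have h2 := mul_lt_mul_of_pos_right h1 h0
  rw [one_mul] at h2
  exact absurd hle (not_le.2 h2)

lemma transferFunction_eq (S : StateSpaceModel d m ι) :
    S.transferFunction = S.C.map (algebraMap ℝ (RatFunc ℝ)) * (pencil S.A)⁻¹ *
      S.B.map (algebraMap ℝ (RatFunc ℝ)) := rfl

open scoped Classical in
lemma inftyValuation_transferFunction_lt (S : StateSpaceModel d m ι) (i : Fin d) (j : Fin m) :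
    inftyValuation ℝ (S.transferFunction i j) < 1 := by
  rw [transferFunction_eq, Matrix.mul_apply]
  refine Valuation.map_sum_lt _ one_ne_zero fun p _ => ?_
  rw [map_mul, Matrix.mul_apply]
  refine (mul_le_mul' le_rfl (inftyValuation_algebraMap_le _)).trans_lt ?_
  rw [mul_one]
  refine Valuation.map_sum_lt _ one_ne_zero fun q _ => ?_
  rw [map_mul]
  refine (mul_le_mul' (inftyValuation_algebraMap_le _) le_rfl).trans_lt ?_
  rw [one_mul]
  exact inftyValuation_pencil_inv_lt _ _ _

/-- The model `(A, B, C A)`, whose Markov parameters are those of `(A, B, C)` shifted by one. -/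
def shift (S : StateSpaceModel d m ι) : StateSpaceModel d m ι := ⟨S.A, S.B, S.C * S.A⟩

lemma markov_shift (S : StateSpaceModel d m ι) (k : ℕ) : S.shift.markov k = S.markov (k + 1) := by
  simp [markov, shift, pow_succ', Matrix.mul_assoc]

lemma X_smul_transferFunction (S : StateSpaceModel d m ι) :
    (RatFunc.X : RatFunc ℝ) • S.transferFunction =
      (S.markov 0).map (algebraMap ℝ (RatFunc ℝ)) + S.shift.transferFunction := by
  rw [transferFunction_eq, transferFunction_eq, markov, shift, ← Matrix.smul_mul,
    ← Matrix.mul_smul, X_smul_pencil_inv, Matrix.mul_add, Matrix.add_mul, Matrix.mul_one,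
    pow_zero, Matrix.mul_one, Matrix.map_mul, Matrix.map_mul]
  simp only [Matrix.mul_assoc]

/-- The Markov parameter `C B` is the value of `z k(z)` at infinity: a constant matrix that is
strictly proper vanishes. -/
lemma markov_zero_eq {S : StateSpaceModel d m ι} {S' : StateSpaceModel d m κ}
    (h : S.transferFunction = S'.transferFunction) : S.markov 0 = S'.markov 0 := by
  classical
  have h1 := X_smul_transferFunction S
  rw [h, X_smul_transferFunction S'] at h1
  ext i j
  have h2 := congrFun (congrFun h1 i) j
  simp only [Matrix.add_apply, Matrix.map_apply] at h2
  have h3 : algebraMap ℝ (RatFunc ℝ) (S.markov 0 i j - S'.markov 0 i j) =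
      S'.shift.transferFunction i j - S.shift.transferFunction i j := by
    rw [map_sub]; linear_combination -h2
  by_contra hne
  have h4 := (inftyValuation ℝ).map_sub_lt (inftyValuation_transferFunction_lt S'.shift i j)
    (inftyValuation_transferFunction_lt S.shift i j)
  rw [← h3, RatFunc.algebraMap_eq_C, inftyValuation.C ℝ (sub_ne_zero.2 hne)] at h4
  exact lt_irrefl _ h4

lemma markov_eq_of_transferFunction_eq {S : StateSpaceModel d m ι} {S' : StateSpaceModel d m κ}
    (h : S.transferFunction = S'.transferFunction) (k : ℕ) : S.markov k = S'.markov k := by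
  induction k generalizing S S' with
  | zero => exact markov_zero_eq h
  | succ k ih =>
    rw [← markov_shift, ← markov_shift]
    refine ih ?_
    have h1 := X_smul_transferFunction S
    rw [h, X_smul_transferFunction S', markov_zero_eq h] at h1
    exact (add_left_cancel h1).symm

/-- The `n`-th shift multiplies the difference of two transfer functions by `zⁿ`, and the product is
still strictly proper; so the difference vanishes at infinity to every order. -/
lemma transferFunction_eq_of_markov_eq {S : StateSpaceModel d m ι} {S' : StateSpaceModel d m κ}
    (h : ∀ k, S.markov k = S'.markov k) : S.transferFunction = S'.transferFunction := by
  classical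
  ext i j
  have key : ∀ (n : ℕ) (S : StateSpaceModel d m ι) (S' : StateSpaceModel d m κ),
      (∀ k, S.markov k = S'.markov k) →
      inftyValuation ℝ (RatFunc.X ^ n * (S.transferFunction i j - S'.transferFunction i j)) < 1 := by
    intro n
    induction n with
    | zero =>
      intro S S' _
      rw [pow_zero, one_mul]
      exact (inftyValuation ℝ).map_sub_lt (inftyValuation_transferFunction_lt S i j)
        (inftyValuation_transferFunction_lt S' i j)
    | succ n ih =>
      intro S S' h
      have h1 := congrFun (congrFun (X_smul_transferFunction S) i) j
      have h2 := congrFun (congrFun (X_smul_transferFunction S') i) j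
      rw [← h 0] at h2
      simp only [Matrix.smul_apply, Matrix.add_apply, smul_eq_mul] at h1 h2
      have h3 := ih S.shift S'.shift fun k => by rw [markov_shift, markov_shift, h]
      convert h3 using 2
      linear_combination RatFunc.X ^ n * (h1 - h2)
  by_contra hne
  have hne' := sub_ne_zero.2 hne
  set D := S.transferFunction i j - S'.transferFunction i j with hD
  have h1 := key D.intDegree.natAbs S S' h
  rw [inftyValuation_apply, inftyValuation_of_nonzero ℝ
    (mul_ne_zero (pow_ne_zero _ RatFunc.X_ne_zero) hne'), ← WithZero.exp_zero,
    WithZero.exp_lt_exp, RatFunc.intDegree_mul (pow_ne_zero _ RatFunc.X_ne_zero) hne'] at h1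
  have h2 : ∀ n : ℕ, (RatFunc.X ^ n : RatFunc ℝ).intDegree = n := by
    intro n
    induction n with
    | zero => simp
    | succ n ih =>
      rw [pow_succ, RatFunc.intDegree_mul (pow_ne_zero _ RatFunc.X_ne_zero) RatFunc.X_ne_zero, ih,
        RatFunc.intDegree_X]
      push_cast; ring
  rw [h2] at h1
  omega

end Resolvent
end StateSpaceModel

/-! ### Minimal models: reachability, observability, and the state space isomorphism -/

namespace StateSpaceModel

section Minimal

variable {d m : ℕ} {ι κ : Type} [Fintype ι] [DecidableEq ι] [Fintype κ] [DecidableEq κ]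

lemma markov_eq_of_intertwine {S : StateSpaceModel d m ι} {S' : StateSpaceModel d m κ}
    (V : Matrix ι κ ℝ) (hA : S.A * V = V * S'.A) (hB : V * S'.B = S.B) (hC : S.C * V = S'.C)
    (k : ℕ) : S.markov k = S'.markov k := by
  have h : S.A ^ k * V = V * S'.A ^ k := by
    induction k with
    | zero => simp
    | succ k ih => rw [pow_succ, Matrix.mul_assoc, hA, ← Matrix.mul_assoc, ih, pow_succ,
        Matrix.mul_assoc]
  rw [markov, markov, ← hB, ← hC, ← Matrix.mul_assoc, Matrix.mul_assoc S.C, h,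
    Matrix.mul_assoc S.C]
  simp only [Matrix.mul_assoc]

lemma IsMinimal.card_le {S : StateSpaceModel d m ι} (hS : S.IsMinimal)
    (S' : StateSpaceModel d m κ) (h : ∀ k, S'.markov k = S.markov k) :
    Fintype.card ι ≤ Fintype.card κ := by
  let e := (Fintype.equivFin κ).symm
  refine hS _ ⟨S'.A.submatrix e e, S'.B.submatrix e id, S'.C.submatrix id e⟩
    (transferFunction_eq_of_markov_eq fun k => ?_)
  rw [← h k]
  refine (markov_eq_of_intertwine ((1 : Matrix κ κ ℝ).submatrix id e) ?_ ?_ ?_ k).symm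
  · ext i j; simp [Matrix.mul_apply, Matrix.one_apply]
    rw [Finset.sum_eq_single (e.symm i)] <;> simp +contextual [Equiv.eq_symm_apply, eq_comm]
  · ext i j; simp [Matrix.mul_apply, Matrix.one_apply]
    rw [Finset.sum_eq_single (e.symm i)] <;> simp +contextual [Equiv.eq_symm_apply, eq_comm]
  · ext i j; simp [Matrix.mul_apply, Matrix.one_apply]

lemma isMinimal_of_card_le {S : StateSpaceModel d m ι} (hS : S.IsMinimal)
    (S' : StateSpaceModel d m κ) (h : S.transferFunction = S'.transferFunction)
    (hc : Fintype.card κ ≤ Fintype.card ι) : S'.IsMinimal :=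
  fun n S'' h' => hc.trans (hS n S'' (h'.trans h.symm))

/-- An invariant subspace that contains the range of `B` carries a realization of the same transfer
function, so it is the whole state space of a minimal model. -/
lemma IsMinimal.eq_top_of_invariant {S : StateSpaceModel d m ι} (hS : S.IsMinimal)
    (W : Submodule ℝ (ι → ℝ)) (hA : ∀ w ∈ W, S.A *ᵥ w ∈ W) (hB : ∀ j, S.B.col j ∈ W) :
    W = ⊤ := by
  let b := Module.finBasis ℝ W
  have key : ∀ w : W, ∀ i, (w : ι → ℝ) i = ∑ k, (b k : ι → ℝ) i * b.repr w k := by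
    intro w i
    have h := congrArg (fun x : W => (x : ι → ℝ) i) (b.sum_repr w)
    simp only [Submodule.coe_sum, Submodule.coe_smul, Finset.sum_apply, Pi.smul_apply,
      smul_eq_mul] at h
    rw [← h]
    exact Finset.sum_congr rfl fun k _ => mul_comm _ _
  let V : Matrix ι (Fin (Module.finrank ℝ W)) ℝ := Matrix.of fun i k => (b k : ι → ℝ) i
  let S' : StateSpaceModel d m (Fin (Module.finrank ℝ W)) :=
    ⟨Matrix.of fun k l => b.repr ⟨S.A *ᵥ b l, hA _ (b l).2⟩ k,
      Matrix.of fun k j => b.repr ⟨S.B.col j, hB j⟩ k, S.C * V⟩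
  have h := hS.card_le S' fun k => (markov_eq_of_intertwine (S := S) (S' := S') V
    (by ext i l; exact key ⟨S.A *ᵥ b l, hA _ (b l).2⟩ i)
    (by ext i j; exact (key ⟨S.B.col j, hB j⟩ i).symm) rfl k).symm
  apply Submodule.eq_top_of_finrank_eq
  refine le_antisymm (Submodule.finrank_le W) ?_
  simpa using h

/-- The reachability map: `e_(k,j) ↦ Aᵏ B e_j`. -/
def reachMap (S : StateSpaceModel d m ι) : (ℕ × Fin m →₀ ℝ) →ₗ[ℝ] (ι → ℝ) :=
  Finsupp.linearCombination ℝ fun p => (S.A ^ p.1 * S.B).col p.2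

lemma reachMap_single (S : StateSpaceModel d m ι) (p : ℕ × Fin m) :
    S.reachMap (Finsupp.single p 1) = (S.A ^ p.1 * S.B).col p.2 := by
  simp [reachMap]

lemma IsMinimal.reachMap_surjective {S : StateSpaceModel d m ι} (hS : S.IsMinimal) :
    Function.Surjective S.reachMap := by
  rw [← LinearMap.range_eq_top]
  refine hS.eq_top_of_invariant _ ?_ ?_
  · rintro _ ⟨f, rfl⟩
    induction f using Finsupp.induction_linear with
    | zero => simp
    | add f g hf hg => rw [map_add, Matrix.mulVec_add]; exact add_mem hf hg
    | single p a =>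
      rw [← mul_one a, ← smul_eq_mul, ← Finsupp.smul_single, map_smul, Matrix.mulVec_smul]
      refine Submodule.smul_mem _ _ ⟨Finsupp.single (p.1 + 1, p.2) 1, ?_⟩
      rw [reachMap_single, reachMap_single, pow_succ', Matrix.mul_assoc]
      rfl
  · exact fun j => ⟨Finsupp.single (0, j) 1, by simp [reachMap_single]⟩

/-- The dual model `(Aᵀ, Cᵀ, Bᵀ)`. -/
def dual (S : StateSpaceModel d m ι) : StateSpaceModel m d ι := ⟨S.Aᵀ, S.Cᵀ, S.Bᵀ⟩

lemma markov_dual (S : StateSpaceModel d m ι) (k : ℕ) : S.dual.markov k = (S.markov k)ᵀ := by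
  simp [markov, dual, Matrix.transpose_mul, Matrix.transpose_pow, Matrix.mul_assoc]

lemma IsMinimal.dual {S : StateSpaceModel d m ι} (hS : S.IsMinimal) : S.dual.IsMinimal := by
  intro n S' h
  have := hS.card_le S'.dual fun k => by
    rw [markov_dual, markov_eq_of_transferFunction_eq h k, markov_dual, Matrix.transpose_transpose]
  simpa using this

/-- A minimal model is observable. -/
lemma IsMinimal.eq_zero_of_unobservable {S : StateSpaceModel d m ι} (hS : S.IsMinimal)
    {x : ι → ℝ} (hx : ∀ k, (S.C * S.A ^ k) *ᵥ x = 0) : x = 0 := by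
  have h : ∀ f, S.dual.reachMap f ⬝ᵥ x = 0 := by
    intro f
    induction f using Finsupp.induction_linear with
    | zero => simp
    | add f g hf hg => rw [map_add, add_dotProduct, hf, hg, add_zero]
    | single p a =>
      rw [← mul_one a, ← smul_eq_mul, ← Finsupp.smul_single, map_smul, smul_dotProduct,
        reachMap_single]
      have h2 : (S.dual.A ^ p.1 * S.dual.B).col p.2 = (S.C * S.A ^ p.1).row p.2 := by
        simp [StateSpaceModel.dual, ← Matrix.transpose_pow, ← Matrix.transpose_mul]
      rw [h2]
      have := congrFun (hx p.1) p.2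
      rw [Matrix.mulVec] at this
      erw [this]
      simp
  obtain ⟨f, hf⟩ := hS.dual.reachMap_surjective x
  have := h f
  rw [hf] at this
  exact dotProduct_self_eq_zero.1 this

lemma mulVec_reachMap_eq {S : StateSpaceModel d m ι} {S' : StateSpaceModel d m κ}
    (h : ∀ k, S.markov k = S'.markov k) (k : ℕ) (f : ℕ × Fin m →₀ ℝ) :
    (S.C * S.A ^ k) *ᵥ S.reachMap f = (S'.C * S'.A ^ k) *ᵥ S'.reachMap f := by
  induction f using Finsupp.induction_linear with
  | zero => simp
  | add f g hf hg => rw [map_add, map_add, Matrix.mulVec_add, Matrix.mulVec_add, hf, hg]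
  | single p a =>
    rw [← mul_one a, ← smul_eq_mul, ← Finsupp.smul_single, map_smul, map_smul, reachMap_single,
      reachMap_single, Matrix.mulVec_smul, Matrix.mulVec_smul]
    congr 1
    have h1 := congrArg (fun M => M.col p.2) (h (k + p.1))
    simp only [markov, pow_add] at h1
    have h2 : ∀ (M : Matrix (Fin d) ι ℝ) (N : Matrix ι (Fin m) ℝ), M *ᵥ N.col p.2 =
      (M * N).col p.2 := fun _ _ => rfl
    have h3 : ∀ (M : Matrix (Fin d) κ ℝ) (N : Matrix κ (Fin m) ℝ), M *ᵥ N.col p.2 =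
      (M * N).col p.2 := fun _ _ => rfl
    rw [h2, h3]
    simpa only [Matrix.mul_assoc] using h1

/-- **State space isomorphism theorem**: two minimal realizations of a transfer function differ by
a change of basis. The reachability maps of both have the same kernel, namely that of the Hankel
map, since both models are observable. -/
theorem ObsEquiv.exists_iso {S : StateSpaceModel d m ι} {S' : StateSpaceModel d m κ}
    (h : S.ObsEquiv S') : ∃ (T : Matrix ι κ ℝ) (T' : Matrix κ ι ℝ), T * T' = 1 ∧ T' * T = 1 ∧
      S.A * T = T * S'.A ∧ T * S'.B = S.B ∧ S.C * T = S'.C := by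
  obtain ⟨hS, hS', htf⟩ := h
  have hm := markov_eq_of_transferFunction_eq htf
  have hker : LinearMap.ker S'.reachMap = LinearMap.ker S.reachMap := by
    ext f
    rw [LinearMap.mem_ker, LinearMap.mem_ker]
    constructor
    · intro hf
      refine hS.eq_zero_of_unobservable fun k => ?_
      rw [mulVec_reachMap_eq hm, hf, Matrix.mulVec_zero]
    · intro hf
      refine hS'.eq_zero_of_unobservable fun k => ?_
      rw [← mulVec_reachMap_eq hm, hf, Matrix.mulVec_zero]
  let E : (κ → ℝ) ≃ₗ[ℝ] (ι → ℝ) :=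
    (S'.reachMap.quotKerEquivOfSurjective hS'.reachMap_surjective).symm.trans
      ((Submodule.quotEquivOfEq _ _ hker).trans
        (S.reachMap.quotKerEquivOfSurjective hS.reachMap_surjective))
  have hE : ∀ f, E (S'.reachMap f) = S.reachMap f := by
    intro f
    have h1 : (S'.reachMap.quotKerEquivOfSurjective hS'.reachMap_surjective).symm
        (S'.reachMap f) = Submodule.Quotient.mk f := by
      rw [LinearEquiv.symm_apply_eq]; rfl
    simp only [E, LinearEquiv.trans_apply, h1]
    rfl
  have hEm : ∀ x, LinearMap.toMatrix' E.toLinearMap *ᵥ x = E x := by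
    intro x; rw [LinearMap.toMatrix'_mulVec]; rfl
  refine ⟨LinearMap.toMatrix' E.toLinearMap, LinearMap.toMatrix' E.symm.toLinearMap, ?_, ?_, ?_,
    ?_, ?_⟩
  · rw [← LinearMap.toMatrix'_comp]; simp
  · rw [← LinearMap.toMatrix'_comp]; simp
  · refine Matrix.ext_of_mulVec_single fun i => ?_
    obtain ⟨f, hf⟩ := hS'.reachMap_surjective (Pi.single i 1)
    rw [← hf, ← Matrix.mulVec_mulVec, ← Matrix.mulVec_mulVec, hEm, hEm, hE]
    clear hf
    induction f using Finsupp.induction_linear with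
    | zero => simp
    | add f g hf hg => simp only [map_add, Matrix.mulVec_add, hf, hg]
    | single p a =>
      rw [← mul_one a, ← smul_eq_mul, ← Finsupp.smul_single]
      simp only [map_smul, Matrix.mulVec_smul]
      congr 1
      have h4 := hE (Finsupp.single (p.1 + 1, p.2) 1)
      simp only [reachMap_single, pow_succ', Matrix.mul_assoc] at h4
      rw [reachMap_single, reachMap_single]
      exact h4.symm
  · refine Matrix.ext_of_mulVec_single fun j => ?_
    have := hE (Finsupp.single (0, j) 1)
    simp only [reachMap_single, pow_zero, Matrix.one_mul] at this
    rw [← Matrix.mulVec_mulVec, Matrix.mulVec_single_one, Matrix.mulVec_single_one, hEm, this]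
  · refine Matrix.ext_of_mulVec_single fun i => ?_
    obtain ⟨f, hf⟩ := hS'.reachMap_surjective (Pi.single i 1)
    rw [← hf, ← Matrix.mulVec_mulVec, hEm, hE]
    simpa using mulVec_reachMap_eq hm 0 f

end Minimal
end StateSpaceModel

/-! ### Positive lower triangular orthonormal bases -/

section PositiveLowerTriangular

variable {d : ℕ}

/-- Every subspace of `ℝᵈ` has an orthonormal basis that forms a positive lower triangular matrix.
With `j` the first coordinate that does not vanish on `W`, the basis of `W ∩ {w_j = 0}` is preceded
by the unit vector of `W` that is orthogonal to this subspace and has a positive `j`-th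
coordinate. -/
lemma exists_positiveLowerTriangular_basis (W : Submodule ℝ (Fin d → ℝ)) :
    ∃ (r : ℕ) (u : Matrix (Fin d) (Fin r) ℝ), uᵀ * u = 1 ∧ IsPositiveLowerTriangular u ∧
      (∀ i, u.col i ∈ W) ∧ ∀ w ∈ W, u *ᵥ (uᵀ *ᵥ w) = w := by
  induction hn : Module.finrank ℝ W using Nat.strong_induction_on generalizing W with
  | _ n ih =>
  by_cases hW : W = ⊥
  · refine ⟨0, Matrix.of fun _ => Fin.elim0, by ext i; exact i.elim0,
      ⟨Fin.elim0, fun i => i.elim0, fun i => i.elim0⟩, fun i => i.elim0, fun w hw => ?_⟩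
    rw [hW, Submodule.mem_bot] at hw
    simp [hw]
  obtain ⟨j, ⟨w₀, hw₀, hj⟩, hmin⟩ := WellFounded.has_min (wellFounded_lt (α := Fin d))
    {j | ∃ w ∈ W, w j ≠ 0} (by
      obtain ⟨w, hw, hne⟩ := Submodule.exists_mem_ne_zero_of_ne_bot hW
      obtain ⟨j, hj⟩ := Function.ne_iff.1 hne
      exact ⟨j, w, hw, hj⟩)
  have hvan : ∀ w ∈ W, ∀ k < j, w k = 0 := by
    intro w hw k hk
    by_contra hne
    exact hmin k ⟨w, hw, hne⟩ hk
  let W' : Submodule ℝ (Fin d → ℝ) := W ⊓ LinearMap.ker (LinearMap.proj j)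
  have hmem : ∀ w, w ∈ W' ↔ w ∈ W ∧ w j = 0 := fun w => by simp [W']
  have hlt : W' < W := lt_of_le_of_ne inf_le_left fun h => hj ((hmem w₀).1 (h ▸ hw₀)).2
  obtain ⟨r, u, huu, ⟨p, hp, hpos⟩, hu, hW'⟩ := ih _ (hn ▸ Submodule.finrank_lt_finrank_of_lt hlt)
    W' rfl
  have huW : ∀ x, u *ᵥ x ∈ W' := by
    intro x
    have : u *ᵥ x = ∑ i, x i • u.col i := by
      ext k; simp [Matrix.mulVec, dotProduct, mul_comm]
    rw [this]
    exact Submodule.sum_mem _ fun i _ => Submodule.smul_mem _ _ (hu i)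
  set w₁ := w₀ - u *ᵥ (uᵀ *ᵥ w₀) with hw₁
  have h1W : w₁ ∈ W := W.sub_mem hw₀ ((hmem _).1 (huW _)).1
  have h1j : w₁ j ≠ 0 := by rw [hw₁, Pi.sub_apply, ((hmem _).1 (huW _)).2, sub_zero]; exact hj
  have h1u : uᵀ *ᵥ w₁ = 0 := by
    rw [hw₁, Matrix.mulVec_sub, Matrix.mulVec_mulVec, huu, Matrix.one_mulVec, sub_self]
  have h1p : 0 < w₁ ⬝ᵥ w₁ := by
    rw [dotProduct]
    exact Finset.sum_pos' (fun i _ => mul_self_nonneg _)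
      ⟨j, Finset.mem_univ j, mul_self_pos.2 h1j⟩
  obtain ⟨a, ha, haj⟩ : ∃ a : ℝ, a * a * (w₁ ⬝ᵥ w₁) = 1 ∧ 0 < a * w₁ j := by
    have hs := Real.mul_self_sqrt h1p.le
    have hs0 := Real.sqrt_pos.2 h1p
    rcases lt_or_gt_of_ne h1j with h | h
    · refine ⟨-(√(w₁ ⬝ᵥ w₁))⁻¹, ?_, by nlinarith [inv_pos.2 hs0]⟩
      field_simp; nlinarith
    · refine ⟨(√(w₁ ⬝ᵥ w₁))⁻¹, ?_, by positivity⟩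
      field_simp; nlinarith
  set w := a • w₁ with hw
  have hwW : w ∈ W := W.smul_mem _ h1W
  have hwu : uᵀ *ᵥ w = 0 := by rw [hw, Matrix.mulVec_smul, h1u, smul_zero]
  have hww : w ⬝ᵥ w = 1 := by rw [hw, smul_dotProduct, dotProduct_smul]; simp [← ha, mul_assoc]
  have hwj : 0 < w j := haj
  have hwui : ∀ i, ∑ k, u k i * w k = 0 := fun i => congrFun hwu i
  refine ⟨r + 1, Matrix.of fun k => Fin.cons (w k) (u k), ?_, ⟨Fin.cons j p, ?_, ?_⟩, ?_, ?_⟩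
  · ext i i'
    rw [Matrix.mul_apply]
    refine Fin.cases ?_ (fun i => ?_) i <;> refine Fin.cases ?_ (fun i' => ?_) i'
    · simpa [dotProduct] using hww
    · simpa [mul_comm, Matrix.one_apply, (Fin.succ_ne_zero i').symm] using hwui i'
    · simpa [Matrix.one_apply] using hwui i
    · have := congrFun (congrFun huu i) i'
      rw [Matrix.mul_apply] at this
      simpa [Matrix.one_apply] using this
  · have hjp : ∀ i, j < p i := by
      intro i
      by_contra! hle
      have h0 : u (p i) i = 0 := by
        rcases hle.lt_or_eq with h | h
        · exact hvan _ ((hmem _).1 (hu i)).1 _ h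
        · rw [h]; exact ((hmem _).1 (hu i)).2
      exact (hpos i).1.ne' h0
    intro i i'
    refine Fin.cases ?_ (fun i => ?_) i <;> refine Fin.cases ?_ (fun i' => ?_) i'
    · simp
    · simpa using hjp i'
    · simp
    · simpa using @hp i i'
  · intro i
    refine Fin.cases ?_ (fun i => ?_) i
    · simpa using ⟨hwj, hvan w hwW⟩
    · simpa using hpos i
  · intro i
    refine Fin.cases ?_ (fun i => ?_) i
    · exact hwW
    · exact ((hmem _).1 (hu i)).1
  · intro x hx
    set t := x j / w j with ht
    set x' := x - t • w with hx'
    have hx'W : x' ∈ W' := (hmem _).2 ⟨W.sub_mem hx (W.smul_mem _ hwW), by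
      rw [hx', ht, Pi.sub_apply, Pi.smul_apply, smul_eq_mul, div_mul_cancel₀ _ hwj.ne', sub_self]⟩
    have hxe : x = x' + t • w := by rw [hx', sub_add_cancel]
    have h1 : uᵀ *ᵥ x = uᵀ *ᵥ x' := by
      rw [hxe, Matrix.mulVec_add, Matrix.mulVec_smul, hwu, smul_zero, add_zero]
    have h2 : w ⬝ᵥ x = t := by
      rw [hxe, dotProduct_add, dotProduct_smul, hww, ← hW' _ hx'W, Matrix.dotProduct_mulVec,
        ← Matrix.mulVec_transpose, hwu, zero_dotProduct]
      simp
    have h3 : (Matrix.of fun k => (Fin.cons (w k) (u k) : Fin (r + 1) → ℝ))ᵀ *ᵥ x =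
        Fin.cons t (uᵀ *ᵥ x) := by
      ext i
      refine Fin.cases ?_ (fun i => ?_) i
      · simpa [Matrix.mulVec, dotProduct] using h2
      · simp [Matrix.mulVec, dotProduct]
    rw [h3, h1]
    ext k
    have h4 := congrFun (hW' _ hx'W) k
    rw [hxe, Pi.add_apply, ← h4]
    simp [Matrix.mulVec, dotProduct, Fin.sum_univ_succ]
    ring

/-- A matrix of rank `c` factors through a positive lower triangular orthonormal basis of its range,
which has exactly `c` columns. -/
lemma exists_mul_eq_of_rank_le {d m c : ℕ} (G : Matrix (Fin d) (Fin m) ℝ) (h : G.rank = c) :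
    ∃ u : Matrix (Fin d) (Fin c) ℝ, uᵀ * u = 1 ∧ IsPositiveLowerTriangular u ∧
      u * (uᵀ * G) = G := by
  obtain ⟨r, u, h1, h2, h3, h4⟩ := exists_positiveLowerTriangular_basis
    (LinearMap.range G.mulVecLin)
  have hinj : Function.Injective u.mulVecLin := by
    intro x y hxy
    have := congrArg (fun z => uᵀ *ᵥ z) hxy
    simpa [Matrix.mulVec_mulVec, h1] using this
  have hrange : LinearMap.range u.mulVecLin = LinearMap.range G.mulVecLin := by
    apply le_antisymm
    · rw [Matrix.range_mulVecLin, Submodule.span_le]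
      rintro _ ⟨i, rfl⟩
      exact h3 i
    · intro w hw
      exact ⟨uᵀ *ᵥ w, h4 w hw⟩
  have hr : r = c := by
    rw [← h, Matrix.rank, ← hrange, LinearMap.finrank_range_of_inj hinj]; simp
  subst hr
  refine ⟨u, h1, h2, Matrix.ext_of_mulVec_single fun i => ?_⟩
  rw [← Matrix.mulVec_mulVec, ← Matrix.mulVec_mulVec]
  exact h4 _ ⟨_, rfl⟩

/-- The first non-zero entry of `u x` stands in the row of the pivot that belongs to the first
non-zero coordinate of `x`. -/
lemma pivot_mulVec {c : ℕ} {u : Matrix (Fin d) (Fin c) ℝ} {j : Fin c → Fin d} (hj : StrictMono j)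
    (hu : ∀ i, 0 < u (j i) i ∧ ∀ k < j i, u k i = 0) {x : Fin c → ℝ} {i : Fin c}
    (hx : ∀ k < i, x k = 0) :
    (u *ᵥ x) (j i) = u (j i) i * x i ∧ ∀ k < j i, (u *ᵥ x) k = 0 := by
  constructor
  · rw [Matrix.mulVec, dotProduct, Finset.sum_eq_single i]
    · intro b _ hb
      rcases lt_or_gt_of_ne hb with h | h
      · rw [hx b h, mul_zero]
      · rw [(hu b).2 _ (hj h), zero_mul]
    · simp
  · intro k hk
    rw [Matrix.mulVec, dotProduct]
    refine Finset.sum_eq_zero fun b _ => ?_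
    rcases lt_or_ge b i with h | h
    · rw [hx b h, mul_zero]
    · rw [(hu b).2 _ (hk.trans_le (hj.monotone h)), zero_mul]

lemma exists_pivot {c : ℕ} {u : Matrix (Fin d) (Fin c) ℝ} {j : Fin c → Fin d} (hj : StrictMono j)
    (hu : ∀ i, 0 < u (j i) i ∧ ∀ k < j i, u k i = 0) {x : Fin c → ℝ} (hx : x ≠ 0) :
    ∃ i, x i ≠ 0 ∧ (∀ k < i, x k = 0) ∧ (u *ᵥ x) (j i) ≠ 0 ∧ ∀ k < j i, (u *ᵥ x) k = 0 := by
  obtain ⟨i, hi, hmin⟩ := WellFounded.has_min (wellFounded_lt (α := Fin c)) {i | x i ≠ 0}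
    (Function.ne_iff.1 hx)
  have h0 : ∀ k < i, x k = 0 := fun k hk => by_contra fun h => hmin k h hk
  obtain ⟨h1, h2⟩ := pivot_mulVec hj hu h0
  exact ⟨i, hi, h0, h1 ▸ mul_ne_zero (hu i).1.ne' hi, h2⟩

/-- A positive lower triangular matrix with orthonormal columns is determined by its range. -/
lemma IsPositiveLowerTriangular.eq_of_eq_mul {c : ℕ} {u v : Matrix (Fin d) (Fin c) ℝ}
    (hu : uᵀ * u = 1) (hv : vᵀ * v = 1) (hu' : IsPositiveLowerTriangular u)
    (hv' : IsPositiveLowerTriangular v) {R : Matrix (Fin c) (Fin c) ℝ} (huv : u = v * R) :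
    u = v := by
  obtain ⟨j, hj, hju⟩ := hu'
  obtain ⟨l, hl, hlv⟩ := hv'
  have hR : R = vᵀ * u := by rw [huv, ← Matrix.mul_assoc, hv, Matrix.one_mul]
  have hRR : Rᵀ * R = 1 := by
    rw [← hu, huv, Matrix.transpose_mul, Matrix.mul_assoc, ← Matrix.mul_assoc vᵀ, hv,
      Matrix.one_mul]
  have hRR' : R * Rᵀ = 1 := mul_eq_one_comm.1 hRR
  have hvu : v = u * Rᵀ := by rw [huv, Matrix.mul_assoc, hRR', Matrix.mul_one]
  have hcol : ∀ i, (fun k => u k i) = v *ᵥ fun k => R k i := by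
    intro i; ext k; rw [huv]; rfl
  have hcol' : ∀ i, (fun k => v k i) = u *ᵥ fun k => Rᵀ k i := by
    intro i; ext k; conv_lhs => rw [hvu]
    rfl
  have hne : ∀ i, (fun k => R k i) ≠ 0 := by
    intro i h
    have := congrFun (hcol i) (j i)
    rw [h, Matrix.mulVec_zero] at this
    exact (hju i).1.ne' this
  have hne' : ∀ i, (fun k => Rᵀ k i) ≠ 0 := by
    intro i h
    have := congrFun (hcol' i) (l i)
    rw [h, Matrix.mulVec_zero] at this
    exact (hlv i).1.ne' this
  -- both matrices have the same set of pivot rows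
  have hpiv : ∀ {u : Matrix (Fin d) (Fin c) ℝ} {j : Fin c → Fin d} (i : Fin c)
      (_ : 0 < u (j i) i ∧ ∀ k < j i, u k i = 0) {q : Fin d} (_ : u q i ≠ 0)
      (_ : ∀ k < q, u k i = 0), q = j i := by
    intro u j i h q h1 h2
    refine le_antisymm (not_lt.1 fun hlt => h.1.ne' (h2 _ hlt)) (not_lt.1 fun hlt => h1 (h.2 _ hlt))
  have hjl : j = l := by
    refine (hj.range_inj hl).1 (Set.Subset.antisymm ?_ ?_)
    · rintro _ ⟨i, rfl⟩
      obtain ⟨k, -, -, h1, h2⟩ := exists_pivot hl hlv (hne i)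
      rw [← hcol i] at h1 h2
      exact ⟨k, hpiv i (hju i) h1 h2⟩
    · rintro _ ⟨i, rfl⟩
      obtain ⟨k, -, -, h1, h2⟩ := exists_pivot hj hju (hne' i)
      rw [← hcol' i] at h1 h2
      exact ⟨k, hpiv i (hlv i) h1 h2⟩
  subst hjl
  have hlow : ∀ i, ∀ k < i, R k i = 0 := by
    intro i
    obtain ⟨k, -, h0, h1, h2⟩ := exists_pivot hl hlv (hne i)
    rw [← hcol i] at h1 h2
    have := hj.injective (hpiv i (hju i) h1 h2)
    rwa [this] at h0
  have hlow' : ∀ i, ∀ k < i, R i k = 0 := by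
    intro i
    obtain ⟨k, -, h0, h1, h2⟩ := exists_pivot hj hju (hne' i)
    rw [← hcol' i] at h1 h2
    have := hj.injective (hpiv i (hlv i) h1 h2)
    rwa [this] at h0
  have hdiag : ∀ i, R i i = 1 := by
    intro i
    have h1 := (pivot_mulVec hl hlv (x := fun k => R k i) (hlow i)).1
    rw [← hcol i] at h1
    have hp : 0 < R i i := pos_of_mul_pos_right (h1 ▸ (hju i).1) (hlv i).1.le
    have h2 := congrFun (congrFun hRR i) i
    rw [Matrix.mul_apply, Finset.sum_eq_single i] at h2
    · simp only [Matrix.transpose_apply, Matrix.one_apply_eq] at h2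
      nlinarith
    · intro k _ hk
      rcases lt_or_gt_of_ne hk with h | h
      · rw [hlow i k h, mul_zero]
      · rw [hlow' k i h, mul_zero]
    · simp
  have hR1 : R = 1 := by
    ext i k
    rcases lt_trichotomy i k with h | h | h
    · rw [hlow k i h, Matrix.one_apply_ne h.ne]
    · rw [h, hdiag, Matrix.one_apply_eq]
    · rw [hlow' i k h, Matrix.one_apply_ne h.ne']
  rw [huv, hR1, Matrix.mul_one]

end PositiveLowerTriangular

/-! ### Spectra of matrix exponentials -/

section ExpSpectrum

variable {ι : Type} [Fintype ι] [DecidableEq ι]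

open scoped Matrix.Norms.Operator in
lemma exp_map_algebraMap (A : Matrix ι ι ℝ) :
    (NormedSpace.exp A).map (algebraMap ℝ ℂ) = NormedSpace.exp (A.map (algebraMap ℝ ℂ)) := by
  have hc : Continuous ((algebraMap ℝ ℂ).mapMatrix : Matrix ι ι ℝ →+* Matrix ι ι ℂ) :=
    continuous_id.matrix_map Complex.continuous_ofReal
  exact NormedSpace.map_exp ((algebraMap ℝ ℂ).mapMatrix : Matrix ι ι ℝ →+* Matrix ι ι ℂ) hc A

lemma exists_eigenvector_of_mem_spectrum {A : Matrix ι ι ℂ} {μ : ℂ} (h : μ ∈ spectrum ℂ A) :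
    ∃ v, v ≠ 0 ∧ A *ᵥ v = μ • v := by
  rw [← Matrix.spectrum_toLin', ← Module.End.hasEigenvalue_iff_mem_spectrum] at h
  obtain ⟨v, hv⟩ := h.exists_hasEigenvector
  exact ⟨v, hv.2, by simpa using hv.apply_eq_smul⟩

lemma mem_spectrum_of_eigenvector {A : Matrix ι ι ℂ} {μ : ℂ} {v : ι → ℂ} (hv : v ≠ 0)
    (h : A *ᵥ v = μ • v) : μ ∈ spectrum ℂ A := by
  rw [← Matrix.spectrum_toLin', ← Module.End.hasEigenvalue_iff_mem_spectrum]
  exact Module.End.hasEigenvalue_of_hasEigenvector (x := v)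
    ⟨Module.End.mem_eigenspace_iff.2 (by simpa using h), hv⟩

open scoped Matrix.Norms.Operator in
lemma exp_mulVec_eigenvector {A : Matrix ι ι ℂ} {μ : ℂ} {v : ι → ℂ} (h : A *ᵥ v = μ • v) :
    NormedSpace.exp A *ᵥ v = NormedSpace.exp μ • v := by
  have hpow : ∀ n : ℕ, (A ^ n) *ᵥ v = μ ^ n • v := by
    intro n
    induction n with
    | zero => simp
    | succ n ih =>
      rw [pow_succ', ← Matrix.mulVec_mulVec, ih, Matrix.mulVec_smul, h, smul_smul, pow_succ]
  have h1 := NormedSpace.exp_series_hasSum_exp' (𝕂 := ℂ) A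
  have h2 := NormedSpace.exp_series_hasSum_exp' (𝕂 := ℂ) μ
  let f : Matrix ι ι ℂ →+ (ι → ℂ) :=
    ⟨⟨fun M => M *ᵥ v, Matrix.zero_mulVec v⟩, fun M N => Matrix.add_mulVec M N v⟩
  have hf : Continuous f := continuous_id.matrix_mulVec continuous_const
  refine (h1.map f hf).unique ?_
  convert h2.smul_const v using 2 with n
  change ((n.factorial : ℂ)⁻¹ • A ^ n) *ᵥ v = _
  rw [Matrix.smul_mulVec, hpow, smul_smul, smul_eq_mul]

/-- An eigenvalue of `exp A` is the exponential of an eigenvalue of `A`: the eigenspaces of `exp A`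
are invariant under `A`. -/
lemma exists_exp_eq_of_mem_spectrum {A : Matrix ι ι ℂ} {l : ℂ}
    (h : l ∈ spectrum ℂ (NormedSpace.exp A)) : ∃ μ ∈ spectrum ℂ A, NormedSpace.exp μ = l := by
  rw [← Matrix.spectrum_toLin', ← Module.End.hasEigenvalue_iff_mem_spectrum] at h
  set E := Module.End.eigenspace (Matrix.toLin' (NormedSpace.exp A)) l with hE
  have hcomm : Commute A (NormedSpace.exp A) := by
    open scoped Matrix.Norms.Operator in
    exact (Commute.refl A).exp_right
  have hmaps : ∀ x ∈ E, Matrix.toLin' A x ∈ E := by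
    intro x hx
    rw [hE, Module.End.mem_eigenspace_iff] at hx ⊢
    simp only [Matrix.toLin'_apply] at hx ⊢
    rw [Matrix.mulVec_mulVec, ← hcomm.eq, ← Matrix.mulVec_mulVec, hx, Matrix.mulVec_smul]
  have : Nontrivial E := Submodule.nontrivial_iff_ne_bot.2 h
  obtain ⟨μ, hμ⟩ := Module.End.exists_eigenvalue ((Matrix.toLin' A).restrict hmaps)
  obtain ⟨v, hv⟩ := hμ.exists_hasEigenvector
  have hv0 : (v : ι → ℂ) ≠ 0 := fun h0 => hv.2 (Subtype.ext h0)
  have hAv : A *ᵥ (v : ι → ℂ) = μ • (v : ι → ℂ) := by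
    simpa using congrArg (Subtype.val) hv.apply_eq_smul
  refine ⟨μ, mem_spectrum_of_eigenvector hv0 hAv, ?_⟩
  have h1 := exp_mulVec_eigenvector hAv
  have h2 := Module.End.mem_eigenspace_iff.1 v.2
  rw [Matrix.toLin'_apply, h1] at h2
  exact smul_left_injective ℂ hv0 h2

lemma norm_exp_complex (μ : ℂ) : ‖NormedSpace.exp μ‖ = Real.exp μ.re := by
  rw [← Complex.exp_eq_exp_ℂ, Complex.norm_exp]

/-- The eigenvalues of `exp A` lie in the open unit disc if and only if those of `A` lie in the open
left half-plane. -/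
lemma spectrum_exp_norm_lt_one_iff (A : Matrix ι ι ℝ) :
    (∀ μ ∈ spectrum ℂ ((NormedSpace.exp A).map (algebraMap ℝ ℂ)), ‖μ‖ < 1) ↔
      ∀ μ ∈ spectrum ℂ (A.map (algebraMap ℝ ℂ)), μ.re < 0 := by
  rw [exp_map_algebraMap]
  constructor
  · intro h μ hμ
    obtain ⟨v, hv, hAv⟩ := exists_eigenvector_of_mem_spectrum hμ
    have := h _ (mem_spectrum_of_eigenvector hv (exp_mulVec_eigenvector hAv))
    rwa [norm_exp_complex, Real.exp_lt_one_iff] at this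
  · intro h l hl
    obtain ⟨μ, hμ, rfl⟩ := exists_exp_eq_of_mem_spectrum hl
    rw [norm_exp_complex, Real.exp_lt_one_iff]
    exact h μ hμ

lemma det_ne_zero_of_stable {A : Matrix ι ι ℝ}
    (h : ∀ μ ∈ spectrum ℂ (A.map (algebraMap ℝ ℂ)), μ.re < 0) : A.det ≠ 0 := by
  intro hdet
  have h0 : (0 : ℂ) ∈ spectrum ℂ (A.map (algebraMap ℝ ℂ)) := by
    rw [spectrum.zero_mem_iff, Matrix.isUnit_iff_isUnit_det, ← RingHom.mapMatrix_apply,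
      ← RingHom.map_det, hdet]
    simp
  simpa using h 0 h0

lemma spectrum_eq_of_iso {κ : Type} [Fintype κ] [DecidableEq κ] {A : Matrix ι ι ℝ}
    {A' : Matrix κ κ ℝ} {T : Matrix ι κ ℝ} {T' : Matrix κ ι ℝ} (h2 : T' * T = 1)
    (hA : A * T = T * A') {μ : ℂ} (hμ : μ ∈ spectrum ℂ (A'.map (algebraMap ℝ ℂ))) :
    μ ∈ spectrum ℂ (A.map (algebraMap ℝ ℂ)) := by
  obtain ⟨v, hv, hAv⟩ := exists_eigenvector_of_mem_spectrum hμ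
  refine mem_spectrum_of_eigenvector (v := T.map (algebraMap ℝ ℂ) *ᵥ v) (fun h0 => hv ?_) ?_
  · have := congrArg (fun x => T'.map (algebraMap ℝ ℂ) *ᵥ x) h0
    simp only [Matrix.mulVec_mulVec, ← Matrix.map_mul, h2, Matrix.mulVec_zero] at this
    simpa using this
  · rw [Matrix.mulVec_mulVec, ← Matrix.map_mul, hA, Matrix.map_mul, ← Matrix.mulVec_mulVec, hAv,
      Matrix.mulVec_smul]

end ExpSpectrum

/-! ### Markov parameters of decoupled models -/

namespace DecoupledModel

variable {d m c n : ℕ}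

open StateSpaceModel

lemma markov_toModel_zero (M : DecoupledModel d m c n) :
    M.toModel.markov 0 = M.C₁ * M.B₁ + M.C₂ * M.B₂ := by
  simp [markov, toModel, Matrix.fromCols_mul_fromRows]

lemma markov_toModel_succ (M : DecoupledModel d m c n) (k : ℕ) :
    M.toModel.markov (k + 1) = M.stablePart.markov (k + 1) := by
  have h : M.toModel.A ^ (k + 1) = Matrix.fromBlocks 0 0 0 (M.A₂ ^ (k + 1)) := by
    rw [toModel, Matrix.fromBlocks_diagonal_pow, zero_pow k.succ_ne_zero]
  rw [markov, h, toModel, Matrix.fromCols_mul_fromBlocks, Matrix.fromCols_mul_fromRows]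
  simp [markov, stablePart]

lemma stablePart_isMinimal {M : DecoupledModel d m c n} (h : M.toModel.IsMinimal) :
    M.stablePart.IsMinimal := by
  intro n' S' hS'
  have hm := markov_eq_of_transferFunction_eq hS'
  let M' : DecoupledModel d m c n' := ⟨S'.A, M.B₁, S'.B, M.C₁, S'.C⟩
  have h0 : M'.stablePart.markov = M.stablePart.markov := funext hm
  have := h.card_le M'.toModel fun k => by
    cases k with
    | zero =>
      have h1 := congrFun h0 0
      simp only [markov, pow_zero, Matrix.mul_one] at h1
      change M'.C₂ * M'.B₂ = M.C₂ * M.B₂ at h1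
      rw [markov_toModel_zero, markov_toModel_zero, h1]
    | succ k => rw [markov_toModel_succ, markov_toModel_succ, h0]
  simpa using this

/-- The residue `C₁ B₁` of the transfer function at `0` has full rank: a factorization through a
smaller space would give a smaller realization. -/
lemma rank_mul_eq {M : DecoupledModel d m c n} (h : M.toModel.IsMinimal) :
    (M.C₁ * M.B₁).rank = c := by
  refine le_antisymm ((Matrix.rank_mul_le_left _ _).trans (by simpa using M.C₁.rank_le_width)) ?_
  obtain ⟨u, -, -, hu⟩ := exists_mul_eq_of_rank_le (M.C₁ * M.B₁) rfl
  let M' : DecoupledModel d m (M.C₁ * M.B₁).rank n :=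
    ⟨M.A₂, uᵀ * (M.C₁ * M.B₁), M.B₂, u, M.C₂⟩
  have := h.card_le M'.toModel fun k => by
    cases k with
    | zero => rw [markov_toModel_zero, markov_toModel_zero]; simp only [M', hu]
    | succ k => rw [markov_toModel_succ, markov_toModel_succ]; rfl
  simpa using this

/-- The direct transmission `C₂ B₂` of a stable part is determined by the higher Markov parameters,
since `0` is not a root of the characteristic polynomials. -/
lemma markov_stablePart_zero_eq {n' : ℕ} {S : StateSpaceModel d m (Fin n)}
    {S' : StateSpaceModel d m (Fin n')} (hS : S.A.det ≠ 0) (hS' : S'.A.det ≠ 0)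
    (h : ∀ k, S.markov (k + 1) = S'.markov (k + 1)) : S.markov 0 = S'.markov 0 := by
  set p := S.A.charpoly * S'.A.charpoly with hp
  have h1 : Polynomial.aeval S.A p = 0 := by rw [hp, map_mul, Matrix.aeval_self_charpoly, zero_mul]
  have h2 : Polynomial.aeval S'.A p = 0 := by
    rw [hp, map_mul, Matrix.aeval_self_charpoly, mul_zero]
  have h0 : p.coeff 0 ≠ 0 := by
    rw [hp, Polynomial.mul_coeff_zero]
    rw [Matrix.det_eq_sign_charpoly_coeff] at hS hS'
    exact mul_ne_zero (right_ne_zero_of_mul hS) (right_ne_zero_of_mul hS')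
  have key : ∀ {n : ℕ} (S : StateSpaceModel d m (Fin n)), Polynomial.aeval S.A p = 0 →
      p.coeff 0 • S.markov 0 =
        -∑ k ∈ Finset.range p.natDegree, p.coeff (k + 1) • S.markov (k + 1) := by
    intro n S hS
    have h := congrArg (fun N => S.C * N * S.B) hS
    simp only [Polynomial.aeval_eq_sum_range, Finset.sum_range_succ', Matrix.mul_add,
      Matrix.add_mul, Matrix.mul_sum, Matrix.sum_mul, Matrix.mul_smul, Matrix.smul_mul,
      Matrix.mul_zero, Matrix.zero_mul] at h
    rw [eq_neg_iff_add_eq_zero, add_comm]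
    exact h
  have h3 := key S h1
  simp only [h] at h3
  rw [← key S' h2] at h3
  exact smul_right_injective _ h0 h3

end DecoupledModel

/-! ### The canonical form: decoupling and uniqueness -/

namespace DecoupledModel

variable {d m c n : ℕ}

open StateSpaceModel

lemma mem_spectrum_fromBlocks_zero {A₂ : Matrix (Fin n) (Fin n) ℂ} {μ : ℂ}
    (h : μ ∈ spectrum ℂ A₂) :
    μ ∈ spectrum ℂ (Matrix.fromBlocks (0 : Matrix (Fin c) (Fin c) ℂ) 0 0 A₂) := by
  obtain ⟨v, hv, hAv⟩ := exists_eigenvector_of_mem_spectrum h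
  refine mem_spectrum_of_eigenvector (v := Sum.elim 0 v) (fun h0 => hv ?_) ?_
  · ext i; exact congrFun h0 (Sum.inr i)
  · rw [Matrix.fromBlocks_mulVec]
    ext (i | i)
    · simp
    · simpa using congrFun hAv i

/-- If the eigenvalue `0` of `A` is semisimple and all other eigenvalues lie in the open left
half-plane, then a minimal model has the same transfer function as a decoupled model with stable
second part: the state space is the direct sum of the kernel and the range of `A`. -/
lemma exists_toModel_obsEquiv {N : ℕ} {S : StateSpaceModel d m (Fin N)} (hmin : S.IsMinimal)
    (hspec : ∀ μ ∈ spectrum ℂ (S.A.map (algebraMap ℝ ℂ)), μ.re < 0 ∨ μ = 0)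
    (halg : S.A.charpoly.rootMultiplicity 0 = c)
    (hgeo : Module.finrank ℝ (Module.End.eigenspace (Matrix.toLin' S.A) 0) = c) :
    ∃ M : DecoupledModel d m c (N - c), S.ObsEquiv M.toModel ∧ M.stablePart.IsStable := by
  set φ : Module.End ℝ (Fin N → ℝ) := Matrix.toLin' S.A with hφ
  have hker : φ.eigenspace 0 = LinearMap.ker φ := Module.End.eigenspace_zero φ
  have hgen : φ.maxGenEigenspace 0 = φ.eigenspace 0 := by
    refine (Submodule.eq_of_le_of_finrank_eq ?_ ?_).symm
    · exact φ.genEigenspace_le_maximal 0 1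
    · rw [LinearMap.finrank_maxGenEigenspace_eq, hgeo, ← halg, hφ, Matrix.charpoly_toLin']
  have hdisj : Disjoint (LinearMap.ker φ) (LinearMap.range φ) := by
    rw [Submodule.disjoint_def]
    rintro _ hx ⟨y, rfl⟩
    have hy : y ∈ φ.maxGenEigenspace 0 := by
      rw [Module.End.mem_maxGenEigenspace]
      refine ⟨2, ?_⟩
      rw [zero_smul, sub_zero, pow_two]
      exact hx
    rw [hgen, hker] at hy
    exact hy
  have hkd : Module.finrank ℝ (LinearMap.ker φ) = c := by rw [← hker, hgeo]
  have hsum := φ.finrank_range_add_finrank_ker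
  have hcN : c ≤ N := by simp at hsum; omega
  have hrd : Module.finrank ℝ (LinearMap.range φ) = N - c := by simp at hsum; omega
  have hcompl : IsCompl (LinearMap.ker φ) (LinearMap.range φ) :=
    ⟨hdisj, by
      rw [codisjoint_iff]
      exact Submodule.eq_top_of_disjoint _ _ (by rw [add_comm, hsum]) hdisj⟩
  let b₁ := Module.finBasisOfFinrankEq ℝ _ hkd
  let b₂ := Module.finBasisOfFinrankEq ℝ _ hrd
  let e := Submodule.prodEquivOfIsCompl _ _ hcompl
  let b := (b₁.prod b₂).map e
  have hbl : ∀ i, φ (b (Sum.inl i)) = 0 := by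
    intro i
    have : b (Sum.inl i) = (b₁ i : Fin N → ℝ) := by simp [b, e]
    rw [this]; exact (b₁ i).2
  have hbr : ∀ i, b (Sum.inr i) ∈ LinearMap.range φ := by
    intro i
    have : b (Sum.inr i) = (b₂ i : Fin N → ℝ) := by simp [b, e]
    rw [this]; exact (b₂ i).2
  have hrepr : ∀ x i, b.repr (φ x) (Sum.inl i) = 0 := by
    intro x i
    have h1 : e.symm (φ x) = (0, ⟨φ x, LinearMap.mem_range_self φ x⟩) :=
      Submodule.prodEquivOfIsCompl_symm_apply_right _ _ hcompl
        (⟨φ x, LinearMap.mem_range_self φ x⟩ : LinearMap.range φ)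
    simp [b, h1]
  let T : Matrix (Fin N) (Fin c ⊕ Fin (N - c)) ℝ := Matrix.of fun i k => b k i
  let T' : Matrix (Fin c ⊕ Fin (N - c)) (Fin N) ℝ := Matrix.of fun k i => b.repr (Pi.single i 1) k
  have hTs : ∀ k, T *ᵥ Pi.single k 1 = b k := fun k => by
    rw [Matrix.mulVec_single_one]; rfl
  have hT'v : ∀ x, T' *ᵥ x = b.repr x := by
    intro x
    ext k
    conv_rhs => rw [← Finset.univ_sum_single x]
    rw [map_sum, Finsupp.finsetSum_apply, Matrix.mulVec, dotProduct]
    refine Finset.sum_congr rfl fun i _ => ?_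
    have : (Pi.single i (x i) : Fin N → ℝ) = x i • Pi.single i 1 := by
      rw [← Pi.single_smul, smul_eq_mul, mul_one]
    rw [this, map_smul, Finsupp.smul_apply, smul_eq_mul, mul_comm]
    rfl
  have hT'T : T' * T = 1 := by
    refine Matrix.ext_of_mulVec_single fun k => ?_
    rw [← Matrix.mulVec_mulVec, hTs, hT'v, b.repr_self, Matrix.one_mulVec]
    ext l; simp [Finsupp.single_apply, Pi.single_apply, eq_comm]
  have hTT' : T * T' = 1 := by
    have hcard : Fintype.card (Fin N) = Fintype.card (Fin c ⊕ Fin (N - c)) := by simp; omega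
    exact (Matrix.mul_eq_one_comm_of_card_eq _ _ _ hcard).2 hT'T
  have hφm : ∀ x, S.A *ᵥ x = φ x := fun x => (Matrix.toLin'_apply S.A x).symm
  let D := T' * S.A * T
  have hD : D = Matrix.fromBlocks 0 0 0 D.toBlocks₂₂ := by
    have hent : ∀ k l, D k l = b.repr (φ (b l)) k := by
      intro k l
      have : D *ᵥ Pi.single l 1 = b.repr (φ (b l)) := by
        rw [← Matrix.mulVec_mulVec, ← Matrix.mulVec_mulVec, hTs, hφm, hT'v]
      rw [← this, Matrix.mulVec_single_one]; rfl
    ext (k | k) (l | l)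
    · rw [hent, hrepr]; rfl
    · rw [hent, hrepr]; rfl
    · rw [hent, hbl, map_zero]; rfl
    · rfl
  have hAT : S.A * T = T * D := by
    simp only [D, ← Matrix.mul_assoc, hTT', Matrix.one_mul]
  let M : DecoupledModel d m c (N - c) := ⟨D.toBlocks₂₂, (T' * S.B).toRows₁, (T' * S.B).toRows₂,
    (S.C * T).toCols₁, (S.C * T).toCols₂⟩
  have htf : S.transferFunction = M.toModel.transferFunction := by
    refine transferFunction_eq_of_markov_eq (markov_eq_of_intertwine T ?_ ?_ ?_)
    · rw [hAT, hD]; rfl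
    · change T * Matrix.fromRows (T' * S.B).toRows₁ (T' * S.B).toRows₂ = S.B
      rw [Matrix.fromRows_toRows, ← Matrix.mul_assoc, hTT', Matrix.one_mul]
    · exact (Matrix.fromCols_toCols _).symm
  refine ⟨M, ⟨hmin, isMinimal_of_card_le hmin _ htf (by simp; omega), htf⟩, fun μ hμ => ?_⟩
  have hμ' : μ ∈ spectrum ℂ (D.map (algebraMap ℝ ℂ)) := by
    rw [hD, Matrix.fromBlocks_map]
    have h := mem_spectrum_fromBlocks_zero (c := c) hμ
    change μ ∈ spectrum ℂ (Matrix.fromBlocks 0 0 0 (D.toBlocks₂₂.map (algebraMap ℝ ℂ))) at h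
    simpa using h
  rcases hspec μ (spectrum_eq_of_iso hT'T hAT hμ') with h | rfl
  · exact h
  -- a vector in the kernel of `A₂` yields one in both the kernel and the range of `A`
  exfalso
  rw [spectrum.zero_mem_iff, Matrix.isUnit_iff_isUnit_det, ← RingHom.mapMatrix_apply,
    ← RingHom.map_det, isUnit_iff_ne_zero, not_not, map_eq_zero] at hμ
  obtain ⟨v, hv, hAv⟩ := Matrix.exists_mulVec_eq_zero_iff.2 hμ
  set w : Fin c ⊕ Fin (N - c) → ℝ := Sum.elim 0 v with hw
  have h1 : T *ᵥ w ∈ LinearMap.range φ := by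
    have : T *ᵥ w = ∑ k, w k • b k := by
      ext i; simp [Matrix.mulVec, dotProduct, T, mul_comm]
    rw [this]
    refine Submodule.sum_mem _ fun k _ => ?_
    rcases k with k | k
    · simp [hw]
    · exact Submodule.smul_mem _ _ (hbr k)
  have h2 : T *ᵥ w ∈ LinearMap.ker φ := by
    rw [LinearMap.mem_ker, ← hφm, Matrix.mulVec_mulVec, hAT, ← Matrix.mulVec_mulVec, hD,
      Matrix.fromBlocks_mulVec]
    have h3 : D.toBlocks₂₂ *ᵥ v = 0 := hAv
    have h4 : (Sum.elim ((0 : Matrix (Fin c) (Fin c) ℝ) *ᵥ (w ∘ Sum.inl) +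
        (0 : Matrix (Fin c) (Fin (N - c)) ℝ) *ᵥ (w ∘ Sum.inr))
        ((0 : Matrix (Fin (N - c)) (Fin c) ℝ) *ᵥ (w ∘ Sum.inl) +
          D.toBlocks₂₂ *ᵥ (w ∘ Sum.inr)) : Fin c ⊕ Fin (N - c) → ℝ) = 0 := by
      have h5 : w ∘ Sum.inr = v := rfl
      rw [h5, h3]
      ext (i | i) <;> simp
    rw [h4, Matrix.mulVec_zero]
  have h3 := (Submodule.disjoint_def.1 hdisj) _ h2 h1
  have h4 := congrArg (fun x => T' *ᵥ x) h3
  simp only [Matrix.mulVec_mulVec, hT'T, Matrix.one_mulVec, Matrix.mulVec_zero] at h4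
  exact hv (funext fun i => congrFun h4 (Sum.inr i))

/-- The matrices `A₂`, `B₂`, `C₂` are determined by the stable part of the transfer function, and the
matrices `B₁`, `C₁` by its residue `C₁ B₁` at `0`. -/
theorem existsUnique_isCanonicalFormOf {N : ℕ} {S : StateSpaceModel d m (Fin N)}
    (hmin : S.IsMinimal)
    (hspec : ∀ μ ∈ spectrum ℂ (S.A.map (algebraMap ℝ ℂ)), μ.re < 0 ∨ μ = 0)
    (halg : S.A.charpoly.rootMultiplicity 0 = c)
    (hgeo : Module.finrank ℝ (Module.End.eigenspace (Matrix.toLin' S.A) 0) = c)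
    {K : ∀ n : ℕ, StateSpaceModel d m (Fin n) → Prop} (hK : IsCanonicalForm K) :
    ∃! M : DecoupledModel d m c (N - c), M.IsCanonicalFormOf K S := by
  obtain ⟨M₀, ⟨-, hM₀, htf₀⟩, hst₀⟩ := exists_toModel_obsEquiv hmin hspec halg hgeo
  refine existsUnique_of_exists_of_unique ?_ ?_
  · have hsm := stablePart_isMinimal hM₀
    obtain ⟨S', ⟨hobs, hKS'⟩, -⟩ := hK _ M₀.stablePart hsm hst₀
    obtain ⟨T, T', -, hT'T, hA, -, -⟩ := hobs.exists_iso
    obtain ⟨u, hu, hplt, huG⟩ := exists_mul_eq_of_rank_le (M₀.C₁ * M₀.B₁) (rank_mul_eq hM₀)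
    let M : DecoupledModel d m c (N - c) := ⟨S'.A, uᵀ * (M₀.C₁ * M₀.B₁), S'.B, u, S'.C⟩
    have hmk := markov_eq_of_transferFunction_eq hobs.2.2
    have htf : S.transferFunction = M.toModel.transferFunction := by
      rw [htf₀]
      refine transferFunction_eq_of_markov_eq fun k => ?_
      cases k with
      | zero =>
        have h0 := hmk 0
        simp only [markov, pow_zero, Matrix.mul_one] at h0
        rw [markov_toModel_zero, markov_toModel_zero]
        change _ + M₀.stablePart.C * M₀.stablePart.B = u * (uᵀ * (M₀.C₁ * M₀.B₁)) + S'.C * S'.B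
        rw [h0, huG]
      | succ k =>
        rw [markov_toModel_succ, markov_toModel_succ]
        exact hmk (k + 1)
    refine ⟨M, ⟨hmin, isMinimal_of_card_le hM₀ _ (htf₀.symm.trans htf) le_rfl, htf⟩, ?_, hu, hplt,
      hKS'⟩
    exact (spectrum_exp_norm_lt_one_iff _).2 fun μ hμ => hst₀ μ (spectrum_eq_of_iso hT'T hA hμ)
  · intro M M' h h'
    have hst : M.stablePart.IsStable := (spectrum_exp_norm_lt_one_iff _).1 h.exp_lt_one
    have hst' : M'.stablePart.IsStable := (spectrum_exp_norm_lt_one_iff _).1 h'.exp_lt_one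
    have hmk := markov_eq_of_transferFunction_eq (h.obsEquiv.2.2.symm.trans h'.obsEquiv.2.2)
    have hsucc : ∀ k, M.stablePart.markov (k + 1) = M'.stablePart.markov (k + 1) := by
      intro k; rw [← markov_toModel_succ, hmk, markov_toModel_succ]
    have hzero := markov_stablePart_zero_eq (det_ne_zero_of_stable hst)
      (det_ne_zero_of_stable hst') hsucc
    have hsm := stablePart_isMinimal h.obsEquiv.2.1
    have hsm' := stablePart_isMinimal h'.obsEquiv.2.1
    have hstable : M.stablePart = M'.stablePart := by
      refine (hK _ M.stablePart hsm hst).unique ⟨⟨hsm, hsm, rfl⟩, h.canonical⟩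
        ⟨⟨hsm, hsm', transferFunction_eq_of_markov_eq fun k => ?_⟩, h'.canonical⟩
      cases k with
      | zero => exact hzero
      | succ k => exact hsucc k
    have hG : M.C₁ * M.B₁ = M'.C₁ * M'.B₁ := by
      have h1 := hmk 0
      rw [markov_toModel_zero, markov_toModel_zero] at h1
      simp only [markov, pow_zero, Matrix.mul_one] at hzero
      change M.C₂ * M.B₂ = M'.C₂ * M'.B₂ at hzero
      rw [hzero] at h1
      exact add_right_cancel h1
    -- `B₁` has full row rank, hence a right inverse, and so `C₁ = C₁' R`
    obtain ⟨E, hE⟩ : ∃ E : Matrix (Fin m) (Fin c) ℝ, M.B₁ * E = 1 := by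
      refine Matrix.mulVec_surjective_iff_exists_right_inverse.1 ?_
      have hr : M.B₁.rank = c := le_antisymm (by simpa using M.B₁.rank_le_height)
        ((rank_mul_eq h.obsEquiv.2.1).symm.le.trans (Matrix.rank_mul_le_right _ _))
      have : LinearMap.range M.B₁.mulVecLin = ⊤ :=
        Submodule.eq_top_of_finrank_eq (by rw [← Matrix.rank, hr]; simp)
      exact LinearMap.range_eq_top.1 this
    have hC : M.C₁ = M'.C₁ := by
      refine h.positiveLowerTriangular.eq_of_eq_mul h.orthonormal h'.orthonormal
        h'.positiveLowerTriangular (R := M'.B₁ * E) ?_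
      rw [← Matrix.mul_assoc, ← hG, Matrix.mul_assoc, hE, Matrix.mul_one]
    have hB : M.B₁ = M'.B₁ := by
      have : M.C₁ᵀ * (M.C₁ * M.B₁) = M.C₁ᵀ * (M'.C₁ * M'.B₁) := by rw [hG]
      rwa [← Matrix.mul_assoc, h.orthonormal, hC, ← Matrix.mul_assoc, h'.orthonormal,
        Matrix.one_mul, Matrix.one_mul] at this
    ext1
    · exact congrArg StateSpaceModel.A hstable
    · exact hB
    · exact congrArg StateSpaceModel.B hstable
    · exact hC
    · exact congrArg StateSpaceModel.C hstable

end DecoupledModel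

/-! ### Output processes of equivalent models -/

namespace StateSpaceModel

variable {d m : ℕ} {ι κ : Type} [Fintype ι] [Fintype κ]

lemma intervalIntegral_mulVec (A : Matrix κ ι ℝ) {f : ℝ → ι → ℝ} {a b : ℝ}
    (hf : IntervalIntegrable f volume a b) :
    IntervalIntegrable (fun s => A *ᵥ f s) volume a b ∧
      ∫ s in a..b, A *ᵥ f s = A *ᵥ ∫ s in a..b, f s := by
  let l : (ι → ℝ) →L[ℝ] (κ → ℝ) := LinearMap.toContinuousLinearMap A.mulVecLin
  exact ⟨⟨l.integrable_comp hf.1, l.integrable_comp hf.2⟩, l.intervalIntegral_comp_comm hf⟩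

lemma IsOutput.of_iso {S : StateSpaceModel d m ι} {S' : StateSpaceModel d m κ} {T : Matrix ι κ ℝ}
    (hA : S.A * T = T * S'.A) (hB : T * S'.B = S.B) (hC : S.C * T = S'.C) {Ω : Type*}
    [MeasurableSpace Ω] {P : Measure Ω} {L : ℝ → Ω → Fin m → ℝ} {t₀ : ℝ} {Y : ℝ → Ω → Fin d → ℝ}
    (h : S'.IsOutput P L t₀ Y) : S.IsOutput P L t₀ Y := by
  obtain ⟨X, ⟨hX1, hX2⟩, hY⟩ := h
  refine ⟨fun t ω => T *ᵥ X t ω, ⟨fun t ht => ?_, ?_⟩, ?_⟩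
  · exact ((continuous_const.matrix_mulVec continuous_id).measurable).comp (hX1 t ht)
  · filter_upwards [hX2] with ω hω t ht
    obtain ⟨h1, h2⟩ := hω t ht
    refine ⟨(intervalIntegral_mulVec T h1).1, ?_⟩
    have h3 := (intervalIntegral_mulVec S'.A h1).2
    have h4 := (intervalIntegral_mulVec (S.A * T) h1).2
    simp only [Matrix.mulVec_mulVec]
    rw [h2, h4, h3, Matrix.mulVec_add, Matrix.mulVec_add, Matrix.mulVec_mulVec,
      Matrix.mulVec_mulVec, hA, hB]
  · filter_upwards [hY] with ω hω t ht
    rw [hω t ht, Matrix.mulVec_mulVec, hC]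

variable [DecidableEq ι] [DecidableEq κ]

/-- Observationally equivalent models have the same output processes. -/
lemma ObsEquiv.isOutput_iff {S : StateSpaceModel d m ι} {S' : StateSpaceModel d m κ}
    (h : S.ObsEquiv S') {Ω : Type*} [MeasurableSpace Ω] (P : Measure Ω) (L : ℝ → Ω → Fin m → ℝ)
    (t₀ : ℝ) (Y : ℝ → Ω → Fin d → ℝ) : S.IsOutput P L t₀ Y ↔ S'.IsOutput P L t₀ Y := by
  obtain ⟨T, T', hTT', hT'T, hA, hB, hC⟩ := h.exists_iso
  refine ⟨fun hY => hY.of_iso (T := T') ?_ ?_ ?_, fun hY => hY.of_iso hA hB hC⟩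
  · have := congrArg (fun X => T' * X * T') hA
    simp only [Matrix.mul_assoc, hTT', Matrix.mul_one] at this
    simpa only [← Matrix.mul_assoc, hT'T, Matrix.one_mul] using this.symm
  · rw [← hB, ← Matrix.mul_assoc, hT'T, Matrix.one_mul]
  · rw [← hC, Matrix.mul_assoc, hTT', Matrix.mul_one]

end StateSpaceModel

/-! ### Second moments of the increments -/

section SecondOrder

variable {Ω : Type*} [MeasurableSpace Ω] {P : Measure Ω}

lemma eLpNorm_two_eq {α : Type*} [MeasurableSpace α] {μ : Measure α} {f : α → ℝ}
    (hf : MemLp f 2 μ) : eLpNorm f 2 μ = ENNReal.ofReal √(∫ x, f x ^ 2 ∂μ) := by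
  rw [hf.eLpNorm_eq_integral_rpow_norm (by norm_num) (by norm_num)]
  simp [Real.sqrt_eq_rpow]

/-- If the sum of two independent random variables is square-integrable, so is each of them. -/
lemma memLp_two_of_indepFun_add [IsProbabilityMeasure P] {X Y : Ω → ℝ} (hX : Measurable X)
    (hY : Measurable Y) (h : IndepFun X Y P) (hXY : MemLp (fun ω => X ω + Y ω) 2 P) :
    MemLp X 2 P := by
  have hmap := (indepFun_iff_map_prod_eq_prod_map_map hX.aemeasurable hY.aemeasurable).1 h
  have : IsProbabilityMeasure (P.map X) := Measure.isProbabilityMeasure_map hX.aemeasurable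
  have : IsProbabilityMeasure (P.map Y) := Measure.isProbabilityMeasure_map hY.aemeasurable
  have h1 : Integrable (fun p : ℝ × ℝ => (p.1 + p.2) ^ 2) ((P.map X).prod (P.map Y)) := by
    rw [← hmap, integrable_map_measure (by fun_prop) (by fun_prop)]
    exact hXY.integrable_sq
  -- by Fubini's theorem `X + y` is square-integrable for some constant `y`
  obtain ⟨y, hy⟩ := h1.prod_left_ae.exists
  have h2 : MemLp (fun x : ℝ => x + y) 2 (P.map X) :=
    (memLp_two_iff_integrable_sq (by fun_prop)).2 hy
  have h3 : MemLp (fun x : ℝ => x) 2 (P.map X) := by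
    have := h2.sub (memLp_const y)
    refine this.congr_norm (by fun_prop) (Eventually.of_forall fun x => by simp)
  exact (memLp_map_measure_iff (by fun_prop) hX.aemeasurable).1 h3

/-- A nonnegative additive function on `[0, ∞)` is linear. -/
lemma eq_mul_of_additive_nonneg {V : ℝ → ℝ} (hadd : ∀ r s, 0 ≤ r → 0 ≤ s → V (r + s) = V r + V s)
    (hpos : ∀ r, 0 ≤ r → 0 ≤ V r) {r : ℝ} (hr : 0 ≤ r) : V r = r * V 1 := by
  have hmul : ∀ (n : ℕ) {r : ℝ}, 0 ≤ r → V (n * r) = n * V r := by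
    intro n r hr
    induction n with
    | zero =>
      have := hadd 0 0 le_rfl le_rfl
      simp at this ⊢
      exact this
    | succ n ih =>
      push_cast
      rw [add_mul, one_mul, hadd _ _ (by positivity) hr, ih]
      ring
  have hmono : ∀ r s, 0 ≤ r → r ≤ s → V r ≤ V s := by
    intro r s hr hrs
    have := hadd r (s - r) hr (sub_nonneg.2 hrs)
    rw [add_sub_cancel] at this
    linarith [hpos _ (sub_nonneg.2 hrs)]
  have hV1 := hpos 1 zero_le_one
  have hb : ∀ n : ℕ, n * |V r - r * V 1| ≤ V 1 := by
    intro n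
    have hnr : 0 ≤ n * r := by positivity
    have h1 := hmono _ _ (Nat.cast_nonneg _) (Nat.floor_le hnr)
    have h2 := hmono _ _ hnr (Nat.lt_floor_add_one (n * r)).le
    have e1 := hmul ⌊n * r⌋₊ zero_le_one
    have e2 := hmul (⌊n * r⌋₊ + 1) zero_le_one
    push_cast at e2
    rw [mul_one] at e1 e2
    rw [e1, hmul n hr] at h1
    rw [e2, hmul n hr] at h2
    have h3 := mul_le_mul_of_nonneg_right (Nat.floor_le hnr) hV1
    have h4 := mul_le_mul_of_nonneg_right (Nat.lt_floor_add_one (n * r)).le hV1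
    rw [← abs_of_nonneg (Nat.cast_nonneg (α := ℝ) n), ← abs_mul, abs_le]
    constructor <;> nlinarith
  by_contra hne
  have hpos' : 0 < |V r - r * V 1| := abs_pos.2 (sub_ne_zero.2 hne)
  obtain ⟨n, hn⟩ := exists_nat_gt (V 1 / |V r - r * V 1|)
  rw [div_lt_iff₀ hpos'] at hn
  linarith [hb n]

/-- A real process whose increments are square-integrable with
`E (ℓ(t) - ℓ(s))² = σ |t - s|`. By polarization its increments over disjoint intervals are
orthogonal, which is what the `L²` integral needs. -/
structure IsL2Noise (ℓ : ℝ → Ω → ℝ) (P : Measure Ω) (σ : ℝ) : Prop where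
  memLp : ∀ s t, MemLp (fun ω => ℓ t ω - ℓ s ω) 2 P
  sq : ∀ s t, ∫ ω, (ℓ t ω - ℓ s ω) ^ 2 ∂P = σ * |t - s|

/-- A centred process with stationary independent increments is an `L²` noise. The variance of the
increments is additive, hence linear in time; the mean is additive, vanishes at the rationals, and
the increments over short intervals tend to `0` both almost surely and, after centring, in `L²`. -/
lemma exists_isL2Noise [IsProbabilityMeasure P] {ℓ : ℝ → Ω → ℝ} (hm : ∀ t, Measurable (ℓ t))
    (hi : HasIndepIncrements ℓ P)
    (hs : ∀ s t h, IdentDistrib (fun ω => ℓ (t + h) ω - ℓ (s + h) ω) (fun ω => ℓ t ω - ℓ s ω) P P)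
    (hc : ∀ᵐ ω ∂P, ContinuousWithinAt (fun t => ℓ t ω) (Set.Ici 0) 0)
    (h1 : MemLp (fun ω => ℓ 1 ω - ℓ 0 ω) 2 P) (h1' : ∫ ω, (ℓ 1 ω - ℓ 0 ω) ∂P = 0) :
    ∃ σ, IsL2Noise ℓ P σ := by
  have hdm : ∀ s t, Measurable fun ω => ℓ t ω - ℓ s ω := fun s t => (hm t).sub (hm s)
  have hind : ∀ {r s t : ℝ}, r ≤ s → s ≤ t →
      IndepFun (fun ω => ℓ s ω - ℓ r ω) (fun ω => ℓ t ω - ℓ s ω) P :=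
    fun hrs hst => hi.indepFun_sub_sub hrs hst
  have hid : ∀ r s, IdentDistrib (fun ω => ℓ (s + r) ω - ℓ s ω) (fun ω => ℓ r ω - ℓ 0 ω) P P := by
    intro r s
    have := hs 0 r s
    rwa [zero_add, add_comm r s] at this
  -- square-integrability of the increments from time `0`
  have hL01 : ∀ t, 0 ≤ t → t ≤ 1 → MemLp (fun ω => ℓ t ω - ℓ 0 ω) 2 P := by
    intro t h0 ht
    refine memLp_two_of_indepFun_add (hdm 0 t) (hdm t 1) (hind h0 ht) ?_
    convert h1 using 2
    ring
  have hL0 : ∀ (n : ℕ) (t : ℝ), 0 ≤ t → t ≤ n → MemLp (fun ω => ℓ t ω - ℓ 0 ω) 2 P := by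
    intro n
    induction n with
    | zero => intro t h0 ht; exact hL01 t h0 (by push_cast at ht; linarith)
    | succ n ih =>
      intro t h0 ht
      push_cast at ht
      by_cases h : t ≤ 1
      · exact hL01 t h0 h
      · have h2 := ih (t - 1) (by linarith) (by linarith)
        have h3 := (hid 1 (t - 1)).symm.memLp_snd h1
        have h4 := h3.add h2
        refine h4.congr_norm (hdm 0 t).aestronglyMeasurable
          (Eventually.of_forall fun ω => ?_)
        simp
  have hL : ∀ t, 0 ≤ t → MemLp (fun ω => ℓ t ω - ℓ 0 ω) 2 P := fun t ht =>
    hL0 ⌈t⌉₊ t ht (Nat.le_ceil t)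
  set M : ℝ → ℝ := fun t => ∫ ω, (ℓ t ω - ℓ 0 ω) ∂P with hM
  set V : ℝ → ℝ := fun t => Var[fun ω => ℓ t ω - ℓ 0 ω; P] with hV
  have hLs : ∀ r s, 0 ≤ r → MemLp (fun ω => ℓ (s + r) ω - ℓ s ω) 2 P := fun r s hr =>
    (hid r s).symm.memLp_snd (hL r hr)
  have hsplit : ∀ r s, (fun ω => ℓ (r + s) ω - ℓ 0 ω) =
      (fun ω => ℓ r ω - ℓ 0 ω) + fun ω => ℓ (r + s) ω - ℓ r ω := by
    intro r s; ext ω; simp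
  have hMadd : ∀ r s, 0 ≤ r → 0 ≤ s → M (r + s) = M r + M s := by
    intro r s hr h's
    simp only [hM]
    rw [← (hid s r).integral_eq, ← integral_add ((hL r hr).integrable one_le_two)
      ((hLs s r h's).integrable one_le_two)]
    exact integral_congr_ae (Eventually.of_forall fun ω => by simp)
  have hVadd : ∀ r s, 0 ≤ r → 0 ≤ s → V (r + s) = V r + V s := by
    intro r s hr h's
    simp only [hV]
    rw [hsplit, IndepFun.variance_add (hL r hr) (hLs s r h's) (hind hr (by linarith)),
      (hid s r).variance_eq]
  have hVlin : ∀ r, 0 ≤ r → V r = r * V 1 := fun r hr =>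
    eq_mul_of_additive_nonneg hVadd (fun r _ => variance_nonneg _ _) hr
  have hMmul : ∀ (n : ℕ) {r : ℝ}, 0 ≤ r → M (n * r) = n * M r := by
    intro n r hr
    induction n with
    | zero => simp [hM]
    | succ n ih =>
      push_cast
      rw [add_mul, one_mul, hMadd _ _ (by positivity) hr, ih]
      ring
  have hMzero : ∀ r, 0 ≤ r → M r = 0 := by
    intro r hr
    -- `s n` is the distance from `r` to the next lower multiple of `1 / (n + 1)`
    set s : ℕ → ℝ := fun n => r - ⌊(n + 1 : ℕ) * r⌋₊ / ((n + 1 : ℕ) : ℝ) with hsn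
    have hpos : ∀ n : ℕ, (0 : ℝ) < ((n + 1 : ℕ) : ℝ) := fun n => by positivity
    have hs0 : ∀ n, 0 ≤ s n := by
      intro n
      rw [hsn]
      simp only
      rw [sub_nonneg, div_le_iff₀ (hpos n), mul_comm]
      exact Nat.floor_le (by positivity)
    have hs1 : ∀ n, s n ≤ 1 / ((n : ℝ) + 1) := by
      intro n
      have := (Nat.lt_floor_add_one (((n + 1 : ℕ) : ℝ) * r)).le
      have hp := hpos n
      rw [hsn]
      simp only
      rw [sub_le_iff_le_add, ← Nat.cast_succ, ← add_div, le_div_iff₀ hp]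
      linarith
    have hMs : ∀ n, M (s n) = M r := by
      intro n
      have h2 : M (⌊(n + 1 : ℕ) * r⌋₊ / ((n + 1 : ℕ) : ℝ)) = 0 := by
        have h3 := hMmul (n + 1) (r := ⌊(n + 1 : ℕ) * r⌋₊ / ((n + 1 : ℕ) : ℝ)) (by positivity)
        rw [mul_div_cancel₀ _ (hpos n).ne'] at h3
        have h4 := hMmul ⌊(n + 1 : ℕ) * r⌋₊ zero_le_one
        rw [mul_one] at h4
        have h5 : M 1 = 0 := h1'
        rw [h4, h5, mul_zero] at h3
        exact (mul_eq_zero.1 h3.symm).resolve_left (hpos n).ne'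
      have h6 := hMadd (s n) (⌊(n + 1 : ℕ) * r⌋₊ / ((n + 1 : ℕ) : ℝ)) (hs0 n) (by positivity)
      rw [h2, add_zero, hsn] at h6
      simp only [sub_add_cancel] at h6
      exact h6.symm
    have hst : Tendsto s atTop (𝓝 0) :=
      squeeze_zero hs0 hs1 tendsto_one_div_add_atTop_nhds_zero_nat
    have hmeas : ∀ n, AEStronglyMeasurable (fun ω => ℓ (s n) ω - ℓ 0 ω) P := fun n =>
      (hdm _ _).aestronglyMeasurable
    -- the increment over `[0, s n]` has mean `M r` and tends to `0`, which forces `M r = 0`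
    have hA : TendstoInMeasure P (fun n ω => ℓ (s n) ω - ℓ 0 ω) atTop (fun _ => 0) := by
      refine tendstoInMeasure_of_tendsto_ae hmeas ?_
      filter_upwards [hc] with ω hω
      have h2 : Tendsto s atTop (𝓝[Set.Ici 0] 0) :=
        tendsto_nhdsWithin_iff.2 ⟨hst, Eventually.of_forall hs0⟩
      have := (Tendsto.comp hω h2).sub_const (ℓ 0 ω)
      simpa using this
    have hB : TendstoInMeasure P (fun n ω => ℓ (s n) ω - ℓ 0 ω) atTop (fun _ => M r) := by
      refine tendstoInMeasure_of_tendsto_eLpNorm (p := 2) (by norm_num) hmeas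
        aestronglyMeasurable_const ?_
      have hE : ∀ n, eLpNorm ((fun ω => ℓ (s n) ω - ℓ 0 ω) - fun _ => M r) 2 P =
          ENNReal.ofReal √(s n * V 1) := by
        intro n
        rw [eLpNorm_two_eq ((hL _ (hs0 n)).sub (memLp_const _)), ← hVlin _ (hs0 n)]
        simp only [hV]
        rw [variance_eq_integral (hmeas n).aemeasurable]
        congr 3
        ext ω
        rw [Pi.sub_apply, ← hMs n]
      simp only [hE]
      rw [← ENNReal.ofReal_zero]
      refine ENNReal.tendsto_ofReal ?_
      rw [← Real.sqrt_zero]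
      refine (Real.continuous_sqrt.tendsto 0).comp ?_
      simpa using hst.mul_const (V 1)
    obtain ⟨ω, hω⟩ := (tendstoInMeasure_ae_unique hB hA).exists
    exact hω
  have hsq : ∀ r, 0 ≤ r → ∫ ω, (ℓ r ω - ℓ 0 ω) ^ 2 ∂P = V 1 * r := by
    intro r hr
    rw [mul_comm, ← hVlin r hr]
    simp only [hV]
    rw [variance_of_integral_eq_zero (hdm 0 r).aemeasurable (hMzero r hr)]
  have hsq' : ∀ s t, s ≤ t → ∫ ω, (ℓ t ω - ℓ s ω) ^ 2 ∂P = V 1 * (t - s) := by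
    intro s t hst
    have h2 := (hid (t - s) s).sq.integral_eq
    rw [add_sub_cancel] at h2
    rw [← hsq _ (sub_nonneg.2 hst)]
    exact h2
  refine ⟨V 1, fun s t => ?_, fun s t => ?_⟩
  · rcases le_total s t with h | h
    · have := hLs (t - s) s (sub_nonneg.2 h)
      rwa [add_sub_cancel] at this
    · have := hLs (s - t) t (sub_nonneg.2 h)
      rw [add_sub_cancel] at this
      refine this.neg.congr_norm (hdm s t).aestronglyMeasurable
        (Eventually.of_forall fun ω => ?_)
      simp
  · rcases le_total s t with h | h
    · rw [abs_of_nonneg (sub_nonneg.2 h), hsq' s t h]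
    · rw [abs_sub_comm, abs_of_nonneg (sub_nonneg.2 h), ← hsq' t s h]
      congr 1
      ext ω
      ring

end SecondOrder

/-! ### The isometry and the stochastic integral of square-integrable functions -/

namespace StepFn

variable {Ω : Type*} [MeasurableSpace Ω] {P : Measure Ω} {ℓ : ℝ → Ω → ℝ} {σ : ℝ}

/-- The step function `c g + h`. -/
def comb (c : ℝ) (g h : StepFn) : StepFn where
  size := g.size + h.size
  a := Fin.append g.a h.a
  b := Fin.append g.b h.b
  w := Fin.append (fun i => c * g.w i) h.w
  le i := by
    refine Fin.addCases (fun i => ?_) (fun i => ?_) i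
    · simpa using g.le i
    · simpa using h.le i

lemma comb_toFun (c : ℝ) (g h : StepFn) (u : ℝ) :
    (comb c g h).toFun u = c * g.toFun u + h.toFun u := by
  change ∑ i : Fin (g.size + h.size), (Set.Ioc (Fin.append g.a h.a i)
    (Fin.append g.b h.b i)).indicator (fun _ => Fin.append (fun i => c * g.w i) h.w i) u = _
  simp only [toFun, Fin.sum_univ_add, Fin.append_left, Fin.append_right, Finset.mul_sum]
  congr 1
  refine Finset.sum_congr rfl fun i _ => ?_
  simp [Set.indicator_apply]

lemma comb_integral {Ω : Type*} {ℓ : ℝ → Ω → ℝ} (c : ℝ) (g h : StepFn) (ω : Ω) :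
    (comb c g h).integral ℓ ω = c * g.integral ℓ ω + h.integral ℓ ω := by
  change ∑ i : Fin (g.size + h.size), Fin.append (fun i => c * g.w i) h.w i *
    (ℓ (Fin.append g.b h.b i) ω - ℓ (Fin.append g.a h.a i) ω) = _
  simp only [integral, Fin.sum_univ_add, Fin.append_left, Fin.append_right, Finset.mul_sum,
    mul_assoc]

lemma integral_indicator_Ioc_mul (c c' : ℝ) {a b a' b' : ℝ} (h : a ≤ b) (h' : a' ≤ b') :
    ∫ u, (Set.Ioc a b).indicator (fun _ => c) u * (Set.Ioc a' b').indicator (fun _ => c') u =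
      c * c' * ((|b - a'| + |a - b'| - |b - b'| - |a - a'|) / 2) := by
  have h1 : (fun u => (Set.Ioc a b).indicator (fun _ => c) u *
      (Set.Ioc a' b').indicator (fun _ => c') u) =
      (Set.Ioc (max a a') (min b b')).indicator fun _ => c * c' := by
    ext u
    rw [← Set.Ioc_inter_Ioc, Set.inter_indicator_mul]
  rw [h1, integral_indicator_const _ measurableSet_Ioc, Real.volume_real_Ioc, smul_eq_mul, mul_comm]
  congr 1
  rcases le_total a a' with h2 | h2 <;> rcases le_total b b' with h3 | h3 <;>
    rcases le_total b a' with h4 | h4 <;> rcases le_total a b' with h5 | h5 <;>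
    simp only [max_eq_left, max_eq_right, min_eq_left, min_eq_right, h2, h3, abs_of_nonneg,
      abs_of_nonpos, h4, h5, sub_nonneg, sub_nonpos] <;>
    first
      | linarith
      | (rw [max_eq_left (by linarith)]; linarith)

lemma memLp_indicator_Ioc (a b c : ℝ) :
    MemLp ((Set.Ioc a b).indicator fun _ => c) 2 (volume : Measure ℝ) :=
  memLp_indicator_const 2 measurableSet_Ioc c (Or.inr (by simp))

lemma memLp_toFun (g : StepFn) : MemLp g.toFun 2 (volume : Measure ℝ) := by
  have : g.toFun = ∑ i, (Set.Ioc (g.a i) (g.b i)).indicator fun _ => g.w i := by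
    ext u; simp [toFun]
  rw [this]
  exact memLp_finsetSum' _ fun i _ => memLp_indicator_Ioc _ _ _

lemma memLp_integral (hℓ : IsL2Noise ℓ P σ) (g : StepFn) : MemLp (g.integral ℓ) 2 P := by
  have : g.integral ℓ = ∑ i, fun ω => g.w i * (ℓ (g.b i) ω - ℓ (g.a i) ω) := by
    ext ω; simp [integral]
  rw [this]
  exact memLp_finsetSum' _ fun i _ => (hℓ.memLp _ _).const_mul _

end StepFn

/-- The covariance of two increments, by polarization. -/
lemma IsL2Noise.integral_mul {Ω : Type*} [MeasurableSpace Ω] {P : Measure Ω} {ℓ : ℝ → Ω → ℝ}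
    {σ : ℝ} (hℓ : IsL2Noise ℓ P σ) (a b a' b' : ℝ) :
    ∫ ω, (ℓ b ω - ℓ a ω) * (ℓ b' ω - ℓ a' ω) ∂P =
      σ * ((|b - a'| + |a - b'| - |b - b'| - |a - a'|) / 2) := by
  have h : ∀ ω, (ℓ b ω - ℓ a ω) * (ℓ b' ω - ℓ a' ω) =
      ((ℓ b ω - ℓ a' ω) ^ 2 + (ℓ a ω - ℓ b' ω) ^ 2 - (ℓ b ω - ℓ b' ω) ^ 2 -
        (ℓ a ω - ℓ a' ω) ^ 2) / 2 := fun ω => by ring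
  have hint : ∀ s t, Integrable (fun ω => (ℓ t ω - ℓ s ω) ^ 2) P := fun s t =>
    (hℓ.memLp s t).integrable_sq
  simp only [h]
  rw [integral_div, integral_sub, integral_sub, integral_add, hℓ.sq, hℓ.sq, hℓ.sq, hℓ.sq]
  · ring
  · exact hint _ _
  · exact hint _ _
  · exact (hint _ _).add (hint _ _)
  · exact hint _ _
  · exact ((hint _ _).add (hint _ _)).sub (hint _ _)
  · exact hint _ _

namespace StepFn

variable {Ω : Type*} [MeasurableSpace Ω] {P : Measure Ω} {ℓ : ℝ → Ω → ℝ} {σ : ℝ}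

lemma integral_sq (hℓ : IsL2Noise ℓ P σ) (g : StepFn) :
    ∫ ω, g.integral ℓ ω ^ 2 ∂P = σ * ∫ u, g.toFun u ^ 2 := by
  simp only [pow_two, integral, toFun, Finset.sum_mul_sum]
  rw [integral_finsetSum, integral_finsetSum, Finset.mul_sum]
  · refine Finset.sum_congr rfl fun i _ => ?_
    rw [integral_finsetSum, integral_finsetSum, Finset.mul_sum]
    · refine Finset.sum_congr rfl fun j _ => ?_
      rw [integral_indicator_Ioc_mul _ _ (g.le i) (g.le j)]
      have : ∀ ω, g.w i * (ℓ (g.b i) ω - ℓ (g.a i) ω) * (g.w j * (ℓ (g.b j) ω - ℓ (g.a j) ω)) =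
        g.w i * g.w j * ((ℓ (g.b i) ω - ℓ (g.a i) ω) * (ℓ (g.b j) ω - ℓ (g.a j) ω)) :=
        fun ω => by ring
      simp only [this]
      rw [integral_const_mul, hℓ.integral_mul]
      ring
    · exact fun j _ => (memLp_indicator_Ioc _ _ _).integrable_mul (memLp_indicator_Ioc _ _ _)
    · exact fun j _ => ((hℓ.memLp _ _).const_mul _).integrable_mul ((hℓ.memLp _ _).const_mul _)
  · exact fun i _ => integrable_finsetSum _ fun j _ =>
      (memLp_indicator_Ioc _ _ _).integrable_mul (memLp_indicator_Ioc _ _ _)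
  · exact fun i _ => integrable_finsetSum _ fun j _ =>
      ((hℓ.memLp _ _).const_mul _).integrable_mul ((hℓ.memLp _ _).const_mul _)

/-- The Itô isometry for step functions. -/
lemma eLpNorm_integral (hℓ : IsL2Noise ℓ P σ) (g : StepFn) :
    eLpNorm (g.integral ℓ) 2 P = ENNReal.ofReal √σ * eLpNorm g.toFun 2 volume := by
  have hσ : 0 ≤ σ := by
    have := hℓ.sq 0 1
    norm_num at this
    rw [← this]
    exact integral_nonneg fun ω => sq_nonneg _
  rw [eLpNorm_two_eq (g.memLp_integral hℓ), eLpNorm_two_eq g.memLp_toFun, g.integral_sq hℓ,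
    Real.sqrt_mul hσ, ENNReal.ofReal_mul (Real.sqrt_nonneg _)]

lemma eLpNorm_integral_sub (hℓ : IsL2Noise ℓ P σ) (g h : StepFn) :
    eLpNorm (fun ω => g.integral ℓ ω - h.integral ℓ ω) 2 P =
      ENNReal.ofReal √σ * eLpNorm (fun u => g.toFun u - h.toFun u) 2 volume := by
  have := eLpNorm_integral hℓ (comb (-1) h g)
  convert this using 2
  · ext ω; rw [comb_integral]; ring
  · congr 1; ext u; rw [comb_toFun]; ring

lemma eLpNorm_toFun_sub_le {f : ℝ → ℝ} (hf : AEStronglyMeasurable f volume) (g h : StepFn) :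
    eLpNorm (fun u => g.toFun u - h.toFun u) 2 volume ≤
      eLpNorm (fun u => f u - g.toFun u) 2 volume +
        eLpNorm (fun u => f u - h.toFun u) 2 volume := by
  have e : (fun u => g.toFun u - h.toFun u) =
      (fun u => f u - h.toFun u) - fun u => f u - g.toFun u := by ext u; simp
  rw [e, add_comm]
  exact eLpNorm_sub_le (hf.sub h.memLp_toFun.1) (hf.sub g.memLp_toFun.1) one_le_two

/-- The step function `∑ᵢ F(vᵢ) 1_{(vᵢ, vᵢ₊₁]}`. -/
def ofGrid (F : ℝ → ℝ) (v : ℕ → ℝ) (hv : Monotone v) (n : ℕ) : StepFn where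
  size := n
  a i := v i
  b i := v (i + 1)
  w i := F (v i)
  le i := hv (Nat.le_succ i)

end StepFn

/-! ### Equidistant grids -/

/-- The points `a + i (b - a) / (k + 1)`. -/
def grid (a b : ℝ) (k i : ℕ) : ℝ := a + i * ((b - a) / (k + 1))

lemma grid_zero (a b : ℝ) (k : ℕ) : grid a b k 0 = a := by simp [grid]

lemma grid_last (a b : ℝ) (k : ℕ) : grid a b k (k + 1) = b := by
  have : (k : ℝ) + 1 ≠ 0 := by positivity
  simp only [grid]; push_cast; field_simp; ring

lemma grid_succ_sub (a b : ℝ) (k i : ℕ) : grid a b k (i + 1) - grid a b k i = (b - a) / (k + 1) := by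
  simp only [grid]; push_cast; ring

lemma monotone_grid {a b : ℝ} (hab : a ≤ b) (k : ℕ) : Monotone (grid a b k) := by
  refine monotone_nat_of_le_succ fun i => ?_
  rw [← sub_nonneg, grid_succ_sub]
  exact div_nonneg (sub_nonneg.2 hab) (by positivity)

lemma exists_mem_Ioc_of_monotone {v : ℕ → ℝ} {n : ℕ} {u : ℝ} (h : u ∈ Set.Ioc (v 0) (v n)) :
    ∃ i < n, u ∈ Set.Ioc (v i) (v (i + 1)) := by
  induction n with
  | zero => exact absurd (h.1.trans_le h.2) (lt_irrefl _)
  | succ n ih =>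
    by_cases hu : u ≤ v n
    · obtain ⟨i, hi, h'⟩ := ih ⟨h.1, hu⟩
      exact ⟨i, hi.trans (Nat.lt_succ_self n), h'⟩
    · exact ⟨n, Nat.lt_succ_self n, not_le.1 hu, h.2⟩

lemma sum_indicator_Ioc_eq {v : ℕ → ℝ} (hv : Monotone v) {n i : ℕ} (hi : i < n) {u : ℝ}
    (h : u ∈ Set.Ioc (v i) (v (i + 1))) (w : ℕ → ℝ) :
    ∑ j ∈ Finset.range n, (Set.Ioc (v j) (v (j + 1))).indicator (fun _ => w j) u = w i := by
  rw [Finset.sum_eq_single i, Set.indicator_of_mem h]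
  · intro j _ hj
    exact Set.indicator_of_notMem
      (fun hu => (Set.disjoint_left.1 (hv.pairwise_disjoint_on_Ioc_succ hj) hu h)) _
  · intro hn
    exact absurd (Finset.mem_range.2 hi) hn

lemma StepFn.ofGrid_toFun (F : ℝ → ℝ) {v : ℕ → ℝ} (hv : Monotone v) (n : ℕ) (u : ℝ) :
    (StepFn.ofGrid F v hv n).toFun u =
      ∑ j ∈ Finset.range n, (Set.Ioc (v j) (v (j + 1))).indicator (fun _ => F (v j)) u := by
  rw [Finset.sum_range]; rfl

/-- The values of a continuous function at the left end points of the grid intervals approximate it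
in `L²`. -/
lemma tendsto_eLpNorm_ofGrid {F : ℝ → ℝ} (hF : Continuous F) {a b : ℝ} (hab : a ≤ b) :
    Tendsto (fun k => eLpNorm (fun u => (Set.Ioc a b).indicator F u -
      (StepFn.ofGrid F (grid a b k) (monotone_grid hab k) (k + 1)).toFun u) 2 volume)
      atTop (𝓝 0) := by
  have hzero : Tendsto (fun ε : ℝ => ENNReal.ofReal (ε * √(b - a))) (𝓝 0) (𝓝 0) := by
    have : Continuous fun ε : ℝ => ENNReal.ofReal (ε * √(b - a)) :=
      ENNReal.continuous_ofReal.comp (by fun_prop)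
    simpa using this.tendsto 0
  rw [ENNReal.tendsto_nhds_zero]
  intro η hη
  obtain ⟨ε, hε, hεη⟩ : ∃ ε > 0, ENNReal.ofReal (ε * √(b - a)) ≤ η := by
    have h1 := (hzero.eventually (Iic_mem_nhds hη)).filter_mono (nhdsWithin_le_nhds (s := Set.Ioi 0))
    obtain ⟨ε, h2, h3⟩ := (h1.and self_mem_nhdsWithin).exists
    exact ⟨ε, h3, h2⟩
  have huc : UniformContinuousOn F (Set.Icc a b) :=
    isCompact_Icc.uniformContinuousOn_of_continuous hF.continuousOn
  obtain ⟨δ, hδ, hFδ⟩ := Metric.uniformContinuousOn_iff.1 huc ε hε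
  have hmesh : Tendsto (fun k : ℕ => (b - a) * (1 / ((k : ℝ) + 1))) atTop (𝓝 0) := by
    simpa using tendsto_one_div_add_atTop_nhds_zero_nat.const_mul (b - a)
  filter_upwards [hmesh.eventually (Iio_mem_nhds hδ)] with k hk
  refine le_trans ?_ hεη
  have hbound : ∀ u, ‖(Set.Ioc a b).indicator F u -
      (StepFn.ofGrid F (grid a b k) (monotone_grid hab k) (k + 1)).toFun u‖ ≤
      ‖(Set.Ioc a b).indicator (fun _ => ε) u‖ := by
    intro u
    rw [StepFn.ofGrid_toFun]
    by_cases hu : u ∈ Set.Ioc a b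
    · have hu' : u ∈ Set.Ioc (grid a b k 0) (grid a b k (k + 1)) := by
        rwa [grid_zero, grid_last]
      obtain ⟨i, hi, hui⟩ := exists_mem_Ioc_of_monotone hu'
      rw [sum_indicator_Ioc_eq (monotone_grid hab k) hi hui fun j => F (grid a b k j),
        Set.indicator_of_mem hu, Set.indicator_of_mem hu, Real.norm_of_nonneg hε.le]
      have hsub := grid_succ_sub a b k i
      have ha : a ≤ grid a b k i :=
        (grid_zero a b k).ge.trans (monotone_grid hab k (Nat.zero_le i))
      refine (hFδ u ⟨hu.1.le, hu.2⟩ _ ⟨ha, hui.1.le.trans hu.2⟩ ?_).le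
      rw [Real.dist_eq, abs_of_nonneg (sub_nonneg.2 hui.1.le)]
      have h2 : (b - a) / (k + 1) < δ := by rw [← mul_one_div]; exact hk
      linarith [hui.2]
    · rw [Set.indicator_of_notMem hu, Set.indicator_of_notMem hu, Finset.sum_eq_zero]
      · simp
      · intro j hj
        refine Set.indicator_of_notMem (fun h => hu ⟨?_, ?_⟩) _
        · refine lt_of_le_of_lt ?_ h.1
          conv_lhs => rw [← grid_zero a b k]
          exact monotone_grid hab k (Nat.zero_le j)
        · refine h.2.trans ?_
          conv_rhs => rw [← grid_last a b k]
          exact monotone_grid hab k (Finset.mem_range.1 hj)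
  refine (eLpNorm_mono hbound).trans ?_
  rw [eLpNorm_indicator_const measurableSet_Ioc (by norm_num) (by norm_num), Real.volume_Ioc,
    ENNReal.ofReal_mul hε.le, Real.sqrt_eq_rpow,
    ← ENNReal.ofReal_rpow_of_nonneg (sub_nonneg.2 hab) (by norm_num)]
  simp [Real.enorm_eq_ofReal hε.le]

/-- Step functions are dense in `L²(ℝ)`. -/
lemma exists_stepFn_tendsto {f : ℝ → ℝ} (hf : MemLp f 2 volume) :
    ∃ g : ℕ → StepFn,
      Tendsto (fun k => eLpNorm (fun u => f u - (g k).toFun u) 2 volume) atTop (𝓝 0) := by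
  have key : ∀ n : ℕ, ∃ g : StepFn,
      eLpNorm (fun u => f u - g.toFun u) 2 volume ≤ ((n : ℝ≥0∞) + 1)⁻¹ := by
    intro n
    have hε : ((n : ℝ≥0∞) + 1)⁻¹ / 2 ≠ 0 := by
      refine (ENNReal.div_pos ?_ (by norm_num)).ne'
      exact ENNReal.inv_ne_zero.2 (by simp)
    obtain ⟨F, hFc, hF, hFcont, hFm⟩ := hf.exists_hasCompactSupport_eLpNorm_sub_le
      (by norm_num) hε
    obtain ⟨R, hR⟩ := hFc.isCompact.isBounded.subset_closedBall 0
    have hR' : tsupport F ⊆ Set.Ioc (-(|R| + 1)) (|R| + 1) := fun x hx => by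
      have := hR hx
      rw [Metric.mem_closedBall, dist_zero_right, Real.norm_eq_abs] at this
      have h2 := abs_le.1 (this.trans (le_abs_self R))
      constructor <;> linarith [h2.1, h2.2]
    have hFi : (Set.Ioc (-(|R| + 1)) (|R| + 1)).indicator F = F :=
      Set.indicator_eq_self.2 ((subset_tsupport F).trans hR')
    have hab : -(|R| + 1) ≤ |R| + 1 := by linarith [abs_nonneg R]
    have ht := tendsto_eLpNorm_ofGrid hFcont hab
    rw [hFi] at ht
    obtain ⟨k, hk⟩ := (ht.eventually (Iic_mem_nhds (pos_iff_ne_zero.2 hε))).exists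
    refine ⟨StepFn.ofGrid F (grid _ _ k) (monotone_grid hab k) (k + 1),
      le_trans ?_ (le_trans (add_le_add hF hk) (ENNReal.add_halves _).le)⟩
    have e : ∀ g : StepFn, (fun u => f u - g.toFun u) = (f - F) + fun u => F u - g.toFun u := by
      intro g; ext u; simp
    rw [e]
    exact eLpNorm_add_le (hf.1.sub hFm.1) (hFm.1.sub (StepFn.memLp_toFun _).1) one_le_two
  choose g hg using key
  refine ⟨g, tendsto_of_tendsto_of_tendsto_of_le_of_le tendsto_const_nhds ?_
    (fun _ => zero_le) hg⟩
  have := ENNReal.tendsto_inv_nat_nhds_zero.comp (tendsto_add_atTop_nat 1)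
  refine this.congr fun n => ?_
  simp

section Integral

variable {Ω : Type*} [MeasurableSpace Ω] {P : Measure Ω} {ℓ : ℝ → Ω → ℝ} {σ : ℝ}

/-- By the isometry, one approximating sequence decides about the integral. -/
lemma HasStochIntegral.of_seq (hℓ : IsL2Noise ℓ P σ) {f : ℝ → ℝ} {J : Ω → ℝ}
    (hf : MemLp f 2 volume) (hJ : MemLp J 2 P) (g : ℕ → StepFn)
    (hg : Tendsto (fun k => eLpNorm (fun u => f u - (g k).toFun u) 2 volume) atTop (𝓝 0))
    (hgJ : Tendsto (fun k => eLpNorm (fun ω => J ω - (g k).integral ℓ ω) 2 P) atTop (𝓝 0)) :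
    HasStochIntegral P ℓ f J := by
  refine ⟨hf, hJ, fun h hh => ?_⟩
  have hlim : Tendsto (fun k => eLpNorm (fun ω => J ω - (g k).integral ℓ ω) 2 P +
      ENNReal.ofReal √σ * (eLpNorm (fun u => f u - (g k).toFun u) 2 volume +
        eLpNorm (fun u => f u - (h k).toFun u) 2 volume)) atTop (𝓝 0) := by
    have := hgJ.add (ENNReal.Tendsto.const_mul (hg.add hh) (Or.inr (ENNReal.ofReal_ne_top (r := √σ))))
    simpa using this
  refine tendsto_of_tendsto_of_tendsto_of_le_of_le tendsto_const_nhds hlim (fun _ => zero_le)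
    fun k => ?_
  have e : (fun ω => J ω - (h k).integral ℓ ω) = (fun ω => J ω - (g k).integral ℓ ω) +
      fun ω => (g k).integral ℓ ω - (h k).integral ℓ ω := by ext ω; simp
  rw [e]
  refine (eLpNorm_add_le (hJ.1.sub (StepFn.memLp_integral hℓ _).1)
    ((StepFn.memLp_integral hℓ _).1.sub (StepFn.memLp_integral hℓ _).1) one_le_two).trans ?_
  refine add_le_add le_rfl ?_
  refine (StepFn.eLpNorm_integral_sub hℓ (g k) (h k)).trans_le ?_
  gcongr
  exact StepFn.eLpNorm_toFun_sub_le hf.1 _ _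

/-- By the isometry, the integrals of approximating step functions form a Cauchy sequence in `L²`. -/
lemma exists_hasStochIntegral (hℓ : IsL2Noise ℓ P σ) {f : ℝ → ℝ} (hf : MemLp f 2 volume) :
    ∃ J, HasStochIntegral P ℓ f J := by
  obtain ⟨g, hg⟩ := exists_stepFn_tendsto hf
  let I : ℕ → Lp ℝ 2 P := fun k => (StepFn.memLp_integral hℓ (g k)).toLp _
  have hcau : CauchySeq I := by
    rw [EMetric.cauchySeq_iff]
    intro ε hε
    have hlim : Tendsto (fun k => ENNReal.ofReal √σ *
        eLpNorm (fun u => f u - (g k).toFun u) 2 volume) atTop (𝓝 0) := by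
      simpa using ENNReal.Tendsto.const_mul hg (Or.inr (ENNReal.ofReal_ne_top (r := √σ)))
    obtain ⟨N, hN⟩ := eventually_atTop.1
      (hlim.eventually (Iio_mem_nhds (ENNReal.half_pos hε.ne')))
    refine ⟨N, fun k hk l hl => ?_⟩
    rw [Lp.edist_toLp_toLp]
    refine (StepFn.eLpNorm_integral_sub hℓ (g k) (g l)).trans_lt ?_
    calc _ ≤ ENNReal.ofReal √σ * (eLpNorm (fun u => f u - (g k).toFun u) 2 volume +
          eLpNorm (fun u => f u - (g l).toFun u) 2 volume) := by
            gcongr; exact StepFn.eLpNorm_toFun_sub_le hf.1 _ _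
      _ < ε / 2 + ε / 2 := by
            rw [mul_add]
            exact ENNReal.add_lt_add (hN k hk) (hN l hl)
      _ = ε := ENNReal.add_halves ε
  obtain ⟨J, hJ⟩ := cauchySeq_tendsto_of_complete hcau
  refine ⟨J, HasStochIntegral.of_seq hℓ hf (Lp.memLp J) g hg ?_⟩
  rw [Lp.tendsto_Lp_iff_tendsto_eLpNorm'] at hJ
  refine hJ.congr fun k => ?_
  rw [eLpNorm_sub_comm]
  refine eLpNorm_congr_ae ?_
  filter_upwards [(StepFn.memLp_integral hℓ (g k)).coeFn_toLp] with ω hω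
  simp only [Pi.sub_apply, I, hω]

/-- Linearity of the stochastic integral. -/
lemma HasStochIntegral.comb (hℓ : IsL2Noise ℓ P σ) {f f' : ℝ → ℝ} {J J' : Ω → ℝ} (c : ℝ)
    (h : HasStochIntegral P ℓ f J) (h' : HasStochIntegral P ℓ f' J') :
    HasStochIntegral P ℓ (fun u => c * f u + f' u) (fun ω => c * J ω + J' ω) := by
  obtain ⟨g, hg⟩ := exists_stepFn_tendsto h.1
  obtain ⟨g', hg'⟩ := exists_stepFn_tendsto h'.1
  have hzero : ∀ {x y : ℕ → ℝ≥0∞}, Tendsto x atTop (𝓝 0) → Tendsto y atTop (𝓝 0) →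
      Tendsto (fun k => ‖c‖ₑ * x k + y k) atTop (𝓝 0) := by
    intro x y hx hy
    simpa using (ENNReal.Tendsto.const_mul hx (Or.inr (enorm_ne_top (x := c)))).add hy
  refine HasStochIntegral.of_seq hℓ ((h.1.const_mul c).add h'.1) ((h.2.1.const_mul c).add h'.2.1)
    (fun k => StepFn.comb c (g k) (g' k)) ?_ ?_
  · refine tendsto_of_tendsto_of_tendsto_of_le_of_le tendsto_const_nhds (hzero hg hg')
      (fun _ => zero_le) fun k => ?_
    have e : (fun u => c * f u + f' u - (StepFn.comb c (g k) (g' k)).toFun u) =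
        (c • fun u => f u - (g k).toFun u) + fun u => f' u - (g' k).toFun u := by
      ext u; simp [StepFn.comb_toFun]; ring
    rw [e, ← eLpNorm_const_smul]
    exact eLpNorm_add_le ((h.1.1.sub (StepFn.memLp_toFun _).1).const_smul c)
      (h'.1.1.sub (StepFn.memLp_toFun _).1) one_le_two
  · refine tendsto_of_tendsto_of_tendsto_of_le_of_le tendsto_const_nhds
      (hzero (h.2.2 g hg) (h'.2.2 g' hg')) (fun _ => zero_le) fun k => ?_
    have e : (fun ω => c * J ω + J' ω - (StepFn.comb c (g k) (g' k)).integral ℓ ω) =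
        (c • fun ω => J ω - (g k).integral ℓ ω) + fun ω => J' ω - (g' k).integral ℓ ω := by
      ext ω; simp [StepFn.comb_integral]; ring
    rw [e, ← eLpNorm_const_smul]
    exact eLpNorm_add_le ((h.2.1.1.sub (StepFn.memLp_integral hℓ _).1).const_smul c)
      (h'.2.1.1.sub (StepFn.memLp_integral hℓ _).1) one_le_two

lemma HasStochIntegral.sum_add (hℓ : IsL2Noise ℓ P σ) {ι : Type*} (s : Finset ι) (c : ι → ℝ)
    {f : ι → ℝ → ℝ} {J : ι → Ω → ℝ} (h : ∀ i, HasStochIntegral P ℓ (f i) (J i)) {f' : ℝ → ℝ}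
    {J' : Ω → ℝ} (h' : HasStochIntegral P ℓ f' J') :
    HasStochIntegral P ℓ (fun u => ∑ i ∈ s, c i * f i u + f' u)
      (fun ω => ∑ i ∈ s, c i * J i ω + J' ω) := by
  classical
  induction s using Finset.induction_on with
  | empty => simpa using h'
  | insert i s hi ih =>
    have := HasStochIntegral.comb hℓ (c i) (h i) ih
    simpa only [Finset.sum_insert hi, add_assoc] using this

end Integral

/-! ### Decay and derivatives of matrix exponentials -/

section Exponential

open scoped Matrix.Norms.Operator

variable {ι : Type} [Fintype ι] [DecidableEq ι]

lemma exists_norm_exp_nsmul_lt_one {A : Matrix ι ι ℝ}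
    (h : ∀ μ ∈ spectrum ℂ ((NormedSpace.exp A).map (algebraMap ℝ ℂ)), ‖μ‖ < 1) :
    ∃ k : ℕ, 0 < k ∧ ‖NormedSpace.exp (k • A)‖ < 1 := by
  set a := (NormedSpace.exp A).map (algebraMap ℝ ℂ) with ha
  have hr : spectralRadius ℂ a < 1 := by
    rcases isEmpty_or_nonempty ι with hι | hι
    · rw [spectrum.SpectralRadius.of_subsingleton]; exact zero_lt_one
    · rw [← ENNReal.coe_one]
      exact spectrum.spectralRadius_lt_of_forall_lt a fun z hz => h z hz
  have hG := spectrum.pow_nnnorm_pow_one_div_tendsto_nhds_spectralRadius a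
  obtain ⟨k, hk, hk0⟩ := ((hG.eventually (Iio_mem_nhds hr)).and (eventually_gt_atTop 0)).exists
  refine ⟨k, hk0, ?_⟩
  have h1 : ‖a ^ k‖ < 1 := by
    by_contra! hge
    have h2 : (1 : ℝ≥0∞) ≤ ‖a ^ k‖₊ := by exact_mod_cast hge
    exact absurd hk (not_lt.2 (ENNReal.one_le_rpow h2 (by positivity)))
  have h2 : a ^ k = (NormedSpace.exp (k • A)).map (algebraMap ℝ ℂ) := by
    rw [Matrix.exp_nsmul, ha, Matrix.map_pow]
  rw [h2] at h1
  convert h1 using 1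
  simp [Matrix.linfty_opNorm_def]

/-- If the eigenvalues of `exp A` lie in the open unit disc, then `exp (s A)` decays exponentially,
by Gelfand's formula and the semigroup property. -/
lemma exists_norm_exp_smul_le {A : Matrix ι ι ℝ}
    (h : ∀ μ ∈ spectrum ℂ ((NormedSpace.exp A).map (algebraMap ℝ ℂ)), ‖μ‖ < 1) :
    ∃ C r : ℝ, 0 < r ∧ ∀ s : ℝ, 0 ≤ s → ‖NormedSpace.exp (s • A)‖ ≤ C * Real.exp (-(r * s)) := by
  obtain ⟨k, hk0, hk⟩ := exists_norm_exp_nsmul_lt_one h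
  have hcont : Continuous fun s : ℝ => NormedSpace.exp (s • A) :=
    NormedSpace.exp_continuous.comp (continuous_id.smul continuous_const)
  obtain ⟨M, hM⟩ := (isCompact_Icc (a := (0 : ℝ)) (b := k)).exists_bound_of_continuousOn
    hcont.continuousOn
  have hM0 : 0 ≤ M := (norm_nonneg _).trans (hM 0 ⟨le_rfl, by positivity⟩)
  -- `θ` is kept away from `0` so that its logarithm is meaningful
  set θ := max ‖NormedSpace.exp (k • A)‖ (1 / 2) with hθ
  have hθ0 : 0 < θ := lt_of_lt_of_le (by norm_num) (le_max_right _ _)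
  have hθ1 : θ < 1 := max_lt hk (by norm_num)
  have hlog : Real.log θ < 0 := Real.log_neg hθ0 hθ1
  have hk' : (0 : ℝ) < k := by exact_mod_cast hk0
  refine ⟨M * θ⁻¹, -Real.log θ / k, by have := neg_pos.2 hlog; positivity, fun s hs => ?_⟩
  set n := ⌊s / k⌋₊ with hn
  have h1 : n * (k : ℝ) ≤ s := by
    have := Nat.floor_le (div_nonneg hs hk'.le)
    rwa [← hn, le_div_iff₀ hk'] at this
  have h2 : s < (n + 1) * k := by
    have := Nat.lt_floor_add_one (s / k)
    rwa [← hn, div_lt_iff₀ hk'] at this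
  have hsplit : NormedSpace.exp (s • A) =
      NormedSpace.exp (k • A) ^ n * NormedSpace.exp ((s - n * k) • A) := by
    rw [← Matrix.exp_nsmul, ← Matrix.exp_add_of_commute]
    · congr 1
      rw [← Nat.cast_smul_eq_nsmul ℝ n, ← Nat.cast_smul_eq_nsmul ℝ k, smul_smul, ← add_smul]
      congr 1; ring
    · exact (((Commute.refl A).smul_left k).smul_left n).smul_right _
  have hpow : ‖NormedSpace.exp (k • A) ^ n‖ ≤ θ ^ n := by
    rcases Nat.eq_zero_or_pos n with h0 | h0
    · rw [h0, pow_zero, pow_zero]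
      rcases isEmpty_or_nonempty ι with hι | hι
      · rw [Subsingleton.elim (1 : Matrix ι ι ℝ) 0, norm_zero]; exact zero_le_one
      · exact norm_one.le
    · exact (norm_pow_le' _ h0).trans (pow_le_pow_left₀ (norm_nonneg _) (le_max_left _ _) n)
  have hθn : θ ^ n ≤ θ⁻¹ * Real.exp (-(-Real.log θ / k * s)) := by
    rw [← Real.exp_log hθ0, ← Real.exp_neg, ← Real.exp_add, ← Real.exp_nat_mul, Real.exp_log hθ0]
    refine Real.exp_le_exp.2 ?_
    have h3 : s / k < n + 1 := by rwa [div_lt_iff₀ hk']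
    have h4 : -(-Real.log θ / k * s) = Real.log θ * (s / k) := by field_simp
    rw [h4]
    nlinarith
  rw [hsplit]
  calc _ ≤ ‖NormedSpace.exp (k • A) ^ n‖ * ‖NormedSpace.exp ((s - n * k) • A)‖ := norm_mul_le _ _
    _ ≤ (θ⁻¹ * Real.exp (-(-Real.log θ / k * s))) * M :=
        mul_le_mul (hpow.trans hθn) (hM _ ⟨by linarith, by linarith⟩) (norm_nonneg _)
          (by positivity)
    _ = _ := by ring

lemma abs_apply_le_norm {ι κ : Type} [Fintype ι] [Fintype κ] (M : Matrix ι κ ℝ) (i : ι) (j : κ) :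
    |M i j| ≤ ‖M‖ := by
  rw [Matrix.linfty_opNorm_def]
  have h1 : ‖M i j‖₊ ≤ ∑ j, ‖M i j‖₊ :=
    Finset.single_le_sum (f := fun j => ‖M i j‖₊) (fun _ _ => zero_le) (Finset.mem_univ j)
  have h2 : ∑ j, ‖M i j‖₊ ≤ Finset.univ.sup fun i => ∑ j, ‖M i j‖₊ :=
    Finset.le_sup (f := fun i => ∑ j, ‖M i j‖₊) (Finset.mem_univ i)
  have := h1.trans h2
  rw [← NNReal.coe_le_coe, coe_nnnorm, Real.norm_eq_abs] at this
  exact this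

/-- `d/du exp ((t - u) A) B = -exp ((t - u) A) A B`, entry by entry. -/
lemma hasDerivAt_exp_sub_smul_mul {κ : Type} [Fintype κ] (A : Matrix ι ι ℝ) (B : Matrix ι κ ℝ)
    (t u : ℝ) (i : ι) (j : κ) :
    HasDerivAt (fun u => (NormedSpace.exp ((t - u) • A) * B) i j)
      (-(NormedSpace.exp ((t - u) • A) * A * B) i j) u := by
  have h2 := (hasDerivAt_exp_smul_const (𝕂 := ℝ) A (t - u)).scomp u
    ((hasDerivAt_id u).const_sub t)
  let l : Matrix ι ι ℝ →ₗ[ℝ] ℝ :=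
    { toFun := fun M => (M * B) i j
      map_add' := fun M N => by simp [Matrix.add_mul]
      map_smul' := fun c M => by simp }
  have h3 := (LinearMap.toContinuousLinearMap l).hasFDerivAt.comp_hasDerivAt u h2
  refine h3.congr_deriv ?_
  change (((-1 : ℝ) • (NormedSpace.exp ((t - u) • A) * A)) * B) i j = _
  simp

lemma continuous_exp_sub_smul_mul {κ : Type} [Fintype κ] (A : Matrix ι ι ℝ) (B : Matrix ι κ ℝ)
    (t : ℝ) (i : ι) (j : κ) : Continuous fun u : ℝ => (NormedSpace.exp ((t - u) • A) * B) i j :=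
  continuous_iff_continuousAt.2 fun u => (hasDerivAt_exp_sub_smul_mul A B t u i j).continuousAt

/-- The kernel `u ↦ 1_{u ≤ t} exp ((t - u) A) B` is square-integrable. -/
lemma memLp_kernel {κ : Type} [Fintype κ] {A : Matrix ι ι ℝ}
    (h : ∀ μ ∈ spectrum ℂ ((NormedSpace.exp A).map (algebraMap ℝ ℂ)), ‖μ‖ < 1)
    (B : Matrix ι κ ℝ) (t : ℝ) (i : ι) (j : κ) :
    MemLp ((Set.Iic t).indicator fun u => (NormedSpace.exp ((t - u) • A) * B) i j) 2 volume := by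
  obtain ⟨C, r, hr, hC⟩ := exists_norm_exp_smul_le h
  have hm : AEStronglyMeasurable
      ((Set.Iic t).indicator fun u => (NormedSpace.exp ((t - u) • A) * B) i j) volume :=
    ((continuous_exp_sub_smul_mul A B t i j).measurable.indicator
      measurableSet_Iic).aestronglyMeasurable
  rw [memLp_two_iff_integrable_sq hm]
  have hdom : Integrable ((Set.Iic t).indicator fun u =>
      (C * ‖B‖ * Real.exp (-(r * t))) ^ 2 * Real.exp (2 * r * u)) volume :=
    (integrable_indicator_iff measurableSet_Iic).2
      ((integrableOn_exp_mul_Iic (by positivity : 0 < 2 * r) t).const_mul _)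
  refine hdom.mono' (hm.pow 2) (Eventually.of_forall fun u => ?_)
  by_cases hu : u ∈ Set.Iic t
  · rw [Set.indicator_of_mem hu, Set.indicator_of_mem hu, Real.norm_eq_abs, abs_pow]
    have h1 : |(NormedSpace.exp ((t - u) • A) * B) i j| ≤
        C * ‖B‖ * Real.exp (-(r * t)) * Real.exp (r * u) := by
      calc _ ≤ ‖NormedSpace.exp ((t - u) • A) * B‖ := abs_apply_le_norm _ _ _
        _ ≤ ‖NormedSpace.exp ((t - u) • A)‖ * ‖B‖ := Matrix.linfty_opNorm_mul _ _
        _ ≤ C * Real.exp (-(r * (t - u))) * ‖B‖ := by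
            gcongr; exact hC _ (sub_nonneg.2 hu)
        _ = _ := by
            rw [show -(r * (t - u)) = -(r * t) + r * u by ring, Real.exp_add]; ring
    calc _ ≤ (C * ‖B‖ * Real.exp (-(r * t)) * Real.exp (r * u)) ^ 2 :=
          pow_le_pow_left₀ (abs_nonneg _) h1 2
      _ = _ := by
          rw [mul_pow, ← Real.exp_nat_mul (r * u)]
          push_cast
          rw [mul_assoc 2 r u]
  · rw [Set.indicator_of_notMem hu, Set.indicator_of_notMem hu]; simp

end Exponential

/-! ### Càdlàg paths -/

section Cadlag

lemma IsCadlag.comp_continuous {E F : Type*} [TopologicalSpace E] [TopologicalSpace F]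
    {x : ℝ → E} (hx : IsCadlag x) {φ : E → F} (hφ : Continuous φ) : IsCadlag fun t => φ (x t) :=
  fun t => ⟨hφ.continuousAt.comp_continuousWithinAt (hx t).1,
    let ⟨l, hl⟩ := (hx t).2; ⟨φ l, (hφ.tendsto l).comp hl⟩⟩

lemma IsCadlag.exists_bound {E : Type*} [NormedAddCommGroup E] {x : ℝ → E} (hx : IsCadlag x)
    (a b : ℝ) : ∃ C, ∀ s ∈ Set.Icc a b, ‖x s‖ ≤ C := by
  refine isCompact_Icc.induction_on (p := fun s => ∃ C, ∀ u ∈ s, ‖x u‖ ≤ C) ⟨0, by simp⟩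
    (fun s t hst ⟨C, hC⟩ => ⟨C, fun u hu => hC u (hst hu)⟩)
    (fun s t ⟨C, hC⟩ ⟨D, hD⟩ => ⟨max C D, fun u hu => hu.elim
      (fun h => (hC u h).trans (le_max_left _ _)) fun h => (hD u h).trans (le_max_right _ _)⟩)
    fun t _ => ?_
  obtain ⟨h1, l, h2⟩ := hx t
  have e1 : ∀ᶠ u in 𝓝[≥] t, ‖x u‖ < ‖x t‖ + 1 :=
    h1.norm.eventually (Iio_mem_nhds (lt_add_one _))
  have e2 : ∀ᶠ u in 𝓝[<] t, ‖x u‖ < ‖l‖ + 1 := h2.norm.eventually (Iio_mem_nhds (lt_add_one _))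
  have e3 : ∀ᶠ u in 𝓝 t, ‖x u‖ ≤ max (‖x t‖ + 1) (‖l‖ + 1) := by
    rw [← nhdsLT_sup_nhdsGE, eventually_sup]
    exact ⟨e2.mono fun u hu => hu.le.trans (le_max_right _ _),
      e1.mono fun u hu => hu.le.trans (le_max_left _ _)⟩
  exact ⟨_, mem_nhdsWithin_of_mem_nhds e3, _, fun u hu => hu⟩

/-- The path that is frozen at the right end points of the grid intervals. -/
def gridPath (x : ℝ → ℝ) (v : ℕ → ℝ) (n : ℕ) (s : ℝ) : ℝ :=
  ∑ j ∈ Finset.range n, (Set.Ioc (v j) (v (j + 1))).indicator (fun _ => x (v (j + 1))) s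

lemma measurable_gridPath (x : ℝ → ℝ) (v : ℕ → ℝ) (n : ℕ) : Measurable (gridPath x v n) :=
  Finset.measurable_sum _ fun _ _ => measurable_const.indicator measurableSet_Ioc

lemma exists_gridPath_eq (x : ℝ → ℝ) {a b : ℝ} (hab : a ≤ b) (k : ℕ) {s : ℝ}
    (hs : s ∈ Set.Ioc a b) : ∃ r ∈ Set.Icc s b, r ≤ s + (b - a) / (k + 1) ∧
      gridPath x (grid a b k) (k + 1) s = x r := by
  have hs' : s ∈ Set.Ioc (grid a b k 0) (grid a b k (k + 1)) := by rwa [grid_zero, grid_last]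
  obtain ⟨i, hi, hsi⟩ := exists_mem_Ioc_of_monotone hs'
  refine ⟨grid a b k (i + 1), ⟨hsi.2, ?_⟩, ?_,
    sum_indicator_Ioc_eq (monotone_grid hab k) hi hsi fun j => x (grid a b k (j + 1))⟩
  · exact (monotone_grid hab k hi).trans (grid_last a b k).le
  · linarith [grid_succ_sub a b k i, hsi.1]

lemma IsCadlag.tendsto_gridPath {x : ℝ → ℝ} (hx : IsCadlag x) {a b : ℝ} (hab : a ≤ b) {s : ℝ}
    (hs : s ∈ Set.Ioc a b) :
    Tendsto (fun k => gridPath x (grid a b k) (k + 1) s) atTop (𝓝 (x s)) := by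
  choose r hr hr' hrx using fun k => exists_gridPath_eq x hab k hs
  have hmesh : Tendsto (fun k : ℕ => s + (b - a) / ((k : ℝ) + 1)) atTop (𝓝 s) := by
    have := (tendsto_one_div_add_atTop_nhds_zero_nat.const_mul (b - a)).const_add s
    simpa [mul_one_div, div_eq_mul_inv] using this
  have h1 : Tendsto r atTop (𝓝[≥] s) := tendsto_nhdsWithin_iff.2
    ⟨tendsto_of_tendsto_of_tendsto_of_le_of_le tendsto_const_nhds hmesh (fun k => (hr k).1) hr',
      Eventually.of_forall fun k => (hr k).1⟩
  exact ((hx s).1.tendsto.comp h1).congr fun k => (hrx k).symm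

lemma IsCadlag.aestronglyMeasurable_real {x : ℝ → ℝ} (hx : IsCadlag x) {a b : ℝ} (hab : a ≤ b) :
    AEStronglyMeasurable x (volume.restrict (Set.Ioc a b)) :=
  aestronglyMeasurable_of_tendsto_ae atTop
    (fun k => (measurable_gridPath x (grid a b k) (k + 1)).aestronglyMeasurable)
    ((ae_restrict_iff' measurableSet_Ioc).2 (Eventually.of_forall fun _ hs =>
      hx.tendsto_gridPath hab hs))

lemma IsCadlag.intervalIntegrable_real {x : ℝ → ℝ} (hx : IsCadlag x) (a b : ℝ) :
    IntervalIntegrable x volume a b := by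
  wlog hab : a ≤ b generalizing a b
  · exact (this b a (le_of_not_ge hab)).symm
  obtain ⟨C, hC⟩ := hx.exists_bound a b
  rw [intervalIntegrable_iff_integrableOn_Ioc_of_le hab]
  exact Integrable.of_bound (hx.aestronglyMeasurable_real hab) C
    ((ae_restrict_iff' measurableSet_Ioc).2 (Eventually.of_forall fun s hs =>
      hC s (Set.Ioc_subset_Icc_self hs)))

lemma IsCadlag.intervalIntegrable {ι : Type*} [Fintype ι] {x : ℝ → ι → ℝ} (hx : IsCadlag x)
    (a b : ℝ) : IntervalIntegrable x volume a b := by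
  have h : ∀ i, IntervalIntegrable (fun t => x t i) volume a b := fun i =>
    (hx.comp_continuous (continuous_apply i)).intervalIntegrable_real a b
  exact ⟨Integrable.of_eval fun i => (h i).1, Integrable.of_eval fun i => (h i).2⟩

/-- The integral of `F'` against the frozen path is a sum over the grid intervals. -/
lemma integral_mul_gridPath {F F' : ℝ → ℝ} (hF : ∀ u, HasDerivAt F (F' u) u)
    (hF' : Continuous F') (x : ℝ → ℝ) {v : ℕ → ℝ} (hv : Monotone v) (n : ℕ) :
    ∫ s in v 0..v n, F' s * gridPath x v n s =
      ∑ i ∈ Finset.range n, (F (v (i + 1)) - F (v i)) * x (v (i + 1)) := by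
  have hcongr : ∀ i < n, ∀ s ∈ Set.uIoc (v i) (v (i + 1)),
      F' s * gridPath x v n s = F' s * x (v (i + 1)) := by
    intro i hi s hs
    rw [Set.uIoc_of_le (hv (Nat.le_succ i))] at hs
    rw [gridPath, sum_indicator_Ioc_eq hv hi hs fun j => x (v (j + 1))]
  rw [← intervalIntegral.sum_integral_adjacent_intervals]
  · refine Finset.sum_congr rfl fun i hi => ?_
    rw [intervalIntegral.integral_congr_ae (Eventually.of_forall
      (hcongr i (Finset.mem_range.1 hi))), intervalIntegral.integral_mul_const,
      intervalIntegral.integral_eq_sub_of_hasDerivAt (fun u _ => hF u)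
        (hF'.intervalIntegrable _ _)]
  · intro i hi
    refine ((hF'.mul (continuous_const (y := x (v (i + 1))))).intervalIntegrable _ _).congr ?_
    exact fun s hs => (hcongr i hi s hs).symm

/-- Integration by parts: the Riemann–Stieltjes sums of a continuously differentiable function with
respect to a càdlàg path converge. -/
lemma IsCadlag.tendsto_sum_mul_sub {F F' : ℝ → ℝ} (hF : ∀ u, HasDerivAt F (F' u) u)
    (hF' : Continuous F') {x : ℝ → ℝ} (hx : IsCadlag x) {a b : ℝ} (hab : a ≤ b) :
    Tendsto (fun k => ∑ i ∈ Finset.range (k + 1),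
      F (grid a b k i) * (x (grid a b k (i + 1)) - x (grid a b k i))) atTop
      (𝓝 (F b * x b - F a * x a - ∫ s in a..b, F' s * x s)) := by
  have habel : ∀ k, F b * x b - F a * x a -
      ∫ s in a..b, F' s * gridPath x (grid a b k) (k + 1) s = ∑ i ∈ Finset.range (k + 1),
      F (grid a b k i) * (x (grid a b k (i + 1)) - x (grid a b k i)) := by
    intro k
    have h1 := integral_mul_gridPath hF hF' x (monotone_grid hab k) (k + 1)
    have h2 := Finset.sum_range_sub (fun i => F (grid a b k i) * x (grid a b k i)) (k + 1)
    simp only [grid_zero, grid_last] at h1 h2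
    rw [h1, ← h2, ← Finset.sum_sub_distrib]
    exact Finset.sum_congr rfl fun i _ => by ring
  refine Tendsto.congr habel (tendsto_const_nhds.sub ?_)
  obtain ⟨C, hC⟩ := hx.exists_bound a b
  refine intervalIntegral.tendsto_integral_filter_of_dominated_convergence
    (fun s => ‖F' s‖ * C) (Eventually.of_forall fun k => ?_) (Eventually.of_forall fun k => ?_)
    ((hF'.norm.mul continuous_const).intervalIntegrable _ _) ?_
  · exact (hF'.measurable.mul (measurable_gridPath _ _ _)).aestronglyMeasurable
  · refine Eventually.of_forall fun s hs => ?_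
    rw [Set.uIoc_of_le hab] at hs
    obtain ⟨r, hr, -, h⟩ := exists_gridPath_eq x hab k hs
    rw [h, norm_mul]
    gcongr
    exact hC r ⟨hs.1.le.trans hr.1, hr.2⟩
  · refine Eventually.of_forall fun s hs => ?_
    rw [Set.uIoc_of_le hab] at hs
    exact (hx.tendsto_gridPath hab hs).const_mul _

/-- Integration by parts for the stochastic integral of a continuously differentiable function over
a bounded interval. -/
lemma HasStochIntegral.ae_eq_integration_by_parts {Ω : Type*} [MeasurableSpace Ω] {P : Measure Ω}
    [IsFiniteMeasure P] {ℓ : ℝ → Ω → ℝ} {σ : ℝ} (hℓ : IsL2Noise ℓ P σ)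
    (hc : ∀ᵐ ω ∂P, IsCadlag fun t => ℓ t ω) {F F' : ℝ → ℝ} (hF : ∀ u, HasDerivAt F (F' u) u)
    (hF' : Continuous F') {a b : ℝ} (hab : a ≤ b) {J : Ω → ℝ}
    (hJ : HasStochIntegral P ℓ ((Set.Ioc a b).indicator F) J) :
    ∀ᵐ ω ∂P, J ω = F b * ℓ b ω - F a * ℓ a ω - ∫ s in a..b, F' s * ℓ s ω := by
  have hFc : Continuous F := continuous_iff_continuousAt.2 fun u => (hF u).continuousAt
  set g : ℕ → StepFn := fun k => StepFn.ofGrid F (grid a b k) (monotone_grid hab k) (k + 1)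
  have hmeas : ∀ k, AEStronglyMeasurable ((g k).integral ℓ) P := fun k =>
    (StepFn.memLp_integral hℓ (g k)).1
  have h1 : TendstoInMeasure P (fun k => (g k).integral ℓ) atTop J := by
    refine tendstoInMeasure_of_tendsto_eLpNorm (p := 2) (by norm_num) hmeas hJ.2.1.1 ?_
    refine (hJ.2.2 g (tendsto_eLpNorm_ofGrid hFc hab)).congr fun k => ?_
    rw [eLpNorm_sub_comm]
    rfl
  have h2 : TendstoInMeasure P (fun k => (g k).integral ℓ) atTop
      fun ω => F b * ℓ b ω - F a * ℓ a ω - ∫ s in a..b, F' s * ℓ s ω := by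
    refine tendstoInMeasure_of_tendsto_ae hmeas ?_
    filter_upwards [hc] with ω hω
    refine (hω.tendsto_sum_mul_sub hF hF' hab).congr fun k => ?_
    rw [Finset.sum_range]
    rfl
  exact tendstoInMeasure_ae_unique h1 h2

end Cadlag

/-! ### The state equation along a path -/

section PathEquation

variable {ι : Type} [Fintype ι]

lemma hasDerivWithinAt_mulVec {κ : Type*} [Fintype κ] {M : ℝ → Matrix κ ι ℝ} {M' : Matrix κ ι ℝ}
    {v : ℝ → ι → ℝ} {v' : ι → ℝ} {s : Set ℝ} {t : ℝ}
    (hM : ∀ i j, HasDerivAt (fun t => M t i j) (M' i j) t) (hv : HasDerivWithinAt v v' s t) :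
    HasDerivWithinAt (fun t => M t *ᵥ v t) (M' *ᵥ v t + M t *ᵥ v') s t := by
  rw [hasDerivWithinAt_pi] at hv ⊢
  intro i
  have := HasDerivWithinAt.fun_sum (u := Finset.univ)
    fun j _ => ((hM i j).hasDerivWithinAt (s := s)).mul (hv j)
  refine this.congr_deriv ?_
  simp [Matrix.mulVec, dotProduct, Finset.sum_add_distrib]

lemma continuousOn_mulVec {κ : Type*} {M : ℝ → Matrix κ ι ℝ} {v : ℝ → ι → ℝ}
    {s : Set ℝ} (hM : ∀ i j, Continuous fun t => M t i j) (hv : ContinuousOn v s) :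
    ContinuousOn (fun t => M t *ᵥ v t) s := by
  have hc : Continuous fun p : Matrix κ ι ℝ × (ι → ℝ) => p.1 *ᵥ p.2 :=
    continuous_fst.matrix_mulVec continuous_snd
  exact hc.comp_continuousOn ((continuous_matrix hM).continuousOn.prodMk hv)

lemma intervalIntegrable_mulVec_cadlag {κ : Type*} [Fintype κ] {M : ℝ → Matrix κ ι ℝ}
    (hM : ∀ i j, Continuous fun t => M t i j) {x : ℝ → ι → ℝ} (hx : IsCadlag x) (a b : ℝ) :
    IntervalIntegrable (fun s => M s *ᵥ x s) volume a b := by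
  have h : ∀ i, IntervalIntegrable (fun s => (M s *ᵥ x s) i) volume a b := by
    intro i
    simp only [Matrix.mulVec, dotProduct]
    have e : (fun s => ∑ j, M s i j * x s j) = ∑ j, fun s => M s i j * x s j := by
      ext s; simp
    rw [e]
    exact IntervalIntegrable.sum _ fun j _ =>
      ((hx.comp_continuous (continuous_apply j)).intervalIntegrable_real a b).continuousOn_mul
        (hM i j).continuousOn
  exact ⟨Integrable.of_eval fun i => (h i).1, Integrable.of_eval fun i => (h i).2⟩

/-- The primitive of a right-continuous integrable function has a right derivative. -/
lemma hasDerivWithinAt_primitive {f : ℝ → ι → ℝ} {a b t : ℝ} (hf : IntervalIntegrable f volume a b)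
    (ht : t ∈ Set.Ico a b) (hc : ContinuousWithinAt f (Set.Ici t) t) :
    HasDerivWithinAt (fun u => ∫ s in a..u, f s) (f t) (Set.Ioi t) t := by
  have hab : a ≤ b := ht.1.trans ht.2.le
  have hmeas : StronglyMeasurableAtFilter f (𝓝[>] t) volume := by
    refine ⟨Set.Ioc t b, Ioc_mem_nhdsGT ht.2, ?_⟩
    exact hf.1.aestronglyMeasurable.mono_set (Set.Ioc_subset_Ioc_left ht.1)
  refine (intervalIntegral.integral_hasDerivWithinAt_right (s := Set.Ici t) (t := Set.Ioi t)
    (hf.mono_set ?_) hmeas (hc.mono Set.Ioi_subset_Ici_self)).mono Set.Ioi_subset_Ici_self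
  rw [Set.uIcc_of_le ht.1, Set.uIcc_of_le hab]
  exact Set.Icc_subset_Icc_right ht.2.le

variable [DecidableEq ι]

lemma continuous_exp_sub_smul_mul_apply (A : Matrix ι ι ℝ) (t : ℝ) (i j : ι) :
    Continuous fun u : ℝ => (NormedSpace.exp ((t - u) • A) * A) i j :=
  continuous_exp_sub_smul_mul A A t i j

lemma hasDerivAt_exp_sub_smul (A : Matrix ι ι ℝ) (t u : ℝ) (i j : ι) :
    HasDerivAt (fun u : ℝ => NormedSpace.exp ((t - u) • A) i j)
      ((-(NormedSpace.exp ((t - u) • A) * A)) i j) u := by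
  simpa using hasDerivAt_exp_sub_smul_mul A 1 t u i j

lemma exp_smul_mul_exp_smul (A : Matrix ι ι ℝ) (s t : ℝ) :
    NormedSpace.exp (s • A) * NormedSpace.exp (t • A) = NormedSpace.exp ((s + t) • A) := by
  rw [add_smul, Matrix.exp_add_of_commute _ _ (((Commute.refl A).smul_left s).smul_right t)]

/-- **Variation of constants**: a solution of `X(t) = X(t₀) + ∫ A X + x(t) - x(t₀)` with a càdlàg
input `x` is given by an explicit formula, in which the integral against `dx` has been integrated by
parts. The function `s ↦ exp ((t - s) A) (X(s) - x(s))` has the right derivative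
`exp ((t - s) A) A x(s)`. -/
lemma eq_variation_of_constants {A : Matrix ι ι ℝ} {x X : ℝ → ι → ℝ} (hx : IsCadlag x) {t₀ : ℝ}
    (hX : ∀ t, t₀ ≤ t → IntervalIntegrable X volume t₀ t ∧
      X t = X t₀ + (∫ s in t₀..t, A *ᵥ X s) + (x t - x t₀)) {t : ℝ} (ht : t₀ ≤ t) :
    X t = NormedSpace.exp ((t - t₀) • A) *ᵥ (X t₀ - x t₀) + x t +
      ∫ s in t₀..t, (NormedSpace.exp ((t - s) • A) * A) *ᵥ x s := by
  set D : ℝ → ι → ℝ := fun s => X t₀ - x t₀ + ∫ u in t₀..s, A *ᵥ X u with hD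
  have hXD : ∀ s, t₀ ≤ s → X s = D s + x s := by
    intro s hs
    rw [(hX s hs).2, hD]
    simp only
    abel
  have hint : IntervalIntegrable (fun s => A *ᵥ X s) volume t₀ t :=
    (StateSpaceModel.intervalIntegral_mulVec A (hX t ht).1).1
  have hDcont : ContinuousOn D (Set.uIcc t₀ t) :=
    continuousOn_const.add (intervalIntegral.continuousOn_primitive_interval' hint Set.left_mem_uIcc)
  have hDderiv : ∀ s ∈ Set.Ioo t₀ t, HasDerivWithinAt D (A *ᵥ X s) (Set.Ioi s) s := by
    intro s hs
    refine (hasDerivWithinAt_primitive hint ⟨hs.1.le, hs.2⟩ ?_).const_add _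
    have h1 : ContinuousWithinAt (fun u => D u + x u) (Set.Ici s) s := by
      refine ContinuousWithinAt.add ?_ (hx s).1
      have h2 : ContinuousAt D s := hDcont.continuousAt (by
        rw [Set.uIcc_of_le ht]; exact Icc_mem_nhds hs.1 hs.2)
      exact h2.continuousWithinAt
    have h2 : ContinuousWithinAt X (Set.Ici s) s :=
      h1.congr (fun u hu => hXD u (hs.1.le.trans hu)) (hXD s hs.1.le)
    exact (continuous_const.matrix_mulVec continuous_id).continuousAt.comp_continuousWithinAt h2
  have hM : ∀ i j, Continuous fun s : ℝ => NormedSpace.exp ((t - s) • A) i j := fun i j =>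
    continuous_iff_continuousAt.2 fun s => (hasDerivAt_exp_sub_smul A t s i j).continuousAt
  have key := intervalIntegral.integral_eq_sub_of_hasDeriv_right
    (f := fun s => NormedSpace.exp ((t - s) • A) *ᵥ D s)
    (f' := fun s => (NormedSpace.exp ((t - s) • A) * A) *ᵥ x s) (a := t₀) (b := t)
    (continuousOn_mulVec hM hDcont) ?_
    (intervalIntegrable_mulVec_cadlag (continuous_exp_sub_smul_mul_apply A t) hx t₀ t)
  · rw [key, hXD t ht, sub_self, zero_smul, NormedSpace.exp_zero, Matrix.one_mulVec]
    have h0 : D t₀ = X t₀ - x t₀ := by simp [hD]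
    rw [h0]
    abel
  · intro s hs
    rw [min_eq_left ht, max_eq_right ht] at hs
    refine (hasDerivWithinAt_mulVec (hasDerivAt_exp_sub_smul A t s) (hDderiv s hs)).congr_deriv ?_
    have e : NormedSpace.exp ((t - s) • A) *ᵥ (A *ᵥ X s) =
        (NormedSpace.exp ((t - s) • A) * A) *ᵥ D s +
          (NormedSpace.exp ((t - s) • A) * A) *ᵥ x s := by
      rw [Matrix.mulVec_mulVec, hXD s hs.1.le, Matrix.mulVec_add]
    rw [e, Matrix.neg_mulVec, neg_add_cancel_left]

/-- The formula of `eq_variation_of_constants` defines a solution. -/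
lemma variation_of_constants_solves (A : Matrix ι ι ℝ) {x : ℝ → ι → ℝ} (hx : IsCadlag x) (t₀ : ℝ)
    (x₀ : ι → ℝ) {X : ℝ → ι → ℝ}
    (hX : ∀ t, X t = NormedSpace.exp ((t - t₀) • A) *ᵥ (x₀ - x t₀) + x t +
      ∫ s in t₀..t, (NormedSpace.exp ((t - s) • A) * A) *ᵥ x s) {t : ℝ} (ht : t₀ ≤ t) :
    X t₀ = x₀ ∧ IntervalIntegrable X volume t₀ t ∧
      X t = X t₀ + (∫ s in t₀..t, A *ᵥ X s) + (x t - x t₀) := by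
  set G : ℝ → ι → ℝ := fun s => (NormedSpace.exp ((t₀ - s) • A) * A) *ᵥ x s with hG
  set I : ℝ → ι → ℝ := fun s => (x₀ - x t₀) + ∫ u in t₀..s, G u with hI
  set D : ℝ → ι → ℝ := fun s => NormedSpace.exp ((s - t₀) • A) *ᵥ I s with hD
  have hGint : ∀ a b, IntervalIntegrable G volume a b :=
    intervalIntegrable_mulVec_cadlag (continuous_exp_sub_smul_mul_apply A t₀) hx
  have hXD : ∀ s, X s = D s + x s := by
    intro s
    rw [hX s, hD]
    simp only [hI]
    rw [Matrix.mulVec_add, ← (StateSpaceModel.intervalIntegral_mulVec _ (hGint t₀ s)).2]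
    simp only [hG, Matrix.mulVec_mulVec, ← Matrix.mul_assoc, exp_smul_mul_exp_smul,
      sub_add_sub_cancel]
    abel
  have hX0 : X t₀ = x₀ := by rw [hX]; simp
  have hMd : ∀ s i j, HasDerivAt (fun s : ℝ => NormedSpace.exp ((s - t₀) • A) i j)
      ((A * NormedSpace.exp ((s - t₀) • A)) i j) s := by
    intro s i j
    have h1 := (hasDerivAt_exp_sub_smul (-A) t₀ s i j)
    simp only [smul_neg, ← neg_smul, neg_sub, Matrix.mul_neg, neg_neg] at h1
    have e : A * NormedSpace.exp ((s - t₀) • A) = NormedSpace.exp ((s - t₀) • A) * A := by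
      open scoped Matrix.Norms.Operator in
      exact (((Commute.refl A).smul_right (s - t₀)).exp_right).eq
    rw [e]
    exact h1
  have hM : ∀ i j, Continuous fun s : ℝ => NormedSpace.exp ((s - t₀) • A) i j := fun i j =>
    continuous_iff_continuousAt.2 fun s => (hMd s i j).continuousAt
  have hIcont : ContinuousOn I (Set.uIcc t₀ t) := continuousOn_const.add
    (intervalIntegral.continuousOn_primitive_interval' (hGint t₀ t) Set.left_mem_uIcc)
  have hDcont : ContinuousOn D (Set.uIcc t₀ t) := continuousOn_mulVec hM hIcont
  have hXint : IntervalIntegrable X volume t₀ t := by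
    rw [show X = D + x from funext hXD]
    exact hDcont.intervalIntegrable.add (hx.intervalIntegrable t₀ t)
  have hAX := StateSpaceModel.intervalIntegral_mulVec A hXint
  refine ⟨hX0, hXint, ?_⟩
  have key := intervalIntegral.integral_eq_sub_of_hasDeriv_right (f := D)
    (f' := fun s => A *ᵥ X s) (a := t₀) (b := t) hDcont ?_ hAX.1
  · rw [key, hXD t, hXD t₀]
    abel
  · intro s hs
    rw [min_eq_left ht, max_eq_right ht] at hs
    have hGc : ContinuousWithinAt G (Set.Ici s) s := by
      have hc : Continuous fun u : ℝ => NormedSpace.exp ((t₀ - u) • A) * A :=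
        continuous_matrix (continuous_exp_sub_smul_mul_apply A t₀)
      have hc2 : Continuous fun p : Matrix ι ι ℝ × (ι → ℝ) => p.1 *ᵥ p.2 :=
        continuous_fst.matrix_mulVec continuous_snd
      exact hc2.continuousAt.comp_continuousWithinAt
        (hc.continuousAt.continuousWithinAt.prodMk (hx s).1)
    have hId : HasDerivWithinAt I (G s) (Set.Ioi s) s :=
      (hasDerivWithinAt_primitive (hGint t₀ t) ⟨hs.1.le, hs.2⟩ hGc).const_add _
    refine (hasDerivWithinAt_mulVec (hMd s) hId).congr_deriv ?_
    have e : NormedSpace.exp ((s - t₀) • A) *ᵥ G s = A *ᵥ x s := by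
      rw [hG]
      simp only [Matrix.mulVec_mulVec, ← Matrix.mul_assoc, exp_smul_mul_exp_smul,
        sub_add_sub_cancel, sub_self, zero_smul, NormedSpace.exp_zero, Matrix.one_mul]
    have e' : (A * NormedSpace.exp ((s - t₀) • A)) *ᵥ I s = A *ᵥ D s := by
      rw [← Matrix.mulVec_mulVec]
    rw [e, e', hXD s, Matrix.mulVec_add]

end PathEquation

/-! ### Lévy processes: components, linear images, joint laws of increments -/

section Levy

variable {k : ℕ} {Ω : Type*} [MeasurableSpace Ω] {L : ℝ → Ω → Fin k → ℝ} {P : Measure Ω}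

/-- Each component of a driving Lévy process is an `L²` noise. -/
lemma IsDrivingLevy.exists_isL2Noise [IsProbabilityMeasure P] (hL : IsDrivingLevy L P)
    (j : Fin k) : ∃ σ, IsL2Noise (fun t ω => L t ω j) P σ := by
  have hL1 : MemLp (fun ω => L 1 ω j) 2 P := hL.memLp.eval j
  have h0 : (fun ω => L 1 ω j) =ᵐ[P] fun ω => L 1 ω j - L 0 ω j := by
    filter_upwards [hL.isLevy.zero] with ω hω
    simp [hω]
  refine _root_.exists_isL2Noise (fun t => (measurable_pi_apply j).comp (hL.isLevy.measurable t))
    (hL.isLevy.indepIncrements.map (ContinuousLinearMap.proj (R := ℝ) (φ := fun _ : Fin k => ℝ) j))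
    (fun s t h => (hL.isLevy.stationaryIncrements s t h).comp (measurable_pi_apply j)) ?_
    (hL1.ae_eq h0) ?_
  · filter_upwards [hL.isLevy.cadlag] with ω hω
    exact (hω.comp_continuous (continuous_apply j) 0).1
  · rw [← integral_congr_ae h0]
    have := congrFun hL.mean_zero j
    rwa [eval_integral fun i => (hL.memLp.eval i).integrable one_le_two] at this

lemma IsLevy.mulVec {l : ℕ} (hL : IsLevy L P) (M : Matrix (Fin l) (Fin k) ℝ) :
    IsLevy (fun t ω => M *ᵥ L t ω) P := by
  have hM : Continuous fun x : Fin k → ℝ => M *ᵥ x := continuous_const.matrix_mulVec continuous_id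
  refine ⟨fun t => hM.measurable.comp (hL.measurable t), ?_,
    hL.indepIncrements.map (LinearMap.toContinuousLinearMap M.mulVecLin), fun s t h => ?_, ?_⟩
  · filter_upwards [hL.zero] with ω hω
    rw [hω, Matrix.mulVec_zero]
  · have := (hL.stationaryIncrements s t h).comp hM.measurable
    simpa only [Function.comp_def, Matrix.mulVec_sub] using this
  · filter_upwards [hL.cadlag] with ω hω
    exact hω.comp_continuous hM

lemma exists_monotone_cover {s : Set ℝ} (hs : s.Finite) :
    ∃ t : ℕ → ℝ, Monotone t ∧ ∀ x ∈ s, ∃ n, t n = x := by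
  classical
  set S := insert 0 hs.toFinset with hS
  have hcard : S.card = S.card - 1 + 1 :=
    (Nat.sub_add_cancel (Finset.card_pos.2 ⟨0, Finset.mem_insert_self _ _⟩)).symm
  set e := S.orderEmbOfFin hcard
  refine ⟨fun n => e ⟨min n (S.card - 1), by omega⟩, fun a b hab => e.monotone ?_, fun x hx => ?_⟩
  · exact Fin.mk_le_mk.2 (min_le_min_right _ hab)
  · have : x ∈ Set.range e := by
      rw [Finset.range_orderEmbOfFin]
      simp [hS, hx]
    obtain ⟨p, rfl⟩ := this
    exact ⟨p, congrArg e (Fin.ext (min_eq_left (by omega)))⟩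

/-- The joint law of finitely many increments is invariant under time shifts: on a common refinement
the increments are independent with shift-invariant laws. -/
lemma IsLevy.identDistrib_increments (hL : IsLevy L P) {ι : Type*} [Finite ι] (a b : ι → ℝ)
    (h : ℝ) : IdentDistrib (fun ω q => L (b q + h) ω - L (a q + h) ω)
      (fun ω q => L (b q) ω - L (a q) ω) P P := by
  obtain ⟨t, ht, hcov⟩ := exists_monotone_cover
    ((Set.finite_range a).union (Set.finite_range b))
  choose pa hpa using fun q => hcov (a q) (Or.inl ⟨q, rfl⟩)
  choose pb hpb using fun q => hcov (b q) (Or.inr ⟨q, rfl⟩)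
  have hind := hL.indepIncrements.nat ht
  have hind' := hL.indepIncrements.nat (t := fun n => t n + h) fun m n hmn =>
    add_le_add_left (ht hmn) h
  have hid := IdentDistrib.pi (fun n => hL.stationaryIncrements (t n) (t (n + 1)) h) hind' hind
  let Ψ : (ℕ → Fin k → ℝ) → ι → Fin k → ℝ := fun y q =>
    ∑ n ∈ Finset.range (pb q), y n - ∑ n ∈ Finset.range (pa q), y n
  have hΨ : Measurable Ψ := by
    refine measurable_pi_lambda _ fun q => ?_
    exact (Finset.measurable_sum _ fun n _ => measurable_pi_apply n).sub
      (Finset.measurable_sum _ fun n _ => measurable_pi_apply n)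
  have h3 := hid.comp hΨ
  have e : ∀ (f : ℕ → Fin k → ℝ), Ψ (fun n => f (n + 1) - f n) =
      fun q => f (pb q) - f (pa q) := by
    intro f
    ext1 q
    simp only [Ψ]
    rw [Finset.sum_range_sub, Finset.sum_range_sub, sub_sub_sub_cancel_right]
  have e1 : (Ψ ∘ fun ω n => L (t (n + 1) + h) ω - L (t n + h) ω) =
      fun ω q => L (b q + h) ω - L (a q + h) ω := by
    ext1 ω
    rw [Function.comp_apply, e fun n => L (t n + h) ω]
    simp only [hpa, hpb]
  have e2 : (Ψ ∘ fun ω n => L (t (n + 1)) ω - L (t n) ω) =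
      fun ω q => L (b q) ω - L (a q) ω := by
    ext1 ω
    rw [Function.comp_apply, e fun n => L (t n) ω]
    simp only [hpa, hpb]
  rwa [e1, e2] at h3

end Levy

/-! ### Strict stationarity -/

section Stationary

lemma tendstoInMeasure_pi {α ι : Type*} [MeasurableSpace α] {μ : Measure α} [Fintype ι]
    {E : ι → Type*} [∀ i, PseudoEMetricSpace (E i)] {f : ℕ → α → ∀ i, E i} {g : α → ∀ i, E i}
    (h : ∀ i, TendstoInMeasure μ (fun n x => f n x i) atTop fun x => g x i) :
    TendstoInMeasure μ f atTop g := by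
  intro ε hε
  have hsum : Tendsto (fun n => ∑ i, μ {x | ε ≤ edist (f n x i) (g x i)}) atTop (𝓝 0) := by
    simpa using tendsto_finsetSum Finset.univ fun i _ => h i ε hε
  refine tendsto_of_tendsto_of_tendsto_of_le_of_le tendsto_const_nhds hsum (fun _ => zero_le)
    fun n => le_trans (measure_mono ?_) (measure_iUnion_fintype_le μ _)
  intro x (hx : ε ≤ edist (f n x) (g x))
  by_contra hne
  simp only [Set.mem_iUnion, Set.mem_ofPred_eq, not_exists, not_le] at hne
  refine absurd hx (not_le.2 ?_)
  rw [edist_pi_def, Finset.sup_lt_iff hε]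
  exact fun i _ => hne i

namespace StepFn

/-- The step function `g(· - h)`. -/
def translate (g : StepFn) (h : ℝ) : StepFn where
  size := g.size
  a i := g.a i + h
  b i := g.b i + h
  w := g.w
  le i := by simpa using g.le i

lemma translate_toFun (g : StepFn) (h u : ℝ) : (g.translate h).toFun u = g.toFun (u - h) := by
  change ∑ i : Fin g.size, (Set.Ioc (g.a i + h) (g.b i + h)).indicator (fun _ => g.w i) u = _
  refine Finset.sum_congr rfl fun i _ => ?_
  simp only [Set.indicator_apply, Set.mem_Ioc, lt_sub_iff_add_lt, sub_le_iff_le_add]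

end StepFn

variable {m n : ℕ} {Ω : Type*} [MeasurableSpace Ω] {L : ℝ → Ω → Fin m → ℝ} {P : Measure Ω}

/-- A matrix-valued stochastic integral is the limit in probability of the integrals of step
functions that approximate the integrand entry by entry in `L²`. -/
lemma HasLevyIntegral.tendstoInMeasure (hL : ∀ j, ∃ σ, IsL2Noise (fun t ω => L t ω j) P σ)
    {F : ℝ → Matrix (Fin n) (Fin m) ℝ} {I : Ω → Fin n → ℝ} (hI : HasLevyIntegral P L F I)
    {g : Fin n → Fin m → ℕ → StepFn}
    (hg : ∀ i j, Tendsto (fun K => eLpNorm (fun u => F u i j - (g i j K).toFun u) 2 volume) atTop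
      (𝓝 0)) (i : Fin n) :
    TendstoInMeasure P (fun K ω => ∑ j, (g i j K).integral (fun t ω => L t ω j) ω) atTop
      fun ω => I ω i := by
  obtain ⟨J, hJ, hIJ⟩ := hI
  choose σ hσ using hL
  have hmeas : ∀ j K, AEStronglyMeasurable ((g i j K).integral fun t ω => L t ω j) P := fun j K =>
    (StepFn.memLp_integral (hσ j) _).1
  refine TendstoInMeasure.congr_right (g := fun ω => ∑ j, J i j ω) ?_ ?_
  · filter_upwards [hIJ] with ω hω
    exact (hω i).symm
  refine tendstoInMeasure_of_tendsto_eLpNorm (p := 2) (by norm_num)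
    (fun K => Finset.aestronglyMeasurable_fun_sum _ fun j _ => hmeas j K)
    (Finset.aestronglyMeasurable_fun_sum _ fun j _ => (hJ i j).2.1.1) ?_
  have hsum : Tendsto (fun K => ∑ j, eLpNorm (fun ω => J i j ω -
      (g i j K).integral (fun t ω => L t ω j) ω) 2 P) atTop (𝓝 0) := by
    simpa using tendsto_finsetSum Finset.univ fun j _ => (hJ i j).2.2 _ (hg i j)
  refine tendsto_of_tendsto_of_tendsto_of_le_of_le tendsto_const_nhds hsum (fun _ => zero_le)
    fun K => ?_
  rw [eLpNorm_sub_comm]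
  have e : ((fun ω => ∑ j, J i j ω) - fun ω => ∑ j, (g i j K).integral (fun t ω => L t ω j) ω) =
      ∑ j, fun ω => J i j ω - (g i j K).integral (fun t ω => L t ω j) ω := by
    ext ω; simp [Finset.sum_sub_distrib]
  rw [e]
  exact eLpNorm_sum_le (fun j _ => (hJ i j).2.1.1.sub (hmeas j K)) one_le_two

/-- A moving average `Z(t) = ∫ F(t - u) dL(u)` is strictly stationary: it is approximated by
integrals of step functions, and shifting these in time does not change their joint laws. -/
lemma isStrictlyStationary_of_movingAverage [IsProbabilityMeasure P] (hL : IsLevy L P)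
    (hL2 : ∀ j, ∃ σ, IsL2Noise (fun t ω => L t ω j) P σ) {F : ℝ → Matrix (Fin n) (Fin m) ℝ}
    {Z : ℝ → Ω → Fin n → ℝ} (hF : ∀ i j, MemLp (fun u => F u i j) 2 volume)
    (hZ : ∀ t, HasLevyIntegral P L (fun u => F (u - t)) (Z t)) :
    IsStrictlyStationary P Z := by
  intro k t h
  choose g₀ hg₀ using fun i j => exists_stepFn_tendsto (hF i j)
  -- the integrand of `Z(r)` is approximated by the translates of one sequence of step functions
  have htrans : ∀ r i j, Tendsto (fun K => eLpNorm (fun u => F (u - r) i j -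
      ((g₀ i j K).translate r).toFun u) 2 volume) atTop (𝓝 0) := by
    intro r i j
    refine (hg₀ i j).congr fun K => ?_
    simp only [StepFn.translate_toFun]
    have hm : AEStronglyMeasurable (fun u => F u i j - (g₀ i j K).toFun u) volume :=
      (hF i j).1.sub (StepFn.memLp_toFun _).1
    exact (eLpNorm_comp_measurePreserving hm (measurePreserving_sub_right volume r)).symm
  let V : (Fin k → ℝ) → ℕ → Ω → Fin k → Fin n → ℝ := fun t K ω p i =>
    ∑ j, ((g₀ i j K).translate (t p)).integral (fun t ω => L t ω j) ω
  have hV : ∀ t : Fin k → ℝ, TendstoInMeasure P (V t) atTop fun ω p => Z (t p) ω := fun t =>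
    tendstoInMeasure_pi fun p => tendstoInMeasure_pi fun i =>
      (hZ (t p)).tendstoInMeasure hL2 (g := fun i j K => (g₀ i j K).translate (t p))
        (htrans (t p)) i
  have hVid : ∀ K, IdentDistrib (V (fun p => t p + h) K) (V t K) P P := by
    intro K
    have hid := hL.identDistrib_increments
      (ι := Σ q : Fin k × Fin n × Fin m, Fin (g₀ q.2.1 q.2.2 K).size)
      (fun q => (g₀ q.1.2.1 q.1.2.2 K).a q.2 + t q.1.1)
      (fun q => (g₀ q.1.2.1 q.1.2.2 K).b q.2 + t q.1.1) h
    let Ψ : ((Σ q : Fin k × Fin n × Fin m, Fin (g₀ q.2.1 q.2.2 K).size) → Fin m → ℝ) →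
        Fin k → Fin n → ℝ := fun y p i =>
      ∑ j, ∑ q : Fin (g₀ i j K).size, (g₀ i j K).w q * y ⟨(p, i, j), q⟩ j
    have hΨ : Measurable Ψ := by
      refine measurable_pi_lambda _ fun p => measurable_pi_lambda _ fun i => ?_
      refine Finset.measurable_sum _ fun j _ => Finset.measurable_sum _ fun q _ => ?_
      have h1 : Measurable fun y : (Σ q : Fin k × Fin n × Fin m, Fin (g₀ q.2.1 q.2.2 K).size) →
          Fin m → ℝ => y ⟨(p, i, j), q⟩ := measurable_pi_apply _
      exact ((measurable_pi_apply j).comp h1).const_mul _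
    have h3 := hid.comp hΨ
    convert h3 using 1
    · ext ω p i
      simp only [V, Ψ, StepFn.integral, StepFn.translate, Function.comp_apply, Pi.sub_apply,
        add_assoc]
      rfl
    · rfl
  have hmeasV : ∀ t K, AEMeasurable (V t K) P := by
    intro t K
    choose σ hσ using hL2
    refine aemeasurable_pi_lambda _ fun p => aemeasurable_pi_lambda _ fun i => ?_
    exact Finset.aemeasurable_fun_sum _ fun j _ =>
      (StepFn.memLp_integral (hσ j) _).1.aemeasurable
  have hd1 := (hV fun p => t p + h).tendstoInDistribution (hmeasV _)
  have hd2 := (hV t).tendstoInDistribution (hmeasV _)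
  have hd3 : TendstoInDistribution (V t) atTop (fun ω p => Z (t p + h) ω) (fun _ => P) P := by
    refine ⟨hmeasV t, hd1.aemeasurable_limit, ?_⟩
    exact hd1.tendsto.congr fun K => Subtype.ext (hVid K).map_eq
  exact ⟨hd1.aemeasurable_limit, hd2.aemeasurable_limit,
    tendstoInDistribution_unique (V t) hd3 hd2⟩

lemma IsStrictlyStationary.mulVec {l : ℕ} {Z : ℝ → Ω → Fin n → ℝ} (hZ : IsStrictlyStationary P Z)
    (C : Matrix (Fin l) (Fin n) ℝ) : IsStrictlyStationary P fun t ω => C *ᵥ Z t ω := by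
  intro k t h
  have hC : Measurable fun (z : Fin k → Fin n → ℝ) i => C *ᵥ z i :=
    measurable_pi_lambda _ fun i => ((continuous_const.matrix_mulVec
      continuous_id).measurable).comp (measurable_pi_apply i)
  exact (hZ k t h).comp hC

end Stationary

/-! ### The stationary solution -/

section StationarySolution

variable {m n : ℕ} {Ω : Type*} [MeasurableSpace Ω] {L : ℝ → Ω → Fin m → ℝ} {P : Measure Ω}

lemma indicator_matrix_apply {α ι κ : Type*} (s : Set α) (F : α → Matrix ι κ ℝ) (u : α) (i : ι)
    (j : κ) : s.indicator F u i j = s.indicator (fun u => F u i j) u := by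
  by_cases h : u ∈ s <;> simp [h]

lemma exists_hasLevyIntegralIic [IsProbabilityMeasure P]
    (hL2 : ∀ j, ∃ σ, IsL2Noise (fun t ω => L t ω j) P σ) {t : ℝ}
    {F : ℝ → Matrix (Fin n) (Fin m) ℝ}
    (hF : ∀ i j, MemLp ((Set.Iic t).indicator fun u => F u i j) 2 volume) :
    ∃ Z, HasLevyIntegralIic P L t F Z := by
  choose σ hσ using hL2
  choose J hJ using fun i j => exists_hasStochIntegral (hσ j) (hF i j)
  refine ⟨fun ω i => ∑ j, J i j ω, J, fun i j => ?_, .of_forall fun _ _ => rfl⟩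
  simpa only [indicator_matrix_apply] using hJ i j

/-- `Z(t) = ∫_{-∞}^t exp (A (t - u)) B dL(u)` is a moving average, hence strictly stationary. -/
lemma isStrictlyStationary_of_hasLevyIntegralIic_exp [IsProbabilityMeasure P] (hL : IsLevy L P)
    (hL2 : ∀ j, ∃ σ, IsL2Noise (fun t ω => L t ω j) P σ) {A : Matrix (Fin n) (Fin n) ℝ}
    (hA : ∀ μ ∈ spectrum ℂ ((NormedSpace.exp A).map (algebraMap ℝ ℂ)), ‖μ‖ < 1)
    (B : Matrix (Fin n) (Fin m) ℝ) {Z : ℝ → Ω → Fin n → ℝ}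
    (hZ : ∀ t, HasLevyIntegralIic P L t (fun u => NormedSpace.exp ((t - u) • A) * B) (Z t)) :
    IsStrictlyStationary P Z := by
  refine isStrictlyStationary_of_movingAverage hL hL2
    (F := (Set.Iic 0).indicator fun u => NormedSpace.exp ((0 - u) • A) * B) (fun i j => ?_)
    fun t => ?_
  · simpa only [indicator_matrix_apply] using memLp_kernel hA B 0 i j
  · have e : (fun u => (Set.Iic 0).indicator (fun u => NormedSpace.exp ((0 - u) • A) * B) (u - t)) =
        (Set.Iic t).indicator fun u => NormedSpace.exp ((t - u) • A) * B := by
      ext1 u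
      simp only [Set.indicator_apply, Set.mem_Iic, sub_nonpos, zero_sub, neg_sub]
    rw [e]
    exact hZ t

lemma intervalIntegrable_of_eval {ι : Type*} [Fintype ι] {f : ℝ → ι → ℝ} {a b : ℝ}
    (h : ∀ i, IntervalIntegrable (fun s => f s i) volume a b) : IntervalIntegrable f volume a b :=
  ⟨Integrable.of_eval fun i => (h i).1, Integrable.of_eval fun i => (h i).2⟩

lemma eval_intervalIntegrable {ι : Type*} [Fintype ι] {f : ℝ → ι → ℝ} {a b : ℝ}
    (h : IntervalIntegrable f volume a b) (i : ι) :
    IntervalIntegrable (fun s => f s i) volume a b :=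
  ⟨Integrable.eval h.1 i, Integrable.eval h.2 i⟩

lemma eval_intervalIntegral {ι : Type*} [Fintype ι] {f : ℝ → ι → ℝ} {a b : ℝ}
    (h : IntervalIntegrable f volume a b) (i : ι) :
    (∫ s in a..b, f s) i = ∫ s in a..b, f s i :=
  ((ContinuousLinearMap.proj (R := ℝ) (φ := fun _ : ι => ℝ) i).intervalIntegral_comp_comm h).symm

lemma eval_intervalIntegral_mulVec_cadlag {κ : Type*} [Fintype κ] {ι : Type} [Fintype ι]
    {M : ℝ → Matrix κ ι ℝ} (hM : ∀ i j, Continuous fun t => M t i j) {x : ℝ → ι → ℝ}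
    (hx : IsCadlag x) (a b : ℝ) (i : κ) :
    (∫ s in a..b, M s *ᵥ x s) i = ∑ j, ∫ s in a..b, M s i j * x s j := by
  rw [eval_intervalIntegral (intervalIntegrable_mulVec_cadlag hM hx a b)]
  simp only [Matrix.mulVec, dotProduct]
  exact intervalIntegral.integral_finsetSum fun j _ =>
    ((hx.comp_continuous (continuous_apply j)).intervalIntegrable_real a b).continuousOn_mul
      (hM i j).continuousOn

/-- The process `Z(t) = ∫_{-∞}^t exp (A (t - u)) B dL(u)` satisfies the formula of variation of
constants: `Z(t) - exp (A (t - t₀)) Z(t₀)` is the integral of `exp (A (t - u)) B` over `(t₀, t]`,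
and this integral may be computed by parts. -/
lemma HasLevyIntegralIic.ae_eq_variation_of_constants [IsProbabilityMeasure P]
    (hL2 : ∀ j, ∃ σ, IsL2Noise (fun t ω => L t ω j) P σ)
    (hc : ∀ᵐ ω ∂P, IsCadlag fun t => L t ω) {A : Matrix (Fin n) (Fin n) ℝ}
    {B : Matrix (Fin n) (Fin m) ℝ} {t₀ t : ℝ} (ht : t₀ ≤ t) {Z₀ Z : Ω → Fin n → ℝ}
    (h₀ : HasLevyIntegralIic P L t₀ (fun u => NormedSpace.exp ((t₀ - u) • A) * B) Z₀)
    (h : HasLevyIntegralIic P L t (fun u => NormedSpace.exp ((t - u) • A) * B) Z) :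
    ∀ᵐ ω ∂P, Z ω = NormedSpace.exp ((t - t₀) • A) *ᵥ (Z₀ ω - B *ᵥ L t₀ ω) + B *ᵥ L t ω +
      ∫ s in t₀..t, (NormedSpace.exp ((t - s) • A) * A) *ᵥ (B *ᵥ L s ω) := by
  choose σ hσ using hL2
  obtain ⟨J₀, hJ₀, e₀⟩ := h₀
  obtain ⟨J, hJ, e⟩ := h
  set E := NormedSpace.exp ((t - t₀) • A) with hE
  have hexp : ∀ u, NormedSpace.exp ((t - u) • A) * B =
      E * (NormedSpace.exp ((t₀ - u) • A) * B) := by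
    intro u
    rw [hE, ← Matrix.mul_assoc, exp_smul_mul_exp_smul, sub_add_sub_cancel]
  -- the part of the integrand on `(-∞, t₀]` cancels
  have hK : ∀ i j, HasStochIntegral P (fun t ω => L t ω j)
      ((Set.Ioc t₀ t).indicator fun u => (NormedSpace.exp ((t - u) • A) * B) i j)
      (fun ω => ∑ p, -E i p * J₀ p j ω + J i j ω) := by
    intro i j
    convert! HasStochIntegral.sum_add (hσ j) Finset.univ (fun p => -E i p) (fun p => hJ₀ p j)
      (hJ i j) using 1
    ext u
    simp only [indicator_matrix_apply]
    rcases le_or_gt u t₀ with hu | hu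
    · rw [Set.indicator_of_notMem fun h => h.1.not_ge hu, Set.indicator_of_mem (Set.mem_Iic.2 (hu.trans ht)),
        hexp u, Matrix.mul_apply]
      simp [Set.indicator_of_mem (Set.mem_Iic.2 hu)]
    · simp [Set.indicator_apply, hu, hu.not_ge]
  have key : ∀ᵐ ω ∂P, ∀ i j, ∑ p, -E i p * J₀ p j ω + J i j ω =
      (NormedSpace.exp ((t - t) • A) * B) i j * L t ω j -
        (NormedSpace.exp ((t - t₀) • A) * B) i j * L t₀ ω j -
        ∫ s in t₀..t, -(NormedSpace.exp ((t - s) • A) * A * B) i j * L s ω j := by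
    refine ae_all_iff.2 fun i => ae_all_iff.2 fun j => ?_
    refine (hK i j).ae_eq_integration_by_parts (hσ j) ?_
      (fun u => hasDerivAt_exp_sub_smul_mul A B t u i j) ?_ ht
    · filter_upwards [hc] with ω hω
      exact hω.comp_continuous (continuous_apply j)
    · simp only [Matrix.mul_assoc]
      exact (continuous_exp_sub_smul_mul A (A * B) t i j).neg
  filter_upwards [e₀, e, key, hc] with ω h0 h1 h2 h3
  ext i
  have hint : (∫ s in t₀..t, (NormedSpace.exp ((t - s) • A) * A) *ᵥ (B *ᵥ L s ω)) i =
      ∑ j, ∫ s in t₀..t, (NormedSpace.exp ((t - s) • A) * A * B) i j * L s ω j := by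
    simp only [Matrix.mulVec_mulVec]
    refine eval_intervalIntegral_mulVec_cadlag (fun i j => ?_) h3 t₀ t i
    simp only [Matrix.mul_assoc]
    exact continuous_exp_sub_smul_mul A (A * B) t i j
  have hJi : ∀ j, J i j ω = ∑ p, E i p * J₀ p j ω + (B i j * L t ω j - (E * B) i j * L t₀ ω j +
      ∫ s in t₀..t, (NormedSpace.exp ((t - s) • A) * A * B) i j * L s ω j) := by
    intro j
    have := h2 i j
    simp only [sub_self, zero_smul, NormedSpace.exp_zero, Matrix.one_mul, neg_mul,
      intervalIntegral.integral_neg, Finset.sum_neg_distrib, ← hE] at this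
    linarith
  rw [h1 i, Pi.add_apply, Pi.add_apply, hint, Matrix.mulVec_sub, Matrix.mulVec_mulVec,
    Finset.sum_congr rfl fun j _ => hJi j]
  simp only [Finset.sum_add_distrib, Finset.sum_sub_distrib, Pi.sub_apply, Matrix.mulVec,
    dotProduct, h0, Finset.mul_sum]
  rw [Finset.sum_comm]
  ring

end StationarySolution

/-! ### Solutions of the decoupled state equation -/

section DecoupledSolutions

variable {Ω : Type*} [MeasurableSpace Ω] {P : Measure Ω}

/-- A process with almost surely càdlàg paths agrees almost surely with a process all of whose paths
are càdlàg. -/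
lemma exists_cadlag_modification {m : ℕ} {L : ℝ → Ω → Fin m → ℝ} (hm : ∀ t, Measurable (L t))
    (hc : ∀ᵐ ω ∂P, IsCadlag fun t => L t ω) :
    ∃ L' : ℝ → Ω → Fin m → ℝ, (∀ t, Measurable (L' t)) ∧ (∀ ω, IsCadlag fun t => L' t ω) ∧
      ∀ᵐ ω ∂P, ∀ t, L' t ω = L t ω := by
  set s := toMeasurable P {ω | ¬ IsCadlag fun t => L t ω} with hs
  have hs0 : P s = 0 := by
    rw [hs, measure_toMeasurable]
    exact hc
  refine ⟨fun t => sᶜ.indicator (L t),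
    fun t => (hm t).indicator (measurableSet_toMeasurable _ _).compl, fun ω => ?_, ?_⟩
  · by_cases hω : ω ∈ s
    · simp only [Set.indicator_of_notMem (Set.notMem_compl_iff.2 hω)]
      exact fun t => ⟨continuousWithinAt_const, 0, tendsto_const_nhds⟩
    · simp only [Set.indicator_of_mem (Set.mem_compl hω)]
      by_contra hne
      exact hω (subset_toMeasurable _ _ hne)
  · filter_upwards [measure_eq_zero_iff_ae_notMem.1 hs0] with ω hω t
    exact Set.indicator_of_mem hω _

/-- The time integral of a càdlàg process against a continuous function is a limit of
Riemann–Stieltjes sums and therefore measurable. -/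
lemma measurable_integral_mul_cadlag {φ : ℝ → ℝ} (hφ : Continuous φ) {y : ℝ → Ω → ℝ}
    (hm : ∀ t, Measurable (y t)) (hc : ∀ ω, IsCadlag fun t => y t ω) {a b : ℝ} (hab : a ≤ b) :
    Measurable fun ω => ∫ s in a..b, φ s * y s ω := by
  set F : ℝ → ℝ := fun u => ∫ s in (0 : ℝ)..u, φ s
  have hF : ∀ u, HasDerivAt F (φ u) u := fun u => hφ.integral_hasStrictDerivAt 0 u |>.hasDerivAt
  have hlim : Measurable fun ω => F b * y b ω - F a * y a ω - ∫ s in a..b, φ s * y s ω := by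
    refine measurable_of_tendsto_metrizable (f := fun k ω => ∑ i ∈ Finset.range (k + 1),
      F (grid a b k i) * (y (grid a b k (i + 1)) ω - y (grid a b k i) ω)) (fun k => ?_)
      (tendsto_pi_nhds.2 fun ω => (hc ω).tendsto_sum_mul_sub hF hφ hab)
    exact Finset.measurable_sum _ fun i _ => ((hm _).sub (hm _)).const_mul _
  convert ((((hm b).const_mul (F b)).sub ((hm a).const_mul (F a))).sub hlim) using 1
  ext1 ω
  exact (sub_sub_cancel _ _).symm

lemma measurable_integral_mulVec_cadlag {κ : Type*} [Fintype κ] {ι : Type} [Fintype ι]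
    {M : ℝ → Matrix κ ι ℝ} (hM : ∀ i j, Continuous fun t => M t i j) {y : ℝ → Ω → ι → ℝ}
    (hm : ∀ t, Measurable (y t)) (hc : ∀ ω, IsCadlag fun t => y t ω) {a b : ℝ} (hab : a ≤ b) :
    Measurable fun ω => ∫ s in a..b, M s *ᵥ y s ω := by
  refine measurable_pi_lambda _ fun i => ?_
  simp only [eval_intervalIntegral_mulVec_cadlag hM (hc _)]
  exact Finset.measurable_sum _ fun j _ => measurable_integral_mul_cadlag (hM i j)
    (fun t => (measurable_pi_apply j).comp (hm t))
    (fun ω => (hc ω).comp_continuous (continuous_apply j)) hab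

lemma measurable_mulVec {κ ι : Type*} [Fintype κ] [Fintype ι] (M : Matrix κ ι ℝ) {f : Ω → ι → ℝ}
    (hf : Measurable f) : Measurable fun ω => M *ᵥ f ω :=
  (continuous_const.matrix_mulVec continuous_id).measurable.comp hf

namespace DecoupledModel

variable {d m c n : ℕ}

/-- The state equation of a decoupled model splits into its two blocks. -/
lemma stateEquation_iff (M : DecoupledModel d m c n) {x : ℝ → Fin c ⊕ Fin n → ℝ}
    {ℓ : ℝ → Fin m → ℝ} {t₀ t : ℝ} :
    (IntervalIntegrable x volume t₀ t ∧
      x t = x t₀ + (∫ s in t₀..t, M.toModel.A *ᵥ x s) + M.toModel.B *ᵥ (ℓ t - ℓ t₀)) ↔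
    (IntervalIntegrable (fun s i => x s (Sum.inl i)) volume t₀ t ∧
      (fun i => x t (Sum.inl i)) = (fun i => x t₀ (Sum.inl i)) + M.B₁ *ᵥ (ℓ t - ℓ t₀)) ∧
    (IntervalIntegrable (fun s i => x s (Sum.inr i)) volume t₀ t ∧
      (fun i => x t (Sum.inr i)) = (fun i => x t₀ (Sum.inr i)) +
        (∫ s in t₀..t, M.A₂ *ᵥ fun i => x s (Sum.inr i)) +
        (M.B₂ *ᵥ ℓ t - M.B₂ *ᵥ ℓ t₀)) := by
  have hI : IntervalIntegrable x volume t₀ t ↔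
      IntervalIntegrable (fun s i => x s (Sum.inl i)) volume t₀ t ∧
      IntervalIntegrable (fun s i => x s (Sum.inr i)) volume t₀ t := by
    refine ⟨fun h => ⟨intervalIntegrable_of_eval fun i => eval_intervalIntegrable h _,
      intervalIntegrable_of_eval fun i => eval_intervalIntegrable h _⟩, fun h =>
      intervalIntegrable_of_eval fun i => ?_⟩
    rcases i with i | i
    · exact eval_intervalIntegrable h.1 i
    · exact eval_intervalIntegrable h.2 i
  have hmain : IntervalIntegrable x volume t₀ t →
      (x t = x t₀ + (∫ s in t₀..t, M.toModel.A *ᵥ x s) + M.toModel.B *ᵥ (ℓ t - ℓ t₀) ↔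
      (fun i => x t (Sum.inl i)) = (fun i => x t₀ (Sum.inl i)) + M.B₁ *ᵥ (ℓ t - ℓ t₀) ∧
      (fun i => x t (Sum.inr i)) = (fun i => x t₀ (Sum.inr i)) +
        (∫ s in t₀..t, M.A₂ *ᵥ fun i => x s (Sum.inr i)) +
        (M.B₂ *ᵥ ℓ t - M.B₂ *ᵥ ℓ t₀)) := by
    intro h
    have hA := (StateSpaceModel.intervalIntegral_mulVec M.toModel.A h).1
    have hA₂ := (StateSpaceModel.intervalIntegral_mulVec M.A₂ (hI.1 h).2).1
    have hvec : ∀ s, M.toModel.A *ᵥ x s =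
        Sum.elim (0 : Fin c → ℝ) (M.A₂ *ᵥ fun i => x s (Sum.inr i)) := by
      intro s
      rw [toModel, Matrix.fromBlocks_mulVec]
      simp only [Matrix.zero_mulVec, zero_add]
      rfl
    have hl : ∀ i, (∫ s in t₀..t, M.toModel.A *ᵥ x s) (Sum.inl i) = 0 := by
      intro i
      rw [eval_intervalIntegral hA]
      simp [hvec]
    have hr : ∀ i, (∫ s in t₀..t, M.toModel.A *ᵥ x s) (Sum.inr i) =
        (∫ s in t₀..t, M.A₂ *ᵥ fun i => x s (Sum.inr i)) i := by
      intro i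
      rw [eval_intervalIntegral hA, eval_intervalIntegral hA₂]
      simp [hvec]
    have hB : M.toModel.B = Matrix.fromRows M.B₁ M.B₂ := rfl
    rw [← Matrix.mulVec_sub]
    simp only [funext_iff, Sum.forall, Pi.add_apply, hl, hr, hB, Matrix.fromRows_mulVec,
      Sum.elim_inl, Sum.elim_inr, add_zero]
  constructor
  · rintro ⟨h1, h2⟩
    have := (hmain h1).1 h2
    exact ⟨⟨(hI.1 h1).1, this.1⟩, (hI.1 h1).2, this.2⟩
  · rintro ⟨⟨h1, h2⟩, h3, h4⟩
    exact ⟨hI.2 ⟨h1, h3⟩, (hmain (hI.2 ⟨h1, h3⟩)).2 ⟨h2, h4⟩⟩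

/-- The decoupled state equation is solvable for every initial value. The solution is built from a
modification of the driving process with càdlàg paths, which makes it measurable. -/
lemma exists_isStateSolution (M : DecoupledModel d m c n) {L : ℝ → Ω → Fin m → ℝ}
    (hm : ∀ t, Measurable (L t)) (hc : ∀ᵐ ω ∂P, IsCadlag fun t => L t ω) (t₀ : ℝ)
    {ξ : Ω → Fin c → ℝ} (hξ : Measurable ξ) {z : Ω → Fin n → ℝ} (hz : AEMeasurable z P) :
    ∃ X : ℝ → Ω → (Fin c ⊕ Fin n) → ℝ, M.toModel.IsStateSolution P L t₀ X ∧
      ∀ᵐ ω ∂P, X t₀ ω = Sum.elim (ξ ω) (z ω) := by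
  obtain ⟨L', hm', hc', hLL'⟩ := exists_cadlag_modification hm hc
  set x : ℝ → Ω → Fin n → ℝ := fun s ω => M.B₂ *ᵥ L' s ω
  have hxm : ∀ t, Measurable (x t) := fun t => measurable_mulVec _ (hm' t)
  have hxc : ∀ ω, IsCadlag fun t => x t ω := fun ω =>
    (hc' ω).comp_continuous (continuous_const.matrix_mulVec continuous_id)
  set X₁ : ℝ → Ω → Fin c → ℝ := fun t ω => ξ ω + M.B₁ *ᵥ (L' t ω - L' t₀ ω)
  set X₂ : ℝ → Ω → Fin n → ℝ := fun t ω =>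
    NormedSpace.exp ((t - t₀) • M.A₂) *ᵥ (hz.mk z ω - x t₀ ω) + x t ω +
      ∫ s in t₀..t, (NormedSpace.exp ((t - s) • M.A₂) * M.A₂) *ᵥ x s ω
  have hX₂ : ∀ ω t, t₀ ≤ t → _ := fun ω t ht => variation_of_constants_solves M.A₂ (hxc ω) t₀
    (hz.mk z ω) (X := fun t => X₂ t ω) (fun _ => rfl) ht
  refine ⟨fun t ω => Sum.elim (X₁ t ω) (X₂ t ω), ⟨fun t ht => ?_, ?_⟩, ?_⟩
  · refine measurable_pi_lambda _ fun i => ?_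
    have h1 : Measurable (X₁ t) := hξ.add (measurable_mulVec _ ((hm' t).sub (hm' t₀)))
    have h2 : Measurable (X₂ t) :=
      ((measurable_mulVec _ (hz.measurable_mk.sub (hxm t₀))).add (hxm t)).add
        (measurable_integral_mulVec_cadlag
          (fun i j => continuous_exp_sub_smul_mul_apply M.A₂ t i j) hxm hxc ht)
    rcases i with i | i
    · exact (measurable_pi_apply i).comp h1
    · exact (measurable_pi_apply i).comp h2
  · filter_upwards [hLL'] with ω hω t ht
    rw [← hω t, ← hω t₀]
    refine (M.stateEquation_iff (x := fun t => Sum.elim (X₁ t ω) (X₂ t ω))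
      (ℓ := fun t => L' t ω)).2 ⟨⟨?_, ?_⟩, (hX₂ ω t ht).2⟩
    · refine IsCadlag.intervalIntegrable ((hc' ω).comp_continuous
        (φ := fun v => ξ ω + M.B₁ *ᵥ (v - L' t₀ ω)) ?_) t₀ t
      exact continuous_const.add
        (continuous_const.matrix_mulVec (continuous_id.sub continuous_const))
    · ext i
      simp [X₁]
  · filter_upwards [hz.ae_eq_mk] with ω hω
    have h1 : X₁ t₀ ω = ξ ω := by simp [X₁]
    have h2 : X₂ t₀ ω = z ω := by rw [hω]; exact (hX₂ ω t₀ le_rfl).1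
    rw [h1, h2]

/-- Solutions of the decoupled state equation are explicit: the first block is driven by `B₁ L`,
the second one obeys the formula of variation of constants. -/
lemma ae_eq_of_isStateSolution (M : DecoupledModel d m c n) {L : ℝ → Ω → Fin m → ℝ}
    (hc : ∀ᵐ ω ∂P, IsCadlag fun t => L t ω) {t₀ : ℝ} {X : ℝ → Ω → (Fin c ⊕ Fin n) → ℝ}
    (hX : M.toModel.IsStateSolution P L t₀ X) :
    ∀ᵐ ω ∂P, ∀ t, t₀ ≤ t →
      (fun i => X t ω (Sum.inl i)) =
        (fun i => X t₀ ω (Sum.inl i)) + M.B₁ *ᵥ (L t ω - L t₀ ω) ∧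
      (fun i => X t ω (Sum.inr i)) = NormedSpace.exp ((t - t₀) • M.A₂) *ᵥ
        ((fun i => X t₀ ω (Sum.inr i)) - M.B₂ *ᵥ L t₀ ω) + M.B₂ *ᵥ L t ω +
        ∫ s in t₀..t, (NormedSpace.exp ((t - s) • M.A₂) * M.A₂) *ᵥ (M.B₂ *ᵥ L s ω) := by
  filter_upwards [hX.2, hc] with ω hω hcω t ht
  have h := fun t ht => (M.stateEquation_iff (x := fun t => X t ω) (ℓ := fun t => L t ω)).1 (hω t ht)
  refine ⟨(h t ht).1.2, ?_⟩
  exact eq_variation_of_constants (X := fun t i => X t ω (Sum.inr i))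
    (hcω.comp_continuous (φ := fun v => M.B₂ *ᵥ v)
      (continuous_const.matrix_mulVec continuous_id)) (fun t ht => (h t ht).2) ht

end DecoupledModel

end DecoupledSolutions

theorem mainTheorem1 {d m N c : ℕ} (hcd : c ≤ d)
    (S : StateSpaceModel d m (Fin N)) (hmin : S.IsMinimal)
    (hspec : ∀ μ ∈ spectrum ℂ (S.A.map (algebraMap ℝ ℂ)), μ.re < 0 ∨ μ = 0)
    (halg : S.A.charpoly.rootMultiplicity 0 = c)
    (hgeo : Module.finrank ℝ (Module.End.eigenspace (Matrix.toLin' S.A) 0) = c)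
    (K : ∀ n : ℕ, StateSpaceModel d m (Fin n) → Prop) (hK : IsCanonicalForm K)
    {Ω : Type*} [MeasurableSpace Ω] (P : Measure Ω) [IsProbabilityMeasure P]
    (L : ℝ → Ω → Fin m → ℝ) (hL : IsDrivingLevy L P) :
    -- existence and uniqueness of the canonical form
    (∃! M : DecoupledModel d m c (N - c), M.IsCanonicalFormOf K S) ∧
    ∀ M : DecoupledModel d m c (N - c), M.IsCanonicalFormOf K S →
      -- it describes the same output processes
      (∀ t₀ : ℝ, 0 ≤ t₀ → ∀ Y : ℝ → Ω → Fin d → ℝ,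
        S.IsOutput P L t₀ Y ↔ M.toModel.IsOutput P L t₀ Y) ∧
      -- `C₁ B₁ L` is a Lévy process
      IsLevy (fun t ω => (M.C₁ * M.B₁) *ᵥ L t ω) P ∧
      -- `Z(t) = ∫_{-∞}^t exp(A₂ (t - u)) B₂ dL(u)` exists for all `t`
      (∃ Z : ℝ → Ω → Fin (N - c) → ℝ, ∀ t, HasLevyIntegralIic P L t
        (fun u => NormedSpace.exp ((t - u) • M.A₂) * M.B₂) (Z t)) ∧
      ∀ Z : ℝ → Ω → Fin (N - c) → ℝ,
        (∀ t, HasLevyIntegralIic P L t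
          (fun u => NormedSpace.exp ((t - u) • M.A₂) * M.B₂) (Z t)) →
        IsStrictlyStationary P Z ∧
        IsStrictlyStationary P (fun t ω => M.C₂ *ᵥ Z t ω) ∧
        ∀ t₀ : ℝ, 0 ≤ t₀ →
          -- for each `X₁(t₀)` there is a solution with `X₂(t₀) = Z(t₀)`
          (∀ ξ : Ω → Fin c → ℝ, Measurable ξ →
            ∃ X : ℝ → Ω → (Fin c ⊕ Fin (N - c)) → ℝ, M.toModel.IsStateSolution P L t₀ X ∧
              ∀ᵐ ω ∂P, X t₀ ω = Sum.elim (ξ ω) (Z t₀ ω)) ∧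
          -- and each such solution has the asserted representation
          ∀ (X : ℝ → Ω → (Fin c ⊕ Fin (N - c)) → ℝ) (Y : ℝ → Ω → Fin d → ℝ),
            M.toModel.IsStateSolution P L t₀ X → M.toModel.IsOutputOf P t₀ X Y →
            (∀ᵐ ω ∂P, (fun i => X t₀ ω (Sum.inr i)) = Z t₀ ω) →
            ∀ t, t₀ ≤ t →
              (∀ᵐ ω ∂P, (fun i => X t ω (Sum.inr i)) = Z t ω) ∧
              (∀ᵐ ω ∂P, Y t ω = M.C₁ *ᵥ (fun i => X t₀ ω (Sum.inl i)) +
                (M.C₁ * M.B₁) *ᵥ (L t ω - L t₀ ω) + M.C₂ *ᵥ Z t ω) ∧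
              (t₀ = 0 → ∀ᵐ ω ∂P, Y t ω = M.C₁ *ᵥ (fun i => X 0 ω (Sum.inl i)) +
                (M.C₁ * M.B₁) *ᵥ L t ω + M.C₂ *ᵥ Z t ω) := by
  have hL2 := hL.exists_isL2Noise
  have hc := hL.isLevy.cadlag
  refine ⟨DecoupledModel.existsUnique_isCanonicalFormOf hmin hspec halg hgeo hK, fun M hM =>
    ⟨fun t₀ _ Y => hM.obsEquiv.isOutput_iff P L t₀ Y, hL.isLevy.mulVec _, ?_, fun Z hZ => ?_⟩⟩
  · choose Z hZ using fun t => exists_hasLevyIntegralIic hL2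
      fun i j => memLp_kernel hM.exp_lt_one M.B₂ t i j
    exact ⟨Z, hZ⟩
  have hstat := isStrictlyStationary_of_hasLevyIntegralIic_exp hL.isLevy hL2 hM.exp_lt_one M.B₂ hZ
  have hZm : ∀ t, AEMeasurable (Z t) P := by
    intro t
    have := (hstat 1 (fun _ => t) 0).aemeasurable_snd
    exact aemeasurable_pi_iff.1 this 0
  refine ⟨hstat, hstat.mulVec M.C₂, fun t₀ _ => ⟨fun ξ hξ =>
    M.exists_isStateSolution hL.isLevy.measurable hc t₀ hξ (hZm t₀), fun X Y hX hY h₀ t ht => ?_⟩⟩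
  have hX₂ : ∀ᵐ ω ∂P, (fun i => X t ω (Sum.inr i)) = Z t ω := by
    filter_upwards [M.ae_eq_of_isStateSolution hc hX, h₀,
      HasLevyIntegralIic.ae_eq_variation_of_constants hL2 hc ht (hZ t₀) (hZ t)] with ω h1 h2 h3
    rw [(h1 t ht).2, h2, h3]
  have hYt : ∀ᵐ ω ∂P, Y t ω = M.C₁ *ᵥ (fun i => X t₀ ω (Sum.inl i)) +
      (M.C₁ * M.B₁) *ᵥ (L t ω - L t₀ ω) + M.C₂ *ᵥ Z t ω := by
    filter_upwards [M.ae_eq_of_isStateSolution hc hX, hX₂, hY] with ω h1 h2 h3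
    have h4 : X t ω = Sum.elim (fun i => X t ω (Sum.inl i)) (fun i => X t ω (Sum.inr i)) := by
      ext i; rcases i with i | i <;> rfl
    rw [h3 t ht, DecoupledModel.toModel, h4, Matrix.fromCols_mulVec_sumElim, (h1 t ht).1, h2,
      Matrix.mulVec_add, Matrix.mulVec_mulVec]
  refine ⟨hX₂, hYt, ?_⟩
  rintro rfl
  filter_upwards [hYt, hL.isLevy.zero] with ω h1 h2
  rw [h1, h2, sub_zero]

end
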